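/- Let $G$ be a discrete group and let $\mathcal F$ be the family of finite subgroups of $G$. Let $\mathcal O_{\mathcal F}G$ be the orbit category, with objects the $G$-sets $G/H$ ($H\in\mathcal F$) and morphisms the $G$-maps; a (right) $\mathcal O_{\mathcal F}G$-module is a contravariant functor from $\mathcal O_{\mathcal F}G$ to abelian groups. For such a module $M$, the Bredon cohomology $H^n_{\mathcal F}(G,M)$ is the $n$-th cohomology of the cochain complex $\mathrm{Hom}_{\mathcal O_{\mathcal F}G}(P_*,M)$, where $P_*$ is a projective resolution of the constant module $\underline{\mathbb Z}$. For $K\in\mathcal F$ let $P_K=\mathbb Z[-,G/K]$ be the free module at $G/K$, let $N_K\subseteq P_K$ be the submodule generated by the values $P_K(G/H)$ for all $H\in\mathcal F$ that are conjugate to a proper subgroup of $K$, and let $Q_K=P_K/N_K$. For a CW-complex $Y$ with subcomplex $A$ (with $Y$ locally finite) let $C_*(Y)$ be the cellular chain complex, and let $C_c^n(Y,A)$ be the group of homomorphisms $C_n(Y)\to\mathbb Z$ that vanish on all but finitely many $n$-cells of $Y$ and that restrict to zero on $C_n(A)$. The relative cohomology with compact support $H_c^n(Y,A)$ is the $n$-th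 cohomology of $C_c^*(Y,A)$. **Theorem.** Let $X$ be a cocompact model for the classifying space for proper actions $\underline{E}G$, that is, a $G$-CW-complex with finite point stabilizers and compact orbit space $G\backslash X$ such that the fixed point set $X^H$ is contractible for every finite subgroup $H$ of $G$. For $K\in\mathcal F$ put $$X^K_{\mathrm{sing}}=\bigcup_{K\subsetneq L\in\mathcal F}X^L\subseteq X^K .$$ Then for every $K\in\mathcal F$ and every $n\ge 0$ there is an isomorphism of abelian groups $$H^n_{\mathcal F}(G,Q_K)\;\cong\;H^n_c\bigl(X^K,X^K_{\mathrm{sing}}\bigr).$$ -/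

import Mathlib

open CategoryTheory Opposite Topology Set

universe u

noncomputable section

/-! ## Modules over the orbit category and Bredon cohomology -/

namespace Bredon

/-- The orbit category of `G` relative to the family of finite subgroups: an object is a finite
subgroup `H`, standing for the left `G`-set `G ⧸ H`. -/
structure OrbitCat (G : Type u) [Group G] : Type u where
  subgroup : Subgroup G
  finite : Finite subgroup

/-- Morphisms of the orbit category are the `G`-equivariant maps `G ⧸ H → G ⧸ K`. -/
instance (G : Type u) [Group G] : Category.{u} (OrbitCat G) where
  Hom H K := (G ⧸ H.subgroup) →[G] (G ⧸ K.subgroup)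
  id H := MulActionHom.id G
  comp f g := MulActionHom.comp g f

/-- The category of right modules over the orbit category: contravariant functors to abelian
groups, with natural transformations. -/
abbrev OrbitMod (G : Type u) [Group G] : Type (u + 1) :=
  (OrbitCat G)ᵒᵖ ⥤ AddCommGrpCat.{u}

variable {G : Type u} [Group G]

/-- The free module `P_K = ℤ[-, G ⧸ K]`. -/
def freeMod (K : OrbitCat G) : OrbitMod G where
  obj L := AddCommGrpCat.of ((L.unop ⟶ K) →₀ ℤ)
  map f := AddCommGrpCat.ofHom (Finsupp.mapDomain.addMonoidHom fun g ↦ f.unop ≫ g)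
  map_id L := by
    ext x
    simp
  map_comp f g := by
    ext x
    simp

/-- `H` is conjugate to a proper subgroup of `K`. -/
def IsConjToProper (H K : Subgroup G) : Prop :=
  ∃ g : G, H.map (MulAut.conj g).toMonoidHom < K

/-- The value at `G ⧸ L` of the submodule `N_K` of `P_K` generated by the values of `P_K` at all
`G ⧸ H` with `H` finite and conjugate to a proper subgroup of `K`. -/
def properSub (K : OrbitCat G) (L : (OrbitCat G)ᵒᵖ) : AddSubgroup ((freeMod K).obj L) :=
  AddSubgroup.closure
    {y | ∃ (H : OrbitCat G) (_ : IsConjToProper H.subgroup K.subgroup) (f : L.unop ⟶ H)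
        (x : (freeMod K).obj (op H)), y = (freeMod K).map f.op x}

theorem properSub_le (K : OrbitCat G) {L M : (OrbitCat G)ᵒᵖ} (f : L ⟶ M) :
    properSub K L ≤ (properSub K M).comap ((freeMod K).map f).hom := by
  refine (AddSubgroup.closure_le _).2 ?_
  rintro _ ⟨H, hH, g, x, rfl⟩
  refine AddSubgroup.subset_closure ⟨H, hH, f.unop ≫ g, x, ?_⟩
  have := congrArg (fun φ ↦ φ.hom x) ((freeMod K).map_comp g.op f)
  exact this.symm

/-- The quotient module `Q_K = P_K / N_K`. -/
def quotMod (K : OrbitCat G) : OrbitMod G where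
  obj L := AddCommGrpCat.of ((freeMod K).obj L ⧸ properSub K L)
  map {L M} f := AddCommGrpCat.ofHom
    (QuotientAddGroup.map (properSub K L) (properSub K M) ((freeMod K).map f).hom
      (properSub_le K f))
  map_id L := by
    refine AddCommGrpCat.hom_ext (QuotientAddGroup.addMonoidHom_ext _ ?_)
    ext1 x
    simp
  map_comp f g := by
    refine AddCommGrpCat.hom_ext (QuotientAddGroup.addMonoidHom_ext _ ?_)
    ext1 x
    simp

/-- The trivial module: the constant functor `ℤ`. -/
def trivMod (G : Type u) [Group G] : OrbitMod G :=
  (Functor.const _).obj (AddCommGrpCat.of (ULift.{u} ℤ))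

/-- The Yoneda morphism `P_H ⟶ M` attached to an element of `M(G ⧸ H)`. -/
def freeDesc (H : OrbitCat G) (M : OrbitMod G) (m : M.obj (op H)) : freeMod H ⟶ M where
  app L := AddCommGrpCat.ofHom
    (Finsupp.liftAddHom fun g : L.unop ⟶ H ↦ (zmultiplesHom (M.obj L)) ((M.map g.op).hom m))
  naturality L L' f := by
    refine AddCommGrpCat.hom_ext (Finsupp.addHom_ext' fun g ↦ AddMonoidHom.ext_int ?_)
    simp [freeMod]

theorem freeDesc_single (H : OrbitCat G) (M : OrbitMod G) (m : M.obj (op H))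
    (L : (OrbitCat G)ᵒᵖ) (g : L.unop ⟶ H) :
    ((freeDesc H M m).app L).hom (Finsupp.single g (1 : ℤ)) = (M.map g.op).hom m :=
  (Finsupp.liftAddHom_apply_single (fun g : L.unop ⟶ H ↦
    (zmultiplesHom (M.obj L)) ((M.map g.op).hom m)) g (1 : ℤ)).trans (one_zsmul _)

theorem freeMod_map_single (H : OrbitCat G) (L : (OrbitCat G)ᵒᵖ) (g : L.unop ⟶ H) :
    ((freeMod H).map g.op).hom (Finsupp.single (𝟙 H) (1 : ℤ)) = Finsupp.single g (1 : ℤ) :=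
  (Finsupp.mapDomain_single (f := fun g' : H ⟶ H ↦ g ≫ g')).trans (by rw [Category.comp_id])

instance (H : OrbitCat G) : Projective (freeMod H) where
  factors {E M} f e _ := by
    have he : Function.Surjective (e.app (op H)) :=
      (AddCommGrpCat.epi_iff_surjective _).1 inferInstance
    obtain ⟨m, hm⟩ := he ((f.app (op H)).hom (Finsupp.single (𝟙 H) (1 : ℤ)))
    refine ⟨freeDesc H E m, ?_⟩
    ext L : 2
    refine AddCommGrpCat.hom_ext (Finsupp.addHom_ext' fun g ↦ AddMonoidHom.ext_int ?_)
    have h1 := congrArg (fun φ ↦ φ.hom m) (e.naturality g.op)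
    have h2 := congrArg (fun φ ↦ φ.hom (Finsupp.single (𝟙 H) (1 : ℤ))) (f.naturality g.op)
    change (e.app L).hom (((freeDesc H E m).app L).hom (Finsupp.single g (1 : ℤ))) =
      (f.app L).hom (Finsupp.single g (1 : ℤ))
    rw [freeDesc_single, ← freeMod_map_single]
    refine h1.trans (Eq.trans ?_ h2.symm)
    exact congrArg (M.map g.op).hom hm

/-- Every module is a quotient of a direct sum of free modules `P_H`. -/
instance : EnoughProjectives (OrbitMod G) where
  presentation M := by
    let F : (Σ H : OrbitCat G, M.obj (op H)) → OrbitMod G := fun i ↦ freeMod i.1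
    let p : ∐ F ⟶ M := Limits.Sigma.desc fun i ↦ freeDesc i.1 M i.2
    have : Epi p := by
      rw [NatTrans.epi_iff_epi_app]
      intro L
      rw [AddCommGrpCat.epi_iff_surjective]
      intro m
      have h := Limits.Sigma.ι_desc (fun i : (Σ H : OrbitCat G, M.obj (op H)) ↦
        freeDesc i.1 M i.2) ⟨L.unop, m⟩
      refine ⟨((Limits.Sigma.ι F ⟨L.unop, m⟩).app L).hom (Finsupp.single (𝟙 L.unop) (1 : ℤ)), ?_⟩
      have h' := congrArg (fun φ ↦ (φ.app L).hom (Finsupp.single (𝟙 L.unop) (1 : ℤ))) h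
      refine h'.trans ((freeDesc_single L.unop M m L (𝟙 _)).trans ?_)
      simp
    exact ⟨{ p := ∐ F, f := p }⟩

/-- The `n`-th Bredon cohomology of `G` (for the family of finite subgroups) with coefficients in
`M`: the cohomology of `Hom(P_*, M)` for a projective resolution `P_*` of the constant module `ℤ`. -/
def cohomology (n : ℕ) (M : OrbitMod G) : ModuleCat.{u} ℤ :=
  ((Ext ℤ (OrbitMod G) n).obj (op (trivMod G))).obj M

end Bredon

/-! ## Relative singular homology of pairs of subspaces -/

namespace RelSing

variable {X Y Z : Type u} [TopologicalSpace X] [TopologicalSpace Y] [TopologicalSpace Z]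

/-- The integral singular chain complex of a space. -/
abbrev chains (X : Type u) [TopologicalSpace X] : ChainComplex AddCommGrpCat.{u} ℕ :=
  ((AlgebraicTopology.singularChainComplexFunctor AddCommGrpCat.{u}).obj
    (AddCommGrpCat.of (ULift.{u} ℤ))).obj (TopCat.of X)

/-- The chain map induced by a continuous map. -/
abbrev chainsMap (f : C(X, Y)) : chains X ⟶ chains Y :=
  ((AlgebraicTopology.singularChainComplexFunctor AddCommGrpCat.{u}).obj
    (AddCommGrpCat.of (ULift.{u} ℤ))).map (TopCat.ofHom f)

/-- The map `f_#` on singular `n`-chains. -/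
abbrev push (f : C(X, Y)) (n : ℕ) : (chains X).X n →+ (chains Y).X n :=
  ((chainsMap f).f n).hom

/-- The singular differential from degree `n` to degree `m` (zero unless `m + 1 = n`). -/
abbrev diff (X : Type u) [TopologicalSpace X] (n m : ℕ) : (chains X).X n →+ (chains X).X m :=
  ((chains X).d n m).hom

theorem push_comp (g : C(Y, Z)) (f : C(X, Y)) (n : ℕ) (c : (chains X).X n) :
    push (g.comp f) n c = push g n (push f n c) := by
  have e : chainsMap (g.comp f) = chainsMap f ≫ chainsMap g := by
    simp only [chainsMap, ← Functor.map_comp]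
    rfl
  simp only [push]
  rw [e]
  rfl

theorem diff_push (f : C(X, Y)) (n m : ℕ) (c : (chains X).X n) :
    diff Y n m (push f n c) = push f m (diff X n m c) :=
  congrArg (fun φ ↦ φ.hom c) ((chainsMap f).comm n m)

theorem diff_diff (n m k : ℕ) (c : (chains X).X n) : diff X m k (diff X n m c) = 0 :=
  congrArg (fun φ ↦ φ.hom c) ((chains X).d_comp_d n m k)

/-- The singular `n`-chains of `X` that lie in the subspace `A`. -/
def chainsIn (A : Set X) (n : ℕ) : AddSubgroup ((chains X).X n) :=
  (push (⟨Subtype.val, continuous_subtype_val⟩ : C(A, X)) n).range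

/-- Relative cycles of `(A, B)`: chains in `A` whose boundary lies in `B`. -/
def relCycles (A B : Set X) (n : ℕ) : AddSubgroup ((chains X).X n) :=
  chainsIn A n ⊓ ⨅ j, (chainsIn B j).comap (diff X n j)

/-- Relative boundaries of `(A, B)`: boundaries of chains in `A` plus chains in `B`. -/
def relBoundaries (A B : Set X) (n : ℕ) : AddSubgroup ((chains X).X n) :=
  (chainsIn A (n + 1)).map (diff X (n + 1) n) ⊔ chainsIn B n

/-- The relative singular homology `H_n(A, B; ℤ)` for subspaces `B ⊆ A` of `X`. -/
abbrev relHomology (A B : Set X) (n : ℕ) : Type u :=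
  relCycles A B n ⧸ (relBoundaries A B n).addSubgroupOf (relCycles A B n)

theorem mem_relCycles {A B : Set X} {n : ℕ} {c : (chains X).X n} :
    c ∈ relCycles A B n ↔ c ∈ chainsIn A n ∧ ∀ j, diff X n j c ∈ chainsIn B j := by
  simp only [relCycles, AddSubgroup.mem_inf, AddSubgroup.mem_iInf, AddSubgroup.mem_comap]

theorem push_mem_chainsIn {A : Set X} {A' : Set Y} (f : C(X, Y)) (h : MapsTo f A A') {n : ℕ}
    {c : (chains X).X n} (hc : c ∈ chainsIn A n) : push f n c ∈ chainsIn A' n := by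
  obtain ⟨c, rfl⟩ := hc
  let g : C(A, A') := ⟨h.restrict f A A', f.continuous.continuousOn.mapsToRestrict h⟩
  refine ⟨push g n c, ?_⟩
  rw [← push_comp, ← push_comp]
  rfl

theorem push_mem_relCycles {A B : Set X} {A' B' : Set Y} (f : C(X, Y)) (hA : MapsTo f A A')
    (hB : MapsTo f B B') {n : ℕ} {c : (chains X).X n} (hc : c ∈ relCycles A B n) :
    push f n c ∈ relCycles A' B' n := by
  rw [mem_relCycles] at hc ⊢
  refine ⟨push_mem_chainsIn f hA hc.1, fun j ↦ ?_⟩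
  rw [diff_push]
  exact push_mem_chainsIn f hB (hc.2 j)

theorem push_mem_relBoundaries {A B : Set X} {A' B' : Set Y} (f : C(X, Y)) (hA : MapsTo f A A')
    (hB : MapsTo f B B') {n : ℕ} {c : (chains X).X n} (hc : c ∈ relBoundaries A B n) :
    push f n c ∈ relBoundaries A' B' n := by
  obtain ⟨_, ⟨y, hy, rfl⟩, b, hb, rfl⟩ := AddSubgroup.mem_sup.1 hc
  rw [map_add, ← diff_push]
  exact add_mem (AddSubgroup.mem_sup_left ⟨_, push_mem_chainsIn f hA hy, rfl⟩)
    (AddSubgroup.mem_sup_right (push_mem_chainsIn f hB hb))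

/-- The map `H_n(A, B) → H_n(A', B')` induced by a continuous map `(A, B) → (A', B')`. -/
def relHomologyMap {A B : Set X} {A' B' : Set Y} (f : C(X, Y)) (hA : MapsTo f A A')
    (hB : MapsTo f B B') (n : ℕ) : relHomology A B n →+ relHomology A' B' n :=
  QuotientAddGroup.map _ _
    (((push f n).comp (relCycles A B n).subtype).codRestrict (relCycles A' B' n)
      fun c ↦ push_mem_relCycles f hA hB c.2)
    fun _ hc ↦ push_mem_relBoundaries f hA hB hc

theorem diff_mem_relCycles {A B : Set X} (B' : Set X) {n m : ℕ} {c : (chains X).X n}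
    (hc : c ∈ relCycles A B n) : diff X n m c ∈ relCycles B B' m := by
  rw [mem_relCycles] at hc ⊢
  refine ⟨hc.2 m, fun j ↦ ?_⟩
  rw [diff_diff]
  exact zero_mem _

theorem diff_mem_relBoundaries {A B : Set X} (B' : Set X) {n : ℕ} {c : (chains X).X (n + 1)}
    (hc : c ∈ relBoundaries A B (n + 1)) : diff X (n + 1) n c ∈ relBoundaries B B' n := by
  obtain ⟨_, ⟨y, hy, rfl⟩, b, hb, rfl⟩ := AddSubgroup.mem_sup.1 hc
  rw [map_add, diff_diff, zero_add]
  exact AddSubgroup.mem_sup_left ⟨b, hb, rfl⟩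

/-- The connecting map `H_{n+1}(A, B) → H_n(B, B')` of a triple `B' ⊆ B ⊆ A`: the class of a
relative cycle `c` goes to the class of its boundary. -/
def connecting (A B B' : Set X) (n : ℕ) : relHomology A B (n + 1) →+ relHomology B B' n :=
  QuotientAddGroup.map _ _
    (((diff X (n + 1) n).comp (relCycles A B (n + 1)).subtype).codRestrict (relCycles B B' n)
      fun c ↦ diff_mem_relCycles B' c.2)
    fun _ hc ↦ diff_mem_relBoundaries B' hc

theorem connecting_connecting (A B B' B'' : Set X) (n : ℕ) (c : relHomology A B (n + 1 + 1)) :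
    connecting B B' B'' n (connecting A B B' (n + 1) c) = 0 := by
  obtain ⟨⟨c, hc⟩, rfl⟩ := QuotientAddGroup.mk_surjective c
  refine (QuotientAddGroup.eq_zero_iff _).2 ?_
  change diff X (n + 1) n (diff X (n + 1 + 1) (n + 1) c) ∈ relBoundaries B' B'' n
  rw [diff_diff]
  exact zero_mem _

end RelSing

/-! ## Cellular chains and compactly supported cohomology of pairs of subcomplexes -/

namespace Cellular

open RelSing Topology.CWComplex

variable {X : Type u} [TopologicalSpace X] [T2Space X] [CWComplex (univ : Set X)]

/-- The part of the subcomplex `E` in dimensions `< k`, that is, the `(k - 1)`-skeleton of `E`. -/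
def skel (E : Subcomplex (univ : Set X)) (k : ℕ) : Set X :=
  (E : Set X) ∩ (skeletonLT (univ : Set X) (k : ℕ∞) : Set X)

/-- The cellular chain group `C_n(E) = H_n(E_n, E_{n-1}; ℤ)` of a subcomplex. -/
abbrev cellularChains (E : Subcomplex (univ : Set X)) (n : ℕ) : Type u :=
  relHomology (skel E (n + 1)) (skel E n) n

/-- The cellular boundary map `C_{n+1}(E) → C_n(E)`. -/
def cellularBoundary (E : Subcomplex (univ : Set X)) (n : ℕ) :
    cellularChains E (n + 1) →+ cellularChains E n :=
  connecting (skel E (n + 2)) (skel E (n + 1)) (skel E n) n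

theorem cellularBoundary_cellularBoundary (E : Subcomplex (univ : Set X)) (n : ℕ)
    (c : cellularChains E (n + 1 + 1)) :
    cellularBoundary E n (cellularBoundary E (n + 1) c) = 0 :=
  connecting_connecting _ _ _ _ n c

/-- The map `C_n(A) → C_n(E)` induced by an inclusion of subcomplexes. -/
def cellularIncl {A E : Subcomplex (univ : Set X)} (h : A ≤ E) (n : ℕ) :
    cellularChains A n →+ cellularChains E n :=
  relHomologyMap (ContinuousMap.id X) (inter_subset_inter_left _ h) (inter_subset_inter_left _ h) n

/-- The closed `n`-disc. -/
abbrev Disc (n : ℕ) : Type u := ULift.{u} (Metric.closedBall (0 : Fin n → ℝ) 1)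

/-- The boundary sphere of the closed `n`-disc. -/
def discBoundary (n : ℕ) : Set (Disc.{u} n) := {z | z.down.1 ∈ Metric.sphere (0 : Fin n → ℝ) 1}

/-- The characteristic map of an `n`-cell. -/
def charMap {n : ℕ} (e : cell (univ : Set X) n) : C(Disc.{u} n, X) where
  toFun z := map n e z.down.1
  continuous_toFun :=
    (continuousOn_iff_continuous_domRestrict.1 (continuousOn (C := (univ : Set X)) n e)).comp
      continuous_uliftDown

/-- The map `H_n(Dⁿ, Sⁿ⁻¹) → C_n(E)` induced by the characteristic map of an `n`-cell of `E`. Its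
image is the infinite cyclic direct summand of `C_n(E)` spanned by this cell. -/
def cellMap (E : Subcomplex (univ : Set X)) {n : ℕ} (e : E.I n) :
    relHomology (univ : Set (Disc.{u} n)) (discBoundary n) n →+ cellularChains E n :=
  relHomologyMap (charMap e.1)
    (fun z _ ↦ by
      have hz : charMap e.1 z ∈ closedCell n e.1 := ⟨z.down.1, z.down.2, rfl⟩
      exact ⟨CWComplex.Subcomplex.closedCell_subset_of_mem E e.2 hz, by
        simpa using CWComplex.closedCell_subset_skeletonLT n e.1 hz⟩)
    (fun z h ↦ by
      have hz : charMap e.1 z ∈ cellFrontier n e.1 := ⟨z.down.1, h, rfl⟩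
      exact ⟨CWComplex.Subcomplex.cellFrontier_subset_of_mem E e.2 hz,
        CWComplex.cellFrontier_subset_skeletonLT n e.1 hz⟩) n

/-- The relative cellular cochains with compact support `C_cⁿ(E, A)`: the homomorphisms
`C_n(E) → ℤ` that vanish on all but finitely many `n`-cells of `E`, and restrict to zero on
`C_n(A)`. -/
def compactCochains {A E : Subcomplex (univ : Set X)} (h : A ≤ E) (n : ℕ) :
    AddSubgroup (cellularChains E n →+ ℤ) where
  carrier := {f | {e : E.I n | f.comp (cellMap E e) ≠ 0}.Finite ∧ f.comp (cellularIncl h n) = 0}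
  zero_mem' := by simp
  add_mem' := by
    rintro f g ⟨hf, hf'⟩ ⟨hg, hg'⟩
    refine ⟨(hf.union hg).subset fun e he ↦ ?_, by rw [AddMonoidHom.add_comp, hf', hg', add_zero]⟩
    by_contra hc
    simp only [mem_union, mem_ofPred_eq, not_or, not_not] at hc
    exact he (by rw [AddMonoidHom.add_comp, hc.1, hc.2, add_zero])
  neg_mem' := by
    rintro f ⟨hf, hf'⟩
    refine ⟨hf.subset fun e he hc ↦ he ?_, ?_⟩
    · rw [AddMonoidHom.neg_comp, hc, neg_zero]
    · rw [AddMonoidHom.neg_comp, hf', neg_zero]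

/-- The coboundary `f ↦ f ∘ ∂` on cellular cochains. -/
def coboundary (E : Subcomplex (univ : Set X)) (n : ℕ) :
    (cellularChains E n →+ ℤ) →+ (cellularChains E (n + 1) →+ ℤ) :=
  AddMonoidHom.compHom.flip (cellularBoundary E n)

theorem coboundary_apply (E : Subcomplex (univ : Set X)) (n : ℕ) (f : cellularChains E n →+ ℤ) :
    coboundary E n f = f.comp (cellularBoundary E n) :=
  rfl

/-- The cocycles of `C_c^*(E, A)`. -/
def compactCocycles {A E : Subcomplex (univ : Set X)} (h : A ≤ E) (n : ℕ) :
    AddSubgroup (cellularChains E n →+ ℤ) :=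
  compactCochains h n ⊓ (coboundary E n).ker

/-- The coboundaries of elements of `C_c^*(E, A)`. -/
def compactCoboundaries {A E : Subcomplex (univ : Set X)} (h : A ≤ E) :
    (n : ℕ) → AddSubgroup (cellularChains E n →+ ℤ)
  | 0 => ⊥
  | n + 1 => (compactCochains h n).map (coboundary E n)

/-- The relative cellular cohomology with compact support `H_cⁿ(E, A)`: cocycles modulo
coboundaries in `C_c^*(E, A)`. If `X` is locally finite, the coboundary preserves compactly
supported cochains, and this is the cohomology of the cochain complex `C_c^*(E, A)`. (In general
`addSubgroupOf` keeps only those coboundaries that are themselves compactly supported.) -/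
abbrev compactCohomology {A E : Subcomplex (univ : Set X)} (h : A ≤ E) (n : ℕ) : Type u :=
  compactCocycles h n ⧸ (compactCoboundaries h n).addSubgroupOf (compactCocycles h n)

end Cellular

/-! ## Proper `G`-CW-complexes and their fixed point subcomplexes -/

namespace GCW

open Topology.CWComplex
open scoped Pointwise

variable (G : Type u) [Group G] (X : Type u) [TopologicalSpace X] [MulAction G X]
  [CWComplex (univ : Set X)]

/-- `X` is a `G`-CW-complex (for the discrete group `G`): `G` acts by homeomorphisms, permutes the
open cells of each dimension, and an element that maps a cell to itself fixes it pointwise. -/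
structure IsGCWComplex : Prop where
  continuous_smul : ∀ g : G, Continuous fun x : X ↦ g • x
  permutes : ∀ (g : G) (n : ℕ) (e : cell (univ : Set X) n),
    ∃ e' : cell (univ : Set X) n, g • openCell n e = openCell n e'
  fixes : ∀ (g : G) (n : ℕ) (e : cell (univ : Set X) n), g • openCell n e = openCell n e →
    ∀ x ∈ openCell n e, g • x = x

/-- `X` is a cocompact classifying space for proper actions of `G`: a `G`-CW-complex with finite
point stabilizers and compact orbit space such that the fixed point set of every finite subgroup is
contractible. -/
structure IsCocompactModel : Prop extends IsGCWComplex G X where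
  finite_stabilizer : ∀ x : X, Finite (MulAction.stabilizer G x)
  contractible : ∀ H : Subgroup G, Finite H → ContractibleSpace (MulAction.fixedPoints H X)
  cocompact : CompactSpace (MulAction.orbitRel.Quotient G X)

variable {G X}

theorem openCell_subset_fixedPoints (hX : IsGCWComplex G X) (L : Subgroup G) {n : ℕ}
    (e : cell (univ : Set X) n) {x : X} (hx : x ∈ openCell n e)
    (hxL : x ∈ MulAction.fixedPoints L X) : openCell n e ⊆ MulAction.fixedPoints L X := by
  rintro y hy ⟨l, hl⟩
  refine hX.fixes l n e ?_ y hy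
  obtain ⟨e', he'⟩ := hX.permutes l n e
  have h1 : x ∈ openCell n e' := by
    rw [← he']
    exact ⟨x, hx, hxL ⟨l, hl⟩⟩
  by_cases h : e = e'
  · rw [he', ← h]
  · have hd := CWComplex.disjoint_openCell_of_ne (C := (univ : Set X)) (n := n) (m := n)
      (i := e) (j := e') (fun hc ↦ h (by simpa using hc))
    exact (hd.notMem_of_mem_left hx h1).elim

variable [T2Space X]

theorem isClosed_fixedPoints (hX : IsGCWComplex G X) (L : Subgroup G) :
    IsClosed (MulAction.fixedPoints L X) := by
  have : MulAction.fixedPoints L X = ⋂ l : L, {x : X | (l : G) • x = x} := by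
    ext x
    simp [MulAction.mem_fixedPoints, Subgroup.smul_def]
  rw [this]
  exact isClosed_iInter fun l ↦ isClosed_eq (hX.continuous_smul l) continuous_id

/-- The subcomplex `⋃_{L ∈ S} X^L`; its cells are those fixed by some `L ∈ S`. -/
def fixedUnion (hX : IsGCWComplex G X) (S : Set (Subgroup G)) : Subcomplex (univ : Set X) :=
  CWComplex.Subcomplex.mk' (univ : Set X) (⋃ L ∈ S, MulAction.fixedPoints L X)
    (fun n ↦ {e | ∃ L ∈ S, openCell n e ⊆ MulAction.fixedPoints L X})
    (by
      rintro n ⟨e, L, hL, he⟩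
      have : closedCell n e ⊆ MulAction.fixedPoints L X := by
        rw [← CWComplex.closure_openCell_eq_closedCell]
        exact (isClosed_fixedPoints hX L).closure_subset_iff.2 he
      exact this.trans (subset_biUnion_of_mem (u := fun L : Subgroup G ↦
        (MulAction.fixedPoints L X : Set X)) hL))
    (by
      apply subset_antisymm
      · refine iUnion_subset fun n ↦ iUnion_subset ?_
        rintro ⟨e, L, hL, he⟩
        exact he.trans (subset_biUnion_of_mem (u := fun L : Subgroup G ↦
          (MulAction.fixedPoints L X : Set X)) hL)
      · refine iUnion₂_subset fun L hL x hx ↦ ?_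
        have hx' : x ∈ ⋃ (n : ℕ) (j : cell (univ : Set X) n), openCell n j := by
          rw [CWComplex.iUnion_openCell_eq_complex]
          exact mem_univ x
        obtain ⟨n, hn⟩ := mem_iUnion.1 hx'
        obtain ⟨e, he⟩ := mem_iUnion.1 hn
        exact mem_iUnion.2 ⟨n, mem_iUnion.2
          ⟨⟨e, L, hL, openCell_subset_fixedPoints hX L e he hx⟩, he⟩⟩)

/-- The fixed point subcomplex `X^K`. -/
def fixed (hX : IsGCWComplex G X) (K : Subgroup G) : Subcomplex (univ : Set X) :=
  fixedUnion hX {K}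

/-- The singular part `X^K_sing = ⋃ X^L`, over the finite subgroups `L` strictly containing `K`. -/
def sing (hX : IsGCWComplex G X) (K : Subgroup G) : Subcomplex (univ : Set X) :=
  fixedUnion hX {L | Finite L ∧ K < L}

theorem coe_fixed (hX : IsGCWComplex G X) (K : Subgroup G) :
    (fixed hX K : Set X) = MulAction.fixedPoints K X := by
  change ⋃ L ∈ ({K} : Set (Subgroup G)), (MulAction.fixedPoints L X : Set X) = _
  simp

theorem coe_sing (hX : IsGCWComplex G X) (K : Subgroup G) :
    (sing hX K : Set X) =
      ⋃ L ∈ {L : Subgroup G | Finite L ∧ K < L}, MulAction.fixedPoints L X :=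
  rfl

theorem sing_le_fixed (hX : IsGCWComplex G X) (K : Subgroup G) : sing hX K ≤ fixed hX K := by
  change (sing hX K : Set X) ⊆ (fixed hX K : Set X)
  rw [coe_sing, coe_fixed]
  refine iUnion₂_subset fun L hL x hx k ↦ ?_
  exact hx ⟨k.1, hL.2.le k.2⟩

end GCW

end

/-!
The Bredon cohomology with coefficients in `Q_K` is computed by a projective resolution made of
cellular chains, and morphisms from this resolution into `Q_K` turn out to be the same thing as
compactly supported cochains of `X^K` that vanish on the singular part.

Sending `G ⧸ H` to the cellular chain group `C_n(X^H)` defines a module over the orbit category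
(`GCW.cellMod`): a morphism `xH ↦ xgK` translates `X^K` into `X^H` by `g`. The `n`-cells of `X^H`
correspond to pairs of an orbit `G ⧸ G_e` of `n`-cells of `X` and a morphism `G ⧸ H → G ⧸ G_e`, so
this module has a basis consisting of the classes of representatives of the orbits of cells at their
isotropy groups (`GCW.isBasis_isotropyGen`). It is therefore projective, and a morphism out of it is
determined by, and can be prescribed through, the images of these classes. Since every `X^H` is
contractible, the complexes `C_*(X^H)` are resolutions of `ℤ`; together they form a projective
resolution of the constant module (`GCW.cellResolution`).

Because the groups in the family are finite, a morphism `G ⧸ L → G ⧸ K` is either invertible or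
makes `L` conjugate to a proper subgroup of `K` (`Bredon.exists_section_or`,
`Bredon.not_isConjToProper`). Hence `Q_K(G ⧸ L)` is free on the isomorphisms `G ⧸ L → G ⧸ K`, and it
is zero if there are none. A morphism `f` from the module of `n`-chains into `Q_K` gives a cochain
on `X^K`: the value of `f` at `G ⧸ K`, followed by the coefficient of the identity
(`GCW.toCochain`). Only cells whose isotropy group is exactly `K` contribute, which means that the
cochain vanishes on `X^K_sing`; elements of `Q_K` are finite combinations and there are finitely
many orbits of cells, so the cochain has compact support (`GCW.toCochain_mem`). Conversely such a
cochain prescribes the coefficients of the images of the basis elements (`GCW.exists_toCochain_eq`),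
and `f` is determined by the cochain (`GCW.toCochain_injective`). This identification commutes with
the differentials.

The cellular chain groups are defined through singular homology, and the rest of the work is the
needed homology theory: homotopy invariance by the prism operator, iterated barycentric subdivision,
and excision in the form that a collared pair glued to another space keeps its relative homology
(`SingularChains.IsGluing.bijective`). The discs are cubes, since they are unit balls for the
supremum norm; gluing the top face onto the rest of the boundary of the cube reduces
`H_{k+1}(Dⁿ⁺¹, Sⁿ)` to `H_k(Dⁿ, Sⁿ⁻¹)` (`SingularChains.discSucc`). This gives the freeness of
cellular chain groups on the cells (`Cellular.bijective_cellGen`) and the exactness of the cellular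
chain complex of a contractible complex (`Cellular.exists_cellularBoundary_eq`).
-/

set_option autoImplicit false

/-! ### Free abelian groups on a set -/

namespace FreeChains

variable {α β A : Type*} [AddCommGroup A]

/-- The homomorphism from the free abelian group on `α` with prescribed values on the basis. -/
noncomputable def liftFree (F : α → A) : (α →₀ ℤ) →+ A :=
  Finsupp.liftAddHom fun a ↦ zmultiplesHom A (F a)

@[simp]
theorem liftFree_single (F : α → A) (a : α) : liftFree F (Finsupp.single a 1) = F a := by
  simp [liftFree]

theorem hom_ext {f g : (α →₀ ℤ) →+ A}
    (h : ∀ a, f (Finsupp.single a 1) = g (Finsupp.single a 1)) : f = g :=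
  Finsupp.addHom_ext' fun a ↦ AddMonoidHom.ext_int (h a)

theorem hom_congr {f g : (α →₀ ℤ) →+ A}
    (h : ∀ a, f (Finsupp.single a 1) = g (Finsupp.single a 1)) (c : α →₀ ℤ) : f c = g c :=
  DFunLike.congr_fun (hom_ext h) c

/-- The map of free abelian groups induced by a map of bases. -/
noncomputable abbrev mapFree (f : α → β) : (α →₀ ℤ) →+ (β →₀ ℤ) := Finsupp.mapDomain.addMonoidHom f

theorem mapFree_single (f : α → β) (a : α) :
    mapFree f (Finsupp.single a 1) = Finsupp.single (f a) 1 := by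
  simp [mapFree]

/-- The subgroup of the elements supported on `s`. -/
noncomputable def supp (s : Set α) : AddSubgroup (α →₀ ℤ) := (Finsupp.supported ℤ ℤ s).toAddSubgroup

theorem single_mem_supp {s : Set α} {a : α} (ha : a ∈ s) (m : ℤ) :
    Finsupp.single a m ∈ supp s :=
  Finsupp.single_mem_supported ℤ m ha

theorem supp_mono {s t : Set α} (h : s ⊆ t) : supp s ≤ supp t :=
  fun _ hc _ ha ↦ h (hc ha)

/-- A homomorphism that maps the basis elements in `s` into a subgroup maps everything supported on
`s` into it. -/
theorem apply_mem_of_mem_supp {s : Set α} {B : AddSubgroup A} (f : (α →₀ ℤ) →+ A)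
    (h : ∀ a ∈ s, f (Finsupp.single a 1) ∈ B) {c : α →₀ ℤ} (hc : c ∈ supp s) : f c ∈ B := by
  rw [← c.sum_single, Finsupp.sum, map_sum]
  refine sum_mem fun a ha ↦ ?_
  have : Finsupp.single a (c a) = c a • Finsupp.single a 1 := by simp
  rw [this, map_zsmul]
  exact B.zsmul_mem (h a (hc ha)) _

/-- A chain supported on a set covered by two subsets splits accordingly. -/
theorem exists_add_of_mem_supp_union {s t : Set α} {c : α →₀ ℤ} (hc : c ∈ supp (s ∪ t)) :
    ∃ a ∈ supp s, ∃ b ∈ supp t, c = a + b := by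
  classical
  refine ⟨c.filter (· ∈ s), fun x hx ↦ ?_, c.filter (¬ · ∈ s), fun x hx ↦ ?_,
    (Finsupp.filter_add_filter_not c _).symm⟩
  · simp only [Finsupp.support_filter, Finset.coe_filter, mem_ofPred_eq] at hx
    exact hx.2
  · simp only [Finsupp.support_filter, Finset.coe_filter, mem_ofPred_eq] at hx
    exact (hc hx.1).resolve_left hx.2

theorem exists_map_eq_of_mem_supp_image {f : β → α} {s : Set β} {c : α →₀ ℤ}
    (hc : c ∈ supp (f '' s)) : ∃ d ∈ supp s, mapFree f d = c := by
  refine apply_mem_of_mem_supp (B := (supp s).map (mapFree f)) (AddMonoidHom.id _) ?_ hc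
  rintro _ ⟨b, hb, rfl⟩
  exact ⟨Finsupp.single b 1, single_mem_supp hb 1, mapFree_single f b⟩

/-- If `f` is injective on `s` and `f_* c` is supported on `t`, then `c` is supported on the
preimage of `t`. -/
theorem mem_supp_preimage_of_injOn {f : β → α} {s : Set β} (hf : InjOn f s) {t : Set α}
    {c : β →₀ ℤ} (hc : c ∈ supp s) (h : mapFree f c ∈ supp t) : c ∈ supp (s ∩ f ⁻¹' t) := by
  classical
  intro x hx
  refine ⟨hc hx, h ?_⟩
  have : mapFree f c (f x) = c x := Finsupp.mapDomain_apply' s c hc hf (hc hx)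
  rw [Finset.mem_coe, Finsupp.mem_support_iff, this]
  exact Finsupp.mem_support_iff.1 hx

end FreeChains

/-! ### Chains of vertex tuples -/

namespace TupleChains

open FreeChains

variable {V W : Type*}

/-- Integral combinations of `(n + 1)`-tuples of points of `V`: the degree `n` part of the chain
complex of the full simplex on the vertex set `V`. -/
abbrev Tup (V : Type*) (n : ℕ) : Type _ := (Fin (n + 1) → V) →₀ ℤ

/-- The boundary, the alternating sum over the deletions of one entry. -/
noncomputable def bdry (n : ℕ) : Tup V (n + 1) →+ Tup V n :=
  ∑ i : Fin (n + 2), (-1 : ℤ) ^ (i : ℕ) • mapFree fun v ↦ v ∘ i.succAbove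

theorem bdry_single (n : ℕ) (v : Fin (n + 2) → V) :
    bdry n (Finsupp.single v 1) =
      ∑ i : Fin (n + 2), (-1 : ℤ) ^ (i : ℕ) • Finsupp.single (v ∘ i.succAbove) 1 := by
  simp only [bdry, AddMonoidHom.finsetSum_apply, AddMonoidHom.smul_apply, mapFree_single]

/-- The cone with apex `p`. -/
noncomputable def cone (p : V) (n : ℕ) : Tup V n →+ Tup V (n + 1) :=
  mapFree fun v ↦ Fin.cons p v

theorem cone_single (p : V) (n : ℕ) (v : Fin (n + 1) → V) :
    cone p n (Finsupp.single v 1) = Finsupp.single (Fin.cons p v) 1 :=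
  mapFree_single _ _

/-- The sum of the coefficients. -/
noncomputable def aug {α : Type*} : (α →₀ ℤ) →+ ℤ := liftFree fun _ ↦ 1

@[simp]
theorem aug_single {α : Type*} (a : α) : aug (Finsupp.single a 1) = 1 := liftFree_single _ _

theorem bdry_cone_single (p : V) (n : ℕ) (v : Fin (n + 1) → V) :
    bdry n (cone p n (Finsupp.single v 1)) = Finsupp.single v 1 -
      ∑ i : Fin (n + 1), (-1 : ℤ) ^ (i : ℕ) •
        Finsupp.single ((Fin.cons p v : Fin (n + 2) → V) ∘ i.succ.succAbove) 1 := by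
  rw [cone_single, bdry_single, Fin.sum_univ_succ, sub_eq_add_neg, ← Finset.sum_neg_distrib]
  congr 1
  · simp only [Fin.val_zero, pow_zero, one_smul]
    congr 1
  · refine Finset.sum_congr rfl fun i _ ↦ ?_
    rw [Fin.val_succ, pow_succ, mul_neg_one, neg_smul]

theorem bdry_cone (p : V) (n : ℕ) (c : Tup V (n + 1)) :
    bdry (n + 1) (cone p (n + 1) c) = c - cone p n (bdry n c) := by
  refine hom_congr (f := (bdry (n + 1)).comp (cone p (n + 1)))
    (g := AddMonoidHom.id _ - (cone p n).comp (bdry n)) (fun v ↦ ?_) c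
  simp only [AddMonoidHom.comp_apply, AddMonoidHom.sub_apply, AddMonoidHom.id_apply]
  rw [bdry_cone_single, bdry_single, map_sum]
  congr 1
  refine Finset.sum_congr rfl fun i _ ↦ ?_
  rw [map_zsmul, cone_single]
  congr 2
  ext j
  refine Fin.cases ?_ (fun j ↦ ?_) j
  · simp
  · simp

theorem bdry_cone_zero (p : V) (c : Tup V 0) :
    bdry 0 (cone p 0 c) = c - aug c • Finsupp.single (fun _ ↦ p) 1 := by
  refine hom_congr (f := (bdry 0).comp (cone p 0))
    (g := AddMonoidHom.id _ - (zmultiplesHom _ (Finsupp.single (fun _ ↦ p) 1)).comp aug)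
    (fun v ↦ ?_) c
  simp only [AddMonoidHom.comp_apply, AddMonoidHom.sub_apply, AddMonoidHom.id_apply]
  rw [bdry_cone_single]
  rw [Fin.sum_univ_one, aug_single, zmultiplesHom_apply, one_smul, Fin.val_zero, pow_zero, one_smul]
  congr 2
  ext j
  fin_cases j
  rfl

theorem aug_bdry (c : Tup V 1) : aug (bdry 0 c) = 0 := by
  refine hom_congr (f := aug.comp (bdry 0)) (g := 0) (fun v ↦ ?_) c
  simp [bdry_single, Fin.sum_univ_succ]

theorem single_eq_cone (n : ℕ) (v : Fin (n + 2) → V) :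
    Finsupp.single v (1 : ℤ) = cone (v 0) n (Finsupp.single (v ∘ Fin.succ) 1) := by
  rw [cone_single]
  congr 1
  exact (Fin.cons_self_tail v).symm

theorem bdry_bdry (n : ℕ) (c : Tup V (n + 2)) : bdry n (bdry (n + 1) c) = 0 := by
  induction n with
  | zero =>
    refine hom_congr (f := (bdry 0).comp (bdry 1)) (g := 0) (fun v ↦ ?_) c
    rw [AddMonoidHom.comp_apply, single_eq_cone, bdry_cone, map_sub, bdry_cone_zero, aug_bdry]
    simp
  | succ n ih =>
    refine hom_congr (f := (bdry (n + 1)).comp (bdry (n + 2))) (g := 0) (fun v ↦ ?_) c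
    rw [AddMonoidHom.comp_apply, single_eq_cone, bdry_cone, map_sub, bdry_cone, ih]
    simp

/-- The map on tuple chains induced by a map of vertex sets. -/
noncomputable def push (f : V → W) (n : ℕ) : Tup V n →+ Tup W n := mapFree fun v ↦ f ∘ v

theorem push_single (f : V → W) (n : ℕ) (v : Fin (n + 1) → V) :
    push f n (Finsupp.single v 1) = Finsupp.single (f ∘ v) 1 :=
  mapFree_single _ _

theorem push_cone (f : V → W) (p : V) (n : ℕ) (c : Tup V n) :
    push f (n + 1) (cone p n c) = cone (f p) n (push f n c) := by
  refine hom_congr (f := (push f (n + 1)).comp (cone p n)) (g := (cone (f p) n).comp (push f n))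
    (fun v ↦ ?_) c
  simp only [AddMonoidHom.comp_apply, push_single, cone_single]
  congr 1
  exact Fin.comp_cons f p v

theorem bdry_push (f : V → W) (n : ℕ) (c : Tup V (n + 1)) :
    bdry n (push f (n + 1) c) = push f n (bdry n c) := by
  refine hom_congr (f := (bdry n).comp (push f (n + 1))) (g := (push f n).comp (bdry n))
    (fun v ↦ ?_) c
  simp only [AddMonoidHom.comp_apply, push_single, bdry_single, map_sum, map_zsmul]
  rfl

/-! ### The prism operator on tuple chains -/

/-- The prism operator: a chain homotopy between the two inclusions of `V` into `V × [0, 1]`. On a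
tuple `v` it is the cone, with apex the first vertex of `v` at the level `0`, over the cycle that
the prism over `v` has to bound. -/
noncomputable def prism : (n : ℕ) → Tup V n →+ Tup (V × unitInterval) (n + 1)
  | 0 => liftFree fun v ↦ cone (v 0, 0) 0
      (push (·, 1) 0 (Finsupp.single v 1) - push (·, 0) 0 (Finsupp.single v 1))
  | n + 1 => liftFree fun v ↦ cone (v 0, 0) (n + 1)
      (push (·, 1) (n + 1) (Finsupp.single v 1) - push (·, 0) (n + 1) (Finsupp.single v 1) -
        prism n (bdry n (Finsupp.single v 1)))

theorem aug_push (f : V → W) (n : ℕ) (c : Tup V n) : aug (push f n c) = aug c :=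
  hom_congr (f := aug.comp (push f n)) (g := aug) (fun v ↦ by simp [push_single]) c

theorem bdry_prism_zero (c : Tup V 0) :
    bdry 0 (prism 0 c) = push (·, 1) 0 c - push (·, 0) 0 c := by
  refine hom_congr (f := (bdry 0).comp (prism 0)) (g := push (·, 1) 0 - push (·, 0) 0)
    (fun v ↦ ?_) c
  rw [AddMonoidHom.comp_apply, prism, liftFree_single, bdry_cone_zero, map_sub aug, aug_push,
    aug_push, sub_self, zero_smul, sub_zero, AddMonoidHom.sub_apply]

theorem bdry_prism (n : ℕ) (c : Tup V (n + 1)) :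
    bdry (n + 1) (prism (n + 1) c) =
      push (·, 1) (n + 1) c - push (·, 0) (n + 1) c - prism n (bdry n c) := by
  have key : ∀ (m : ℕ) (c : Tup V (m + 1)),
      bdry m (push (·, 1) (m + 1) c - push (·, 0) (m + 1) c - prism m (bdry m c)) = 0 →
      ∀ p : V × unitInterval, bdry (m + 1) (cone p (m + 1)
        (push (·, 1) (m + 1) c - push (·, 0) (m + 1) c - prism m (bdry m c))) =
        push (·, 1) (m + 1) c - push (·, 0) (m + 1) c - prism m (bdry m c) := by
    intro m c h p
    rw [bdry_cone, h, map_zero, sub_zero]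
  refine hom_congr (f := (bdry (n + 1)).comp (prism (n + 1)))
    (g := push (·, 1) (n + 1) - push (·, 0) (n + 1) - (prism n).comp (bdry n)) (fun v ↦ ?_) c
  simp only [AddMonoidHom.comp_apply, AddMonoidHom.sub_apply]
  rw [prism, liftFree_single]
  refine key n _ ?_ _
  cases n with
  | zero => rw [map_sub, map_sub, bdry_prism_zero, bdry_push, bdry_push, sub_self]
  | succ n =>
    rw [map_sub, map_sub, bdry_prism n, bdry_bdry, map_zero, bdry_push, bdry_push, sub_zero,
      sub_self]

theorem prism_push (f : V → W) (n : ℕ) (c : Tup V n) :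
    prism n (push f n c) = push (Prod.map f id) (n + 1) (prism n c) := by
  have hp : ∀ (t : unitInterval) (n : ℕ) (c : Tup V n),
      push (·, t) n (push f n c) = push (Prod.map f id) n (push (·, t) n c) := by
    intro t n c
    exact hom_congr (f := (push (·, t) n).comp (push f n))
      (g := (push (Prod.map f id) n).comp (push (·, t) n)) (fun v ↦ by
        simp only [AddMonoidHom.comp_apply, push_single]; rfl) c
  induction n with
  | zero =>
    refine hom_congr (f := (prism 0).comp (push f 0)) (g := (push (Prod.map f id) 1).comp (prism 0))
      (fun v ↦ ?_) c
    simp only [AddMonoidHom.comp_apply]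
    rw [push_single, prism, liftFree_single, prism, liftFree_single, push_cone, map_sub (push _ _),
      ← hp, ← hp, push_single f]
    rfl
  | succ n ih =>
    refine hom_congr (f := (prism (n + 1)).comp (push f (n + 1)))
      (g := (push (Prod.map f id) (n + 2)).comp (prism (n + 1))) (fun v ↦ ?_) c
    simp only [AddMonoidHom.comp_apply]
    rw [push_single, prism, liftFree_single, prism, liftFree_single, push_cone, map_sub (push _ _),
      map_sub (push _ _), ← hp, ← hp, ← ih, ← bdry_push, push_single f]
    rfl

end TupleChains

namespace TupleChains

open FreeChains

variable {V W : Type*}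

/-! ### Barycentric subdivision of tuple chains -/

section Subdivision

variable (β : ∀ n : ℕ, (Fin (n + 1) → V) → V)

/-- The subdivision operator: the subdivision of a simplex `v` is the cone, with apex `β v` inside
`v`, over the subdivision of its boundary. -/
noncomputable def sd : (n : ℕ) → Tup V n →+ Tup V n
  | 0 => AddMonoidHom.id _
  | n + 1 => liftFree fun v ↦ cone (β (n + 1) v) n (sd n (bdry n (Finsupp.single v 1)))

/-- The chain homotopy between the identity and the subdivision operator. -/
noncomputable def sdHtpy : (n : ℕ) → Tup V n →+ Tup V (n + 1)
  | 0 => liftFree fun v ↦ cone (β 0 v) 0 (Finsupp.single v 1)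
  | n + 1 => liftFree fun v ↦ cone (β (n + 1) v) (n + 1)
      (Finsupp.single v 1 - sdHtpy n (bdry n (Finsupp.single v 1)))

theorem sd_succ_single (n : ℕ) (v : Fin (n + 2) → V) :
    sd β (n + 1) (Finsupp.single v 1) =
      cone (β (n + 1) v) n (sd β n (bdry n (Finsupp.single v 1))) := by
  rw [sd, liftFree_single]

theorem bdry_sd (n : ℕ) (c : Tup V (n + 1)) :
    bdry n (sd β (n + 1) c) = sd β n (bdry n c) := by
  induction n with
  | zero =>
    refine hom_congr (f := (bdry 0).comp (sd β 1)) (g := (sd β 0).comp (bdry 0)) (fun v ↦ ?_) c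
    simp only [AddMonoidHom.comp_apply, sd_succ_single, bdry_cone_zero]
    simp only [sd, AddMonoidHom.id_apply, aug_bdry, zero_smul, sub_zero]
  | succ n ih =>
    refine hom_congr (f := (bdry (n + 1)).comp (sd β (n + 2)))
      (g := (sd β (n + 1)).comp (bdry (n + 1))) (fun v ↦ ?_) c
    simp only [AddMonoidHom.comp_apply]
    rw [sd_succ_single, bdry_cone, ih, bdry_bdry, map_zero, map_zero, sub_zero]

theorem bdry_sdHtpy_zero (hβ : ∀ v, β 0 v = v 0) (c : Tup V 0) : bdry 0 (sdHtpy β 0 c) = 0 := by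
  refine hom_congr (f := (bdry 0).comp (sdHtpy β 0)) (g := 0) (fun v ↦ ?_) c
  rw [AddMonoidHom.comp_apply, sdHtpy, liftFree_single, bdry_cone_zero, aug_single, one_smul, hβ,
    AddMonoidHom.zero_apply, sub_eq_zero]
  congr 1
  ext j
  fin_cases j
  rfl

theorem bdry_sdHtpy (hβ : ∀ v, β 0 v = v 0) (n : ℕ) (c : Tup V (n + 1)) :
    bdry (n + 1) (sdHtpy β (n + 1) c) = c - sd β (n + 1) c - sdHtpy β n (bdry n c) := by
  have key : ∀ (m : ℕ) (v : Fin (m + 2) → V),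
      bdry m (Finsupp.single v 1 - sdHtpy β m (bdry m (Finsupp.single v 1))) =
        sd β m (bdry m (Finsupp.single v 1)) →
      bdry (m + 1) (sdHtpy β (m + 1) (Finsupp.single v 1)) = Finsupp.single v 1 -
        sd β (m + 1) (Finsupp.single v 1) - sdHtpy β m (bdry m (Finsupp.single v 1)) := by
    intro m v h
    rw [sdHtpy, liftFree_single, bdry_cone, h, sd_succ_single]
    abel
  refine hom_congr (f := (bdry (n + 1)).comp (sdHtpy β (n + 1)))
    (g := AddMonoidHom.id _ - sd β (n + 1) - (sdHtpy β n).comp (bdry n)) (fun v ↦ ?_) c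
  simp only [AddMonoidHom.comp_apply, AddMonoidHom.sub_apply, AddMonoidHom.id_apply]
  refine key n v ?_
  cases n with
  | zero => rw [map_sub, bdry_sdHtpy_zero β hβ, sub_zero]; rfl
  | succ n =>
    rw [map_sub, bdry_sdHtpy hβ n, bdry_bdry, map_zero]
    abel

variable {β} {β' : ∀ n : ℕ, (Fin (n + 1) → W) → W} {f : V → W}

theorem push_sd (hf : ∀ n v, f (β n v) = β' n (f ∘ v)) (n : ℕ) (c : Tup V n) :
    push f n (sd β n c) = sd β' n (push f n c) := by
  induction n with
  | zero => rfl
  | succ n ih =>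
    refine hom_congr (f := (push f (n + 1)).comp (sd β (n + 1)))
      (g := (sd β' (n + 1)).comp (push f (n + 1))) (fun v ↦ ?_) c
    simp only [AddMonoidHom.comp_apply]
    rw [sd_succ_single, push_cone, ih, ← bdry_push, push_single, sd_succ_single, hf]

theorem push_sdHtpy (hf : ∀ n v, f (β n v) = β' n (f ∘ v)) (n : ℕ) (c : Tup V n) :
    push f (n + 1) (sdHtpy β n c) = sdHtpy β' n (push f n c) := by
  induction n with
  | zero =>
    refine hom_congr (f := (push f 1).comp (sdHtpy β 0))
      (g := (sdHtpy β' 0).comp (push f 0)) (fun v ↦ ?_) c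
    simp only [AddMonoidHom.comp_apply]
    rw [sdHtpy, liftFree_single, push_cone, push_single, sdHtpy, liftFree_single, hf]
  | succ n ih =>
    refine hom_congr (f := (push f (n + 2)).comp (sdHtpy β (n + 1)))
      (g := (sdHtpy β' (n + 1)).comp (push f (n + 1))) (fun v ↦ ?_) c
    simp only [AddMonoidHom.comp_apply]
    rw [sdHtpy, liftFree_single, push_cone, map_sub, ih, ← bdry_push, push_single, sdHtpy,
      liftFree_single, hf]

end Subdivision

end TupleChains

/-! ### Singular chains as combinations of continuous maps -/

namespace SingularChains

open FreeChains TupleChains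

/-- The standard topological `n`-simplex. -/
abbrev Simplex (n : ℕ) : Type := stdSimplex ℝ (Fin (n + 1))

/-- The `i`-th face inclusion. -/
noncomputable def face {n : ℕ} (i : Fin (n + 2)) : C(Simplex n, Simplex (n + 1)) :=
  ⟨stdSimplex.map i.succAbove, stdSimplex.continuous_map _⟩

/-- The integral singular `n`-chains of `X`, as finitely supported functions on the continuous maps
from the standard simplex. -/
abbrev Ch (X : Type*) [TopologicalSpace X] (n : ℕ) : Type _ := C(Simplex n, X) →₀ ℤ

variable {X Y Z V W : Type*} [TopologicalSpace X] [TopologicalSpace Y] [TopologicalSpace Z]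
  [TopologicalSpace V] [TopologicalSpace W]

/-- The singular boundary. -/
noncomputable def d (n : ℕ) : Ch X (n + 1) →+ Ch X n :=
  ∑ i : Fin (n + 2), (-1 : ℤ) ^ (i : ℕ) • mapFree fun σ ↦ σ.comp (face i)

theorem d_single (n : ℕ) (σ : C(Simplex (n + 1), X)) :
    d n (Finsupp.single σ 1) =
      ∑ i : Fin (n + 2), (-1 : ℤ) ^ (i : ℕ) • Finsupp.single (σ.comp (face i)) 1 := by
  simp only [d, AddMonoidHom.finsetSum_apply, AddMonoidHom.smul_apply, mapFree_single]

/-- The chain map induced by a continuous map. -/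
noncomputable def cpush (f : C(X, Y)) (n : ℕ) : Ch X n →+ Ch Y n := mapFree fun σ ↦ f.comp σ

theorem cpush_single (f : C(X, Y)) (n : ℕ) (σ : C(Simplex n, X)) :
    cpush f n (Finsupp.single σ 1) = Finsupp.single (f.comp σ) 1 :=
  mapFree_single _ _

theorem d_cpush (f : C(X, Y)) (n : ℕ) (c : Ch X (n + 1)) :
    d n (cpush f (n + 1) c) = cpush f n (d n c) := by
  refine hom_congr (f := (d n).comp (cpush f (n + 1))) (g := (cpush f n).comp (d n))
    (fun v ↦ ?_) c
  simp only [AddMonoidHom.comp_apply, cpush_single, d_single, map_sum, map_zsmul]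
  rfl

theorem cpush_cpush (g : C(Y, Z)) (f : C(X, Y)) (n : ℕ) (c : Ch X n) :
    cpush g n (cpush f n c) = cpush (g.comp f) n c := by
  refine hom_congr (f := (cpush g n).comp (cpush f n)) (g := cpush (g.comp f) n) (fun v ↦ ?_) c
  simp only [AddMonoidHom.comp_apply, cpush_single]
  rfl

theorem cpush_id (n : ℕ) (c : Ch X n) : cpush (ContinuousMap.id X) n c = c := by
  refine hom_congr (f := cpush (ContinuousMap.id X) n) (g := AddMonoidHom.id _) (fun v ↦ ?_) c
  simp only [cpush_single, AddMonoidHom.id_apply, ContinuousMap.id_comp]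

/-! ### Affine simplices -/

/-- A space in which an `(n + 1)`-tuple of points spans an affine singular simplex, compatibly with
faces. -/
class AffineSpan (V : Type*) [TopologicalSpace V] where
  span : ∀ {n : ℕ}, (Fin (n + 1) → V) → C(Simplex n, V)
  span_face : ∀ {n : ℕ} (v : Fin (n + 2) → V) (i : Fin (n + 2)),
    (span v).comp (face i) = span (v ∘ i.succAbove)
  span_const : ∀ {n : ℕ} (p : V) (t : Simplex n), span (fun _ ↦ p) t = p

open AffineSpan

theorem face_apply_self {n : ℕ} (i : Fin (n + 2)) (t : Simplex n) : (face i t).1 i = 0 := by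
  change (FunOnFinite.linearMap ℝ ℝ i.succAbove t) i = 0
  rw [FunOnFinite.linearMap_apply_apply]
  simp [Fin.succAbove_ne]

theorem face_apply_succAbove {n : ℕ} (i : Fin (n + 2)) (t : Simplex n) (j : Fin (n + 1)) :
    (face i t).1 (i.succAbove j) = t.1 j := by
  change (FunOnFinite.linearMap ℝ ℝ i.succAbove t) (i.succAbove j) = t.1 j
  rw [FunOnFinite.linearMap_apply_apply]
  simp only [Fin.succAbove_right_inj]
  rw [Finset.filter_eq' Finset.univ j]
  simp
  rfl

theorem sum_face_smul {E : Type*} [AddCommGroup E] [Module ℝ E] {n : ℕ} (i : Fin (n + 2))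
    (t : Simplex n) (v : Fin (n + 2) → E) :
    ∑ j, (face i t).1 j • v j = ∑ j, t.1 j • v (i.succAbove j) := by
  rw [Fin.sum_univ_succAbove _ i, face_apply_self, zero_smul, zero_add]
  simp only [face_apply_succAbove]

/-- Affine simplices in a convex set. -/
@[reducible]
noncomputable def affineSpanOfConvex {E : Type*} [AddCommGroup E] [Module ℝ E] [TopologicalSpace E]
    [IsTopologicalAddGroup E] [ContinuousSMul ℝ E] {s : Set E} (hs : Convex ℝ s) :
    AffineSpan s where
  span {n} v := ⟨fun t ↦ ⟨∑ j, t.1 j • (v j : E),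
    hs.sum_mem (fun j _ ↦ t.2.1 j) t.2.2 fun j _ ↦ (v j).2⟩,
      Continuous.subtype_mk (continuous_finsetSum _ fun j _ ↦
        ((continuous_apply j).comp continuous_subtype_val).smul continuous_const) _⟩
  span_face v i := by
    ext t
    exact sum_face_smul i t fun j ↦ (v j : E)
  span_const p t := by
    ext
    change ∑ j, t.1 j • (p : E) = p
    rw [← Finset.sum_smul, t.2.2, one_smul]

noncomputable instance (n : ℕ) : AffineSpan (Simplex n) :=
  affineSpanOfConvex (convex_stdSimplex ℝ (Fin (n + 1)))

noncomputable instance : AffineSpan unitInterval :=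
  affineSpanOfConvex (convex_Icc (0 : ℝ) 1)

noncomputable instance [AffineSpan V] [AffineSpan W] : AffineSpan (V × W) where
  span v := (span (Prod.fst ∘ v)).prodMk (span (Prod.snd ∘ v))
  span_face v i := by
    ext t
    · exact DFunLike.congr_fun (span_face (Prod.fst ∘ v) i) t
    · exact DFunLike.congr_fun (span_face (Prod.snd ∘ v) i) t
  span_const p t := Prod.ext (span_const p.1 t) (span_const p.2 t)

theorem simplexSpan_coe {m n : ℕ} (v : Fin (n + 1) → Simplex m) (t : Simplex n) :
    (span v t).1 = ∑ j, t.1 j • (v j).1 := rfl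

/-- The tuple of the vertices of the standard simplex. -/
noncomputable def verts (n : ℕ) : Fin (n + 1) → Simplex n := fun i ↦ stdSimplex.vertex i

theorem span_verts (n : ℕ) : span (verts n) = ContinuousMap.id (Simplex n) := by
  ext t i
  change (span (verts n) t).1 i = t.1 i
  rw [simplexSpan_coe, Finset.sum_apply]
  simp [verts, Pi.single_apply]

theorem face_verts {n : ℕ} (i : Fin (n + 2)) : face i ∘ verts n = verts (n + 1) ∘ i.succAbove := by
  ext j : 1
  exact stdSimplex.map_vertex _ _

/-- A continuous map is affine if it commutes with affine simplices. -/
def IsAff [AffineSpan V] [AffineSpan W] (f : C(V, W)) : Prop :=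
  ∀ (n : ℕ) (v : Fin (n + 1) → V), f.comp (span v) = span (f ∘ v)

theorem isAff_span {m n : ℕ} (w : Fin (m + 1) → Simplex n) : IsAff (span w) := by
  intro k v
  ext t i
  change (span w (span v t)).1 i = (span (span w ∘ v) t).1 i
  simp only [simplexSpan_coe, Finset.sum_apply, Pi.smul_apply, smul_eq_mul, Function.comp_apply,
    Finset.sum_mul, Finset.mul_sum]
  rw [Finset.sum_comm]
  simp only [mul_assoc]

theorem isAff_face {n : ℕ} (i : Fin (n + 2)) : IsAff (face (n := n) i) := by
  have : face (n := n) i = span (face i ∘ verts n) := by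
    rw [face_verts, ← span_face, span_verts, ContinuousMap.id_comp]
  rw [this]
  exact isAff_span _

theorem IsAff.prodMap_id [AffineSpan V] [AffineSpan W] {U : Type*} [TopologicalSpace U]
    [AffineSpan U] {f : C(V, W)} (hf : IsAff f) : IsAff (f.prodMap (ContinuousMap.id U)) := by
  intro n v
  ext t
  · exact DFunLike.congr_fun (hf n (Prod.fst ∘ v)) t
  · rfl

/-- The realisation of tuple chains as affine singular chains. -/
noncomputable def real [AffineSpan V] (n : ℕ) : Tup V n →+ Ch V n := mapFree span

theorem real_single [AffineSpan V] {n : ℕ} (v : Fin (n + 1) → V) :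
    real n (Finsupp.single v 1) = Finsupp.single (span v) 1 :=
  mapFree_single _ _

theorem d_real [AffineSpan V] (n : ℕ) (c : Tup V (n + 1)) :
    d n (real (n + 1) c) = real n (bdry n c) := by
  refine hom_congr (f := (d n).comp (real (n + 1))) (g := (real n).comp (bdry n)) (fun v ↦ ?_) c
  simp only [AddMonoidHom.comp_apply, real_single, d_single, bdry_single, map_sum, map_zsmul,
    span_face]

theorem IsAff.cpush_real [AffineSpan V] [AffineSpan W] {f : C(V, W)} (hf : IsAff f) (n : ℕ)
    (c : Tup V n) : cpush f n (real n c) = real n (push f n c) := by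
  refine hom_congr (f := (cpush f n).comp (real n)) (g := (real n).comp (push f n)) (fun v ↦ ?_) c
  simp only [AddMonoidHom.comp_apply, real_single, cpush_single, push_single]
  rw [hf]

/-! ### Natural operators on singular chains -/

/-- The chains of simplices with image in `A`. -/
noncomputable def chIn (A : Set X) (n : ℕ) : AddSubgroup (Ch X n) := supp {σ | range σ ⊆ A}

theorem chIn_mono {A B : Set X} (h : A ⊆ B) (n : ℕ) : chIn A n ≤ chIn B n :=
  supp_mono fun _ hσ ↦ hσ.trans h

theorem chIn_univ (n : ℕ) (c : Ch X n) : c ∈ chIn univ n := fun _ _ ↦ subset_univ _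

theorem cpush_mem_chIn {A : Set X} {B : Set Y} (f : C(X, Y)) (h : MapsTo f A B) {n : ℕ}
    {c : Ch X n} (hc : c ∈ chIn A n) : cpush f n c ∈ chIn B n := by
  refine apply_mem_of_mem_supp _ (fun σ hσ ↦ ?_) hc
  rw [cpush_single]
  refine single_mem_supp ?_ 1
  rintro _ ⟨t, rfl⟩
  exact h (hσ ⟨t, rfl⟩)

theorem d_mem_chIn {A : Set X} {n : ℕ} {c : Ch X (n + 1)} (hc : c ∈ chIn A (n + 1)) :
    d n c ∈ chIn A n := by
  refine apply_mem_of_mem_supp _ (fun σ hσ ↦ ?_) hc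
  rw [d_single]
  refine sum_mem fun i _ ↦ zsmul_mem (single_mem_supp ?_ 1) _
  rintro _ ⟨t, rfl⟩
  exact hσ ⟨_, rfl⟩

section Homotopy

/-- The prism operator of a homotopy: the universal prism over the standard simplex is pushed
forward along `h ∘ (σ × id)`. -/
noncomputable def prismOp (h : C(X × unitInterval, Y)) (n : ℕ) : Ch X n →+ Ch Y (n + 1) :=
  liftFree fun σ ↦ cpush (h.comp (σ.prodMap (ContinuousMap.id unitInterval))) (n + 1)
    (real (n + 1) (prism n (Finsupp.single (verts n) 1)))

/-- The end `h(-, t)` of a homotopy. -/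
def slice (h : C(X × unitInterval, Y)) (t : unitInterval) : C(X, Y) :=
  h.comp ((ContinuousMap.id X).prodMk (ContinuousMap.const X t))

variable (h : C(X × unitInterval, Y))

theorem prismOp_single (n : ℕ) (σ : C(Simplex n, X)) :
    prismOp h n (Finsupp.single σ 1) =
      cpush (h.comp (σ.prodMap (ContinuousMap.id unitInterval))) (n + 1)
        (real (n + 1) (prism n (Finsupp.single (verts n) 1))) :=
  liftFree_single _ _

theorem cpush_prismOp_slice (n : ℕ) (σ : C(Simplex n, X)) (t : unitInterval) :
    cpush (h.comp (σ.prodMap (ContinuousMap.id unitInterval))) n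
      (real n (push (·, t) n (Finsupp.single (verts n) 1))) =
    cpush (slice h t) n (Finsupp.single σ 1) := by
  rw [push_single, real_single, cpush_single, cpush_single]
  congr 1
  ext x
  change h (σ (span (verts n) x), span (fun _ ↦ t) x) = h (σ x, t)
  rw [span_verts, span_const]
  rfl

theorem d_prismOp_zero (c : Ch X 0) :
    d 0 (prismOp h 0 c) = cpush (slice h 1) 0 c - cpush (slice h 0) 0 c := by
  refine hom_congr (f := (d 0).comp (prismOp h 0))
    (g := cpush (slice h 1) 0 - cpush (slice h 0) 0) (fun σ ↦ ?_) c
  simp only [AddMonoidHom.comp_apply, AddMonoidHom.sub_apply]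
  rw [prismOp_single, d_cpush, d_real, bdry_prism_zero, map_sub, map_sub, cpush_prismOp_slice,
    cpush_prismOp_slice]

theorem d_prismOp (n : ℕ) (c : Ch X (n + 1)) :
    d (n + 1) (prismOp h (n + 1) c) =
      cpush (slice h 1) (n + 1) c - cpush (slice h 0) (n + 1) c - prismOp h n (d n c) := by
  refine hom_congr (f := (d (n + 1)).comp (prismOp h (n + 1)))
    (g := cpush (slice h 1) (n + 1) - cpush (slice h 0) (n + 1) - (prismOp h n).comp (d n))
    (fun σ ↦ ?_) c
  simp only [AddMonoidHom.comp_apply, AddMonoidHom.sub_apply]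
  rw [prismOp_single, d_cpush, d_real, bdry_prism, map_sub, map_sub, map_sub, map_sub,
    cpush_prismOp_slice, cpush_prismOp_slice]
  congr 1
  simp only [bdry_single, d_single, map_sum, map_zsmul]
  refine Finset.sum_congr rfl fun i _ ↦ ?_
  congr 1
  rw [← face_verts, ← push_single, prism_push, prismOp_single]
  have := (isAff_face (n := n) i).prodMap_id (U := unitInterval)
  rw [show Prod.map (face i) id = (face (n := n) i).prodMap (ContinuousMap.id unitInterval)
    from rfl, ← this.cpush_real, cpush_cpush]
  rfl

theorem prismOp_mem_chIn {A : Set X} {B : Set Y} (hA : ∀ x ∈ A, ∀ t, h (x, t) ∈ B) {n : ℕ}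
    {c : Ch X n} (hc : c ∈ chIn A n) : prismOp h n c ∈ chIn B (n + 1) := by
  refine apply_mem_of_mem_supp _ (fun σ hσ ↦ ?_) hc
  rw [prismOp_single]
  refine cpush_mem_chIn (A := univ) _ (fun x _ ↦ ?_) (chIn_univ _ _)
  exact hA _ (hσ ⟨x.1, rfl⟩) _

end Homotopy

section Subdivision

/-- The barycenter of an affine simplex. -/
noncomputable def bary (V : Type*) [TopologicalSpace V] [AffineSpan V] (n : ℕ)
    (v : Fin (n + 1) → V) : V :=
  span v stdSimplex.barycenter

theorem bary_zero {m : ℕ} (v : Fin 1 → Simplex m) : bary (Simplex m) 0 v = v 0 := by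
  have : v = fun _ ↦ v 0 := by
    ext j : 1
    fin_cases j
    rfl
  rw [this]
  exact span_const _ _

theorem IsAff.map_bary [AffineSpan V] [AffineSpan W] {f : C(V, W)} (hf : IsAff f) (n : ℕ)
    (v : Fin (n + 1) → V) : f (bary V n v) = bary W n (f ∘ v) :=
  DFunLike.congr_fun (hf n v) _

/-- Barycentric subdivision of singular chains. -/
noncomputable def sdOp (n : ℕ) : Ch X n →+ Ch X n :=
  liftFree fun σ ↦ cpush σ n (real n (sd (bary (Simplex n)) n (Finsupp.single (verts n) 1)))

/-- The chain homotopy between the identity and barycentric subdivision. -/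
noncomputable def sdHtpyOp (n : ℕ) : Ch X n →+ Ch X (n + 1) :=
  liftFree fun σ ↦ cpush σ (n + 1)
    (real (n + 1) (sdHtpy (bary (Simplex n)) n (Finsupp.single (verts n) 1)))

theorem sdOp_single (n : ℕ) (σ : C(Simplex n, X)) :
    sdOp n (Finsupp.single σ 1) =
      cpush σ n (real n (sd (bary (Simplex n)) n (Finsupp.single (verts n) 1))) :=
  liftFree_single _ _

theorem sdHtpyOp_single (n : ℕ) (σ : C(Simplex n, X)) :
    sdHtpyOp n (Finsupp.single σ 1) = cpush σ (n + 1)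
      (real (n + 1) (sdHtpy (bary (Simplex n)) n (Finsupp.single (verts n) 1))) :=
  liftFree_single _ _

theorem cpush_sdOp (f : C(X, Y)) (n : ℕ) (c : Ch X n) :
    cpush f n (sdOp n c) = sdOp n (cpush f n c) := by
  refine hom_congr (f := (cpush f n).comp (sdOp n)) (g := (sdOp n).comp (cpush f n))
    (fun σ ↦ ?_) c
  simp only [AddMonoidHom.comp_apply, cpush_single, sdOp_single, cpush_cpush]

theorem d_sdOp (n : ℕ) (c : Ch X (n + 1)) : d n (sdOp (n + 1) c) = sdOp n (d n c) := by
  refine hom_congr (f := (d n).comp (sdOp (n + 1))) (g := (sdOp n).comp (d n)) (fun σ ↦ ?_) c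
  simp only [AddMonoidHom.comp_apply]
  rw [sdOp_single, d_cpush, d_real, bdry_sd]
  simp only [bdry_single, d_single, map_sum, map_zsmul]
  refine Finset.sum_congr rfl fun i _ ↦ ?_
  congr 1
  rw [← face_verts, ← push_single, ← push_sd (isAff_face i).map_bary, ← (isAff_face i).cpush_real,
    cpush_cpush, sdOp_single]

theorem d_sdHtpyOp_zero (c : Ch X 0) : d 0 (sdHtpyOp 0 c) = c - sdOp 0 c := by
  refine hom_congr (f := (d 0).comp (sdHtpyOp 0)) (g := AddMonoidHom.id _ - sdOp 0)
    (fun σ ↦ ?_) c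
  simp only [AddMonoidHom.comp_apply, AddMonoidHom.sub_apply, AddMonoidHom.id_apply]
  rw [sdHtpyOp_single, d_cpush, d_real, bdry_sdHtpy_zero _ bary_zero, map_zero, map_zero,
    sdOp_single, sd, AddMonoidHom.id_apply, real_single, span_verts, cpush_single,
    ContinuousMap.comp_id, sub_self]

theorem d_sdHtpyOp (n : ℕ) (c : Ch X (n + 1)) :
    d (n + 1) (sdHtpyOp (n + 1) c) = c - sdOp (n + 1) c - sdHtpyOp n (d n c) := by
  refine hom_congr (f := (d (n + 1)).comp (sdHtpyOp (n + 1)))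
    (g := AddMonoidHom.id _ - sdOp (n + 1) - (sdHtpyOp n).comp (d n)) (fun σ ↦ ?_) c
  simp only [AddMonoidHom.comp_apply, AddMonoidHom.sub_apply, AddMonoidHom.id_apply]
  rw [sdHtpyOp_single, d_cpush, d_real, bdry_sdHtpy _ bary_zero, map_sub, map_sub, map_sub,
    map_sub, sdOp_single, real_single, span_verts, cpush_single, ContinuousMap.comp_id]
  congr 1
  simp only [bdry_single, d_single, map_sum, map_zsmul]
  refine Finset.sum_congr rfl fun i _ ↦ ?_
  congr 1
  rw [← face_verts, ← push_single, ← push_sdHtpy (isAff_face i).map_bary,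
    ← (isAff_face i).cpush_real, cpush_cpush, sdHtpyOp_single]

theorem sdOp_mem_supp {P : Set X → Prop} (hP : ∀ s t, s ⊆ t → P t → P s) {n : ℕ} {c : Ch X n}
    (hc : c ∈ supp {σ : C(Simplex n, X) | P (range σ)}) :
    sdOp n c ∈ supp {σ : C(Simplex n, X) | P (range σ)} := by
  refine apply_mem_of_mem_supp _ (fun σ hσ ↦ ?_) hc
  rw [sdOp_single]
  refine supp_mono (fun τ hτ ↦ hP _ _ hτ hσ) (cpush_mem_chIn (A := univ) (B := range σ) σ
    (fun x _ ↦ ⟨x, rfl⟩) (chIn_univ _ _))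

theorem sdHtpyOp_mem_chIn {A : Set X} {n : ℕ} {c : Ch X n} (hc : c ∈ chIn A n) :
    sdHtpyOp n c ∈ chIn A (n + 1) := by
  refine apply_mem_of_mem_supp _ (fun σ hσ ↦ ?_) hc
  rw [sdHtpyOp_single]
  exact cpush_mem_chIn (A := univ) σ (fun x _ ↦ hσ ⟨x, rfl⟩) (chIn_univ _ _)

theorem sdOp_real {m : ℕ} (n : ℕ) (c : Tup (Simplex m) n) :
    sdOp n (real n c) = real n (sd (bary (Simplex m)) n c) := by
  refine hom_congr (f := (sdOp n).comp (real n)) (g := (real n).comp (sd (bary (Simplex m)) n))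
    (fun v ↦ ?_) c
  simp only [AddMonoidHom.comp_apply]
  rw [real_single, sdOp_single, (isAff_span v).cpush_real, push_sd (isAff_span v).map_bary,
    push_single]
  congr 3
  ext j : 1
  change span v (stdSimplex.vertex j) = v j
  apply Subtype.ext
  rw [simplexSpan_coe, Finset.sum_eq_single j]
  · simp
  · intro k _ hk
    simp [hk]
  · simp

end Subdivision

end SingularChains

namespace SingularChains

open FreeChains TupleChains AffineSpan

variable {X : Type*} [TopologicalSpace X]

/-! ### Iterated subdivisions are small -/

section Small

variable {m : ℕ}

theorem dist_span_le {n : ℕ} (v : Fin (n + 1) → Simplex m) {p : Simplex m} {r : ℝ}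
    (h : ∀ j, dist (v j) p ≤ r) (t : Simplex n) : dist (span v t) p ≤ r := by
  have := (convex_closedBall (p.1 : Fin (m + 1) → ℝ) r).sum_mem (t := Finset.univ)
    (w := t.1) (z := fun j ↦ (v j).1) (fun j _ ↦ t.2.1 j) t.2.2 (fun j _ ↦ h j)
  exact this

/-- The barycenter lies within `n / (n + 1)` of the mutual distance of the vertices from each
vertex. -/
theorem dist_bary_le {n : ℕ} (v : Fin (n + 1) → Simplex m) {r : ℝ}
    (h : ∀ i j, dist (v i) (v j) ≤ r) (i : Fin (n + 1)) :
    dist (v i) (bary (Simplex m) n v) ≤ n / (n + 1) * r := by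
  have h1 : (v i).1 - (bary (Simplex m) n v).1 =
      ∑ j, ((n : ℝ) + 1)⁻¹ • ((v i).1 - (v j).1) := by
    have h2 : (bary (Simplex m) n v).1 = ∑ j, ((n : ℝ) + 1)⁻¹ • (v j).1 := by
      change ∑ j, (stdSimplex.barycenter : Simplex n).1 j • (v j).1 = _
      simp only [stdSimplex.barycenter_apply, Fintype.card_fin, Nat.cast_add, Nat.cast_one]
    rw [h2]
    simp only [smul_sub, Finset.sum_sub_distrib]
    congr 1
    rw [← Finset.sum_smul, Finset.sum_const, Finset.card_univ, Fintype.card_fin, nsmul_eq_mul,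
      Nat.cast_add, Nat.cast_one, mul_inv_cancel₀ (by positivity), one_smul]
  have h3 : dist (v i) (bary (Simplex m) n v) = ‖(v i).1 - (bary (Simplex m) n v).1‖ :=
    dist_eq_norm (v i).1 _
  rw [h3, h1]
  refine (norm_sum_le _ _).trans ?_
  rw [Fin.sum_univ_succAbove _ i, sub_self, smul_zero, norm_zero, zero_add]
  have h4 : ∀ j : Fin n, ‖((n : ℝ) + 1)⁻¹ • ((v i).1 - (v (i.succAbove j)).1)‖ ≤
      ((n : ℝ) + 1)⁻¹ * r := by
    intro j
    rw [norm_smul, Real.norm_of_nonneg (by positivity)]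
    refine mul_le_mul_of_nonneg_left ?_ (by positivity)
    exact (dist_eq_norm (v i).1 (v (i.succAbove j)).1).symm.le.trans (h _ _)
  refine (Finset.sum_le_sum fun j _ ↦ h4 j).trans (le_of_eq ?_)
  rw [Finset.sum_const, Finset.card_univ, Fintype.card_fin, nsmul_eq_mul]
  ring

/-- Barycentric subdivision shrinks the mesh of an `n`-simplex by the factor `n / (n + 1)`. -/
theorem sd_single_mem (n : ℕ) (v : Fin (n + 1) → Simplex m) {r : ℝ}
    (h : ∀ i j, dist (v i) (v j) ≤ r) :
    sd (bary (Simplex m)) n (Finsupp.single v 1) ∈ supp {w : Fin (n + 1) → Simplex m |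
      (∀ i, w i ∈ range (span v)) ∧ ∀ i j, dist (w i) (w j) ≤ n / (n + 1) * r} := by
  have hr : 0 ≤ r := dist_nonneg.trans (h 0 0)
  induction n with
  | zero =>
    refine single_mem_supp ?_ 1
    refine ⟨fun i ↦ ⟨stdSimplex.barycenter, ?_⟩, fun i j ↦ ?_⟩
    · obtain rfl : i = 0 := Subsingleton.elim (α := Fin 1) _ _
      exact bary_zero v
    · obtain rfl : i = j := Subsingleton.elim (α := Fin 1) _ _
      simp
  | succ n ih =>
    rw [sd_succ_single, bdry_single, map_sum, map_sum]
    refine sum_mem fun i _ ↦ ?_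
    rw [map_zsmul, map_zsmul]
    refine zsmul_mem (apply_mem_of_mem_supp _ (fun w hw ↦ ?_)
      (ih (v ∘ i.succAbove) fun _ _ ↦ h _ _)) _
    rw [cone_single]
    have hw1 : ∀ j, w j ∈ range (span v) := fun j ↦ by
      obtain ⟨t, ht⟩ := hw.1 j
      exact ⟨face i t, by rw [← ht, ← span_face]; rfl⟩
    have hw2 : ∀ j, dist (w j) (bary (Simplex m) (n + 1) v) ≤
        ((n + 1 : ℕ) : ℝ) / ((n + 1 : ℕ) + 1) * r := fun j ↦ by
      obtain ⟨t, ht⟩ := hw1 j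
      rw [← ht]
      exact dist_span_le v (dist_bary_le v h) t
    have hw3 : ∀ j k, dist (w j) (w k) ≤ ((n + 1 : ℕ) : ℝ) / ((n + 1 : ℕ) + 1) * r := by
      refine fun j k ↦ (hw.2 j k).trans (mul_le_mul_of_nonneg_right ?_ hr)
      rw [div_le_div_iff₀ (by positivity) (by positivity)]
      push_cast
      nlinarith
    refine single_mem_supp ?_ 1
    refine ⟨fun j ↦ ?_, fun j k ↦ ?_⟩
    · refine Fin.cases ⟨stdSimplex.barycenter, rfl⟩ (fun j ↦ ?_) j
      exact hw1 j
    · refine Fin.cases ?_ (fun j ↦ ?_) j <;> refine Fin.cases ?_ (fun k ↦ ?_) k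
      · simp only [Fin.cons_zero, dist_self]
        positivity
      · rw [dist_comm]
        exact hw2 k
      · exact hw2 j
      · exact hw3 j k

theorem sd_iterate_mem (n k : ℕ) {r : ℝ} {c : Tup (Simplex m) n}
    (hc : c ∈ supp {w : Fin (n + 1) → Simplex m | ∀ i j, dist (w i) (w j) ≤ r}) :
    (sd (bary (Simplex m)) n)^[k] c ∈ supp {w : Fin (n + 1) → Simplex m |
      ∀ i j, dist (w i) (w j) ≤ ((n : ℝ) / (n + 1)) ^ k * r} := by
  induction k with
  | zero => simpa using hc
  | succ k ih =>
    rw [Function.iterate_succ_apply']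
    refine apply_mem_of_mem_supp _ (fun w hw ↦ ?_) ih
    refine supp_mono (fun u hu i j ↦ (hu.2 i j).trans (le_of_eq ?_)) (sd_single_mem n w hw)
    ring

theorem sdOp_iterate_real {n : ℕ} (k : ℕ) (c : Tup (Simplex m) n) :
    (sdOp n)^[k] (real n c) = real n ((sd (bary (Simplex m)) n)^[k] c) := by
  induction k with
  | zero => rfl
  | succ k ih => rw [Function.iterate_succ_apply', ih, sdOp_real, Function.iterate_succ_apply']

theorem cpush_sdOp_iterate {Y : Type*} [TopologicalSpace Y] (f : C(X, Y)) {n : ℕ} (k : ℕ)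
    (c : Ch X n) : cpush f n ((sdOp n)^[k] c) = (sdOp n)^[k] (cpush f n c) := by
  induction k with
  | zero => rfl
  | succ k ih => rw [Function.iterate_succ_apply', cpush_sdOp, ih, Function.iterate_succ_apply']

/-- Simplices that lie in a member of the family `W`. -/
def smallSimplices {ι : Type*} (W : ι → Set X) (n : ℕ) : Set C(Simplex n, X) :=
  {σ | ∃ i, range σ ⊆ W i}

theorem sdOp_iterate_mem_small {ι : Type*} {W : ι → Set X} {n : ℕ} (k : ℕ) {c : Ch X n}
    (hc : c ∈ supp (smallSimplices W n)) : (sdOp n)^[k] c ∈ supp (smallSimplices W n) := by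
  induction k with
  | zero => exact hc
  | succ k ih =>
    rw [Function.iterate_succ_apply']
    exact sdOp_mem_supp (P := fun s ↦ ∃ i, s ⊆ W i) (fun s t hst ⟨i, hi⟩ ↦ ⟨i, hst.trans hi⟩) ih

theorem exists_sdOp_iterate_single_mem_small {ι : Type*} {W : ι → Set X} (hW : ∀ i, IsOpen (W i))
    (hU : ⋃ i, W i = univ) {n : ℕ} (σ : C(Simplex n, X)) :
    ∃ k, (sdOp n)^[k] (Finsupp.single σ 1) ∈ supp (smallSimplices W n) := by
  obtain ⟨δ, hδ, H⟩ := lebesgue_number_lemma_of_metric (s := (univ : Set (Simplex n)))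
    isCompact_univ (c := fun i ↦ σ ⁻¹' W i) (fun i ↦ (hW i).preimage σ.continuous)
    (by rw [← preimage_iUnion, hU, preimage_univ])
  have hq : (n : ℝ) / (n + 1) < 1 := by
    rw [div_lt_one (by positivity)]
    linarith
  have hlim := (tendsto_pow_atTop_nhds_zero_of_lt_one (by positivity) hq).mul_const
    (Metric.diam (univ : Set (Simplex n)))
  rw [zero_mul] at hlim
  obtain ⟨k, hk⟩ := (hlim.eventually (gt_mem_nhds hδ)).exists
  refine ⟨k, ?_⟩
  have h1 : Finsupp.single σ (1 : ℤ) = cpush σ n (real n (Finsupp.single (verts n) 1)) := by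
    rw [real_single, span_verts, cpush_single, ContinuousMap.comp_id]
  have h2 : (Finsupp.single (verts n) 1 : Tup (Simplex n) n) ∈ supp {w : Fin (n + 1) → Simplex n |
      ∀ i j, dist (w i) (w j) ≤ Metric.diam (univ : Set (Simplex n))} :=
    by
      refine single_mem_supp ?_ 1
      exact fun i j ↦ Metric.dist_le_diam_of_mem isCompact_univ.isBounded (mem_univ _) (mem_univ _)
  rw [h1, ← cpush_sdOp_iterate, sdOp_iterate_real]
  refine apply_mem_of_mem_supp ((cpush σ n).comp (real n)) (fun w hw ↦ ?_) (sd_iterate_mem n k h2)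
  rw [AddMonoidHom.comp_apply, real_single, cpush_single]
  obtain ⟨i, hi⟩ := H (w 0) (mem_univ _)
  refine single_mem_supp ?_ 1
  refine ⟨i, ?_⟩
  rintro _ ⟨t, rfl⟩
  exact hi ((dist_span_le w (fun j ↦ hw j 0) t).trans_lt hk)

/-- Every singular chain becomes small of the order of an open cover after sufficiently many
barycentric subdivisions. -/
theorem exists_sdOp_iterate_mem_small {ι : Type*} {W : ι → Set X} (hW : ∀ i, IsOpen (W i))
    (hU : ⋃ i, W i = univ) {n : ℕ} (c : Ch X n) :
    ∃ k, ∀ j ≥ k, (sdOp n)^[j] c ∈ supp (smallSimplices W n) := by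
  suffices h : ∃ k, (sdOp n)^[k] c ∈ supp (smallSimplices W n) by
    obtain ⟨k, hk⟩ := h
    refine ⟨k, fun j hj ↦ ?_⟩
    obtain ⟨i, rfl⟩ := Nat.exists_eq_add_of_le' hj
    rw [Function.iterate_add_apply]
    exact sdOp_iterate_mem_small i hk
  induction c using Finsupp.induction_linear with
  | zero => exact ⟨0, zero_mem _⟩
  | add a b ha hb =>
    obtain ⟨i, hi⟩ := ha
    obtain ⟨j, hj⟩ := hb
    refine ⟨i + j, ?_⟩
    rw [iterate_map_add]
    refine add_mem ?_ ?_
    · rw [add_comm i j, Function.iterate_add_apply]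
      exact sdOp_iterate_mem_small j hi
    · rw [Function.iterate_add_apply]
      exact sdOp_iterate_mem_small i hj
  | single σ m =>
    obtain ⟨k, hk⟩ := exists_sdOp_iterate_single_mem_small hW hU σ
    refine ⟨k, ?_⟩
    have h1 : Finsupp.single σ m = m • Finsupp.single σ 1 := by simp
    rw [h1, iterate_map_zsmul]
    exact zsmul_mem hk m

end Small

end SingularChains

/-! ### Comparison with the singular chain complex of Mathlib -/

namespace SingularChains

open FreeChains RelSing

variable {X Y Z : Type u} [TopologicalSpace X] [TopologicalSpace Y] [TopologicalSpace Z]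

section Comparison

open scoped Simplicial

/-- The basis element of the singular chain complex attached to a simplex of the singular set. -/
noncomputable def gen {n : ℕ} (x : (TopCat.toSSet.obj (TopCat.of X)) _⦋n⦌) : (chains X).X n :=
  (SSet.ιChainComplex (TopCat.toSSet.obj (TopCat.of X))
    (R := AddCommGrpCat.of (ULift.{u} ℤ)) x).hom ⟨1⟩

theorem chains_hom_ext {n : ℕ} {A : Type u} [AddCommGroup A] {f g : (chains X).X n →+ A}
    (h : ∀ x : (TopCat.toSSet.obj (TopCat.of X)) _⦋n⦌, f (gen x) = g (gen x)) : f = g := by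
  suffices h' : AddCommGrpCat.ofHom f = AddCommGrpCat.ofHom g from
    congrArg AddCommGrpCat.Hom.hom h'
  refine SSet.chainComplex_hom_ext (X := TopCat.toSSet.obj (TopCat.of X))
    (R := AddCommGrpCat.of (ULift.{u} ℤ)) fun x ↦ ?_
  refine AddCommGrpCat.hom_ext ?_
  have : (f.comp (SSet.ιChainComplex (TopCat.toSSet.obj (TopCat.of X))
    (R := AddCommGrpCat.of (ULift.{u} ℤ)) x).hom).comp
      (AddEquiv.ulift.symm.toAddMonoidHom : ℤ →+ ULift.{u} ℤ) =
      (g.comp (SSet.ιChainComplex (TopCat.toSSet.obj (TopCat.of X))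
    (R := AddCommGrpCat.of (ULift.{u} ℤ)) x).hom).comp
      (AddEquiv.ulift.symm.toAddMonoidHom : ℤ →+ ULift.{u} ℤ) :=
    AddMonoidHom.ext_int (h x)
  ext ⟨k⟩
  exact DFunLike.congr_fun this k

/-- The simplex of the singular set attached to a continuous map. -/
noncomputable def simp (X : Type u) [TopologicalSpace X] (n : ℕ) :
    (TopCat.toSSet.obj (TopCat.of X)) _⦋n⦌ ≃ C(Simplex n, X) :=
  TopCat.toSSetObjEquiv (TopCat.of X) (op ⦋n⦌)

theorem simp_δ {n : ℕ} (i : Fin (n + 2)) (x : (TopCat.toSSet.obj (TopCat.of X)) _⦋n + 1⦌) :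
    simp X n ((TopCat.toSSet.obj (TopCat.of X)).δ i x) = (simp X (n + 1) x).comp (face i) := by
  rfl

theorem simp_map (f : C(X, Y)) {n : ℕ} (x : (TopCat.toSSet.obj (TopCat.of X)) _⦋n⦌) :
    simp Y n ((TopCat.toSSet.map (TopCat.ofHom f)).app _ x) = f.comp (simp X n x) := by
  rfl

/-- The comparison map from the singular chains to combinations of continuous maps. -/
noncomputable def toCh (X : Type u) [TopologicalSpace X] (n : ℕ) : (chains X).X n →+ Ch X n :=
  ((SSet.isColimitChainComplexXCofan (TopCat.toSSet.obj (TopCat.of X))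
    (AddCommGrpCat.of (ULift.{u} ℤ)) n).desc (Limits.Cofan.mk (AddCommGrpCat.of (Ch X n)) fun x ↦
      AddCommGrpCat.ofHom ((Finsupp.singleAddHom (simp X n x)).comp
        AddEquiv.ulift.toAddMonoidHom))).hom

theorem toCh_gen {n : ℕ} (x : (TopCat.toSSet.obj (TopCat.of X)) _⦋n⦌) :
    toCh X n (gen x) = Finsupp.single (simp X n x) 1 := by
  have := (SSet.isColimitChainComplexXCofan (TopCat.toSSet.obj (TopCat.of X))
    (AddCommGrpCat.of (ULift.{u} ℤ)) n).fac (Limits.Cofan.mk (AddCommGrpCat.of (Ch X n)) fun x ↦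
      AddCommGrpCat.ofHom ((Finsupp.singleAddHom (simp X n x)).comp
        AddEquiv.ulift.toAddMonoidHom)) ⟨x⟩
  refine (congrArg (fun φ ↦ AddCommGrpCat.Hom.hom φ (ULift.up (1 : ℤ))) this).trans ?_
  rfl

/-- Singular chains are integral combinations of continuous maps from the standard simplex. -/
noncomputable def chEquiv (X : Type u) [TopologicalSpace X] (n : ℕ) :
    (chains X).X n ≃+ Ch X n :=
  AddMonoidHom.toAddEquiv (toCh X n) (liftFree fun σ ↦ gen ((simp X n).symm σ))
    (chains_hom_ext fun x ↦ by simp [toCh_gen])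
    (hom_ext fun σ ↦ by simp [toCh_gen])

theorem chEquiv_gen {n : ℕ} (x : (TopCat.toSSet.obj (TopCat.of X)) _⦋n⦌) :
    chEquiv X n (gen x) = Finsupp.single (simp X n x) 1 :=
  toCh_gen x

theorem chEquiv_push (f : C(X, Y)) (n : ℕ) (c : (chains X).X n) :
    chEquiv Y n (push f n c) = cpush f n (chEquiv X n c) := by
  have : (chEquiv Y n).toAddMonoidHom.comp (push f n) =
      (cpush f n).comp (chEquiv X n).toAddMonoidHom := by
    refine chains_hom_ext fun x ↦ ?_
    have h : push f n (gen x) = gen ((TopCat.toSSet.map (TopCat.ofHom f)).app _ x) :=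
      congrArg (fun φ ↦ AddCommGrpCat.Hom.hom φ (ULift.up (1 : ℤ))) (SSet.ι_chainComplexMap_f
        (f := TopCat.toSSet.map (TopCat.ofHom f)) (R := AddCommGrpCat.of (ULift.{u} ℤ)) (x := x))
    change chEquiv Y n (push f n (gen x)) = cpush f n (chEquiv X n (gen x))
    rw [h, chEquiv_gen, chEquiv_gen, cpush_single, simp_map]
  exact DFunLike.congr_fun this c

theorem hom_sum_apply {M N : AddCommGrpCat.{u}} {ι : Type*} (s : Finset ι) (f : ι → (M ⟶ N))
    (x : M) : (∑ i ∈ s, f i).hom x = ∑ i ∈ s, (f i).hom x := by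
  have h := map_sum (AddCommGrpCat.homAddEquiv (M := M) (N := N)) f s
  exact (DFunLike.congr_fun h x).trans (AddMonoidHom.finsetSum_apply _ s x)

theorem chEquiv_diff (n : ℕ) (c : (chains X).X (n + 1)) :
    chEquiv X n (diff X (n + 1) n c) = d n (chEquiv X (n + 1) c) := by
  have : (chEquiv X n).toAddMonoidHom.comp (diff X (n + 1) n) =
      (d n).comp (chEquiv X (n + 1)).toAddMonoidHom := by
    refine chains_hom_ext fun x ↦ ?_
    have h : diff X (n + 1) n (gen x) =
        ∑ i : Fin (n + 2), (-1 : ℤ) ^ (i : ℕ) • gen ((TopCat.toSSet.obj (TopCat.of X)).δ i x) := by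
      have := congrArg (fun φ ↦ AddCommGrpCat.Hom.hom φ (ULift.up (1 : ℤ))) (SSet.ιChainComplex_d
        (X := TopCat.toSSet.obj (TopCat.of X)) (R := AddCommGrpCat.of (ULift.{u} ℤ)) (x := x))
      refine this.trans ?_
      refine (hom_sum_apply _ _ _).trans ?_
      simp only [AddCommGrpCat.hom_zsmul]
      rfl
    change chEquiv X n (diff X (n + 1) n (gen x)) = d n (chEquiv X (n + 1) (gen x))
    rw [h, chEquiv_gen, d_single, map_sum]
    simp only [map_zsmul, chEquiv_gen, simp_δ]
  exact DFunLike.congr_fun this c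

theorem diff_eq_zero {n m : ℕ} (h : m + 1 ≠ n) (c : (chains X).X n) : diff X n m c = 0 :=
  congrArg (fun φ ↦ AddCommGrpCat.Hom.hom φ c) ((chains X).shape n m h)

theorem d_d (n : ℕ) (c : Ch X (n + 2)) : d n (d (n + 1) c) = 0 := by
  obtain ⟨c, rfl⟩ := (chEquiv X _).surjective c
  rw [← chEquiv_diff, ← chEquiv_diff, RelSing.diff_diff, map_zero]

end Comparison

theorem mem_chainsIn_iff {A : Set X} {n : ℕ} {c : (chains X).X n} :
    c ∈ chainsIn A n ↔ chEquiv X n c ∈ chIn A n := by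
  constructor
  · rintro ⟨c, rfl⟩
    rw [chEquiv_push]
    exact cpush_mem_chIn (A := univ) _ (fun x _ ↦ x.2) (chIn_univ _ _)
  · intro hc
    let j : C(A, X) := ⟨Subtype.val, continuous_subtype_val⟩
    have h1 : chEquiv X n c ∈ supp ((fun σ : C(Simplex n, A) ↦ j.comp σ) '' univ) := by
      refine supp_mono (fun σ hσ ↦ ?_) hc
      exact ⟨⟨fun t ↦ ⟨σ t, hσ ⟨t, rfl⟩⟩, by fun_prop⟩, mem_univ _, rfl⟩
    obtain ⟨e, -, he⟩ := exists_map_eq_of_mem_supp_image h1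
    refine ⟨(chEquiv A n).symm e, (chEquiv X n).injective ?_⟩
    rw [chEquiv_push, AddEquiv.apply_symm_apply]
    exact he

/-! ### Relative cycles and boundaries -/

/-- The condition that the boundary of an `n`-chain lies in `B`; it is void for `n = 0`. -/
def BdryIn (B : Set X) : (n : ℕ) → Ch X n → Prop
  | 0, _ => True
  | n + 1, c => d n c ∈ chIn B n

theorem mem_relCycles_iff {A B : Set X} {n : ℕ} {c : (chains X).X n} :
    c ∈ relCycles A B n ↔ chEquiv X n c ∈ chIn A n ∧ BdryIn B n (chEquiv X n c) := by
  rw [mem_relCycles, mem_chainsIn_iff]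
  refine and_congr_right fun _ ↦ ?_
  cases n with
  | zero =>
    refine iff_of_true (fun j ↦ ?_) trivial
    rw [diff_eq_zero (by omega)]
    exact zero_mem _
  | succ n =>
    change _ ↔ d n _ ∈ _
    rw [← chEquiv_diff, ← mem_chainsIn_iff]
    refine ⟨fun h ↦ h n, fun h j ↦ ?_⟩
    by_cases hj : j = n
    · rw [hj]
      exact h
    · rw [diff_eq_zero (by omega)]
      exact zero_mem _

theorem mem_relBoundaries_iff {A B : Set X} {n : ℕ} {c : (chains X).X n} :
    c ∈ relBoundaries A B n ↔
      ∃ y ∈ chIn A (n + 1), chEquiv X n c - d n y ∈ chIn B n := by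
  constructor
  · intro h
    obtain ⟨_, ⟨y, hy, rfl⟩, b, hb, rfl⟩ := AddSubgroup.mem_sup.1 h
    refine ⟨chEquiv X _ y, mem_chainsIn_iff.1 hy, ?_⟩
    rw [map_add, chEquiv_diff, add_sub_cancel_left]
    exact mem_chainsIn_iff.1 hb
  · rintro ⟨y, hy, h⟩
    have h1 : c = diff X (n + 1) n ((chEquiv X _).symm y) +
        (c - diff X (n + 1) n ((chEquiv X _).symm y)) := by abel
    rw [h1]
    refine add_mem (AddSubgroup.mem_sup_left ⟨_, mem_chainsIn_iff.2 ?_, rfl⟩)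
      (AddSubgroup.mem_sup_right (mem_chainsIn_iff.2 ?_))
    · rwa [AddEquiv.apply_symm_apply]
    · rwa [map_sub, chEquiv_diff, AddEquiv.apply_symm_apply]

/-- The relative homology class of a relative cycle, given as a combination of continuous maps. -/
noncomputable def cls (A B : Set X) (n : ℕ) (c : Ch X n) (h1 : c ∈ chIn A n) (h2 : BdryIn B n c) :
    relHomology A B n :=
  QuotientAddGroup.mk ⟨(chEquiv X n).symm c, mem_relCycles_iff.2
    (by rw [AddEquiv.apply_symm_apply]; exact ⟨h1, h2⟩)⟩

theorem exists_cls {A B : Set X} {n : ℕ} (x : relHomology A B n) :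
    ∃ c h1 h2, x = cls A B n c h1 h2 := by
  obtain ⟨⟨c, hc⟩, rfl⟩ := QuotientAddGroup.mk_surjective x
  have := mem_relCycles_iff.1 hc
  refine ⟨chEquiv X n c, this.1, this.2, ?_⟩
  simp only [cls, AddEquiv.symm_apply_apply]

theorem cls_eq_cls {A B : Set X} {n : ℕ} {c c' : Ch X n} {h1 h2 h1' h2'} :
    cls A B n c h1 h2 = cls A B n c' h1' h2' ↔
      ∃ y ∈ chIn A (n + 1), c - c' - d n y ∈ chIn B n := by
  rw [cls, cls, QuotientAddGroup.eq]
  rw [AddSubgroup.mem_addSubgroupOf, mem_relBoundaries_iff]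
  simp only [AddSubgroup.coe_add, NegMemClass.coe_neg, map_add, map_neg, AddEquiv.apply_symm_apply]
  constructor
  · rintro ⟨y, hy, h⟩
    refine ⟨-y, neg_mem hy, ?_⟩
    rw [map_neg]
    convert neg_mem h using 1
    abel
  · rintro ⟨y, hy, h⟩
    refine ⟨-y, neg_mem hy, ?_⟩
    rw [map_neg]
    convert neg_mem h using 1
    abel

theorem cls_eq_zero {A B : Set X} {n : ℕ} {c : Ch X n} {h1 h2} :
    cls A B n c h1 h2 = 0 ↔ ∃ y ∈ chIn A (n + 1), c - d n y ∈ chIn B n := by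
  have h0 : (0 : relHomology A B n) = cls A B n 0 (zero_mem _) (by
      cases n with
      | zero => trivial
      | succ n => change d n 0 ∈ _; rw [map_zero]; exact zero_mem _) := by
    rw [cls]
    simp only [map_zero]
    rfl
  rw [h0, cls_eq_cls]
  simp only [sub_zero]

theorem BdryIn.cpush {B : Set X} {B' : Set Y} {f : C(X, Y)} (hB : MapsTo f B B') {n : ℕ}
    {c : Ch X n} (hc : BdryIn B n c) : BdryIn B' n (cpush f n c) := by
  cases n with
  | zero => trivial
  | succ n =>
    change d n _ ∈ _
    rw [d_cpush]
    exact cpush_mem_chIn f hB hc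

theorem relHomologyMap_cls {A B : Set X} {A' B' : Set Y} (f : C(X, Y)) (hA : MapsTo f A A')
    (hB : MapsTo f B B') (n : ℕ) (c : Ch X n) (h1 h2) :
    relHomologyMap f hA hB n (cls A B n c h1 h2) =
      cls A' B' n (cpush f n c) (cpush_mem_chIn f hA h1) (h2.cpush hB) := by
  refine congrArg QuotientAddGroup.mk (Subtype.ext ((chEquiv Y n).injective ?_))
  rw [AddEquiv.apply_symm_apply]
  change chEquiv Y n (push f n ((chEquiv X n).symm c)) = _
  rw [chEquiv_push, AddEquiv.apply_symm_apply]

theorem BdryIn.d {B' : Set X} {n : ℕ} (c : Ch X (n + 1)) : BdryIn B' n (d n c) := by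
  cases n with
  | zero => trivial
  | succ n =>
    change SingularChains.d n _ ∈ _
    rw [d_d]
    exact zero_mem _

theorem connecting_cls (A B B' : Set X) (n : ℕ) (c : Ch X (n + 1)) (h1)
    (h2 : BdryIn B (n + 1) c) :
    connecting A B B' n (cls A B (n + 1) c h1 h2) = cls B B' n (d n c) h2 (.d c) := by
  refine congrArg QuotientAddGroup.mk (Subtype.ext ((chEquiv X n).injective ?_))
  rw [AddEquiv.apply_symm_apply]
  change chEquiv X n (diff X (n + 1) n ((chEquiv X (n + 1)).symm c)) = _
  rw [chEquiv_diff, AddEquiv.apply_symm_apply]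

theorem relHomologyMap_comp {A B : Set X} {A' B' : Set Y} {A'' B'' : Set Z} (g : C(Y, Z))
    (f : C(X, Y)) (hA : MapsTo f A A') (hB : MapsTo f B B') (hA' : MapsTo g A' A'')
    (hB' : MapsTo g B' B'') (n : ℕ) (x : relHomology A B n) :
    relHomologyMap g hA' hB' n (relHomologyMap f hA hB n x) =
      relHomologyMap (g.comp f) (hA'.comp hA) (hB'.comp hB) n x := by
  obtain ⟨c, h1, h2, rfl⟩ := exists_cls x
  simp only [relHomologyMap_cls, cpush_cpush]

end SingularChains

namespace SingularChains

open FreeChains RelSing TupleChains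

/-! ### Homology of contractible spaces -/

section Contractible

variable {X : Type u} [TopologicalSpace X]

theorem aug_d (c : Ch X 1) : aug (d 0 c) = 0 := by
  refine hom_congr (f := aug.comp (d 0)) (g := 0) (fun v ↦ ?_) c
  simp [d_single, Fin.sum_univ_succ]

theorem aug_cpush {Y : Type*} [TopologicalSpace Y] (f : C(X, Y)) (n : ℕ) (c : Ch X n) :
    aug (cpush f n c) = aug c :=
  hom_congr (f := aug.comp (cpush f n)) (g := aug) (fun v ↦ by simp [cpush_single]) c

theorem cpush_const (p : X) (n : ℕ) (c : Ch X n) :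
    cpush (ContinuousMap.const X p) n c =
      aug c • Finsupp.single (ContinuousMap.const (Simplex n) p) 1 :=
  hom_congr (f := cpush (ContinuousMap.const X p) n)
    (g := (zmultiplesHom _ (Finsupp.single (ContinuousMap.const (Simplex n) p) 1)).comp aug)
    (fun v ↦ by rw [cpush_single]; simp) c

theorem d_const (p : X) (n : ℕ) :
    d n (Finsupp.single (ContinuousMap.const (Simplex (n + 1)) p) 1) =
      (if Even n then 0 else 1 : ℤ) • Finsupp.single (ContinuousMap.const (Simplex n) p) 1 := by
  have h := Fin.sum_neg_one_pow ℤ (n + 2)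
  rw [d_single]
  simp only [ContinuousMap.const_comp]
  rw [← Finset.sum_smul, h]
  simp [Nat.even_add]

theorem exists_homotopy_const [ContractibleSpace X] :
    ∃ (p : X) (h : C(X × unitInterval, X)), slice h 0 = ContinuousMap.id X ∧
      slice h 1 = ContinuousMap.const X p := by
  obtain ⟨p, ⟨F⟩⟩ := id_nullhomotopic X
  refine ⟨p, F.toContinuousMap.comp ContinuousMap.prodSwap, ?_, ?_⟩
  · ext x
    exact F.apply_zero x
  · ext x
    exact F.apply_one x

theorem exists_d_eq_of_contractible_zero [ContractibleSpace X] {c : Ch X 0} (hc : aug c = 0) :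
    ∃ y, d 0 y = c := by
  obtain ⟨p, h, h0, h1⟩ := exists_homotopy_const (X := X)
  refine ⟨-prismOp h 0 c, ?_⟩
  rw [map_neg, d_prismOp_zero, h0, h1, cpush_const, hc, cpush_id]
  simp

theorem exists_d_eq_of_contractible [ContractibleSpace X] {n : ℕ} {c : Ch X (n + 1)}
    (hc : d n c = 0) : ∃ y, d (n + 1) y = c := by
  obtain ⟨p, h, h0, h1⟩ := exists_homotopy_const (X := X)
  have key := d_prismOp h n c
  rw [h0, h1, hc, map_zero, cpush_id, cpush_const, sub_zero] at key
  have h2 : aug c • d n (Finsupp.single (ContinuousMap.const (Simplex (n + 1)) p) 1) = 0 := by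
    rw [← map_zsmul, ← cpush_const, d_cpush, hc, map_zero]
  rw [d_const] at h2
  -- In odd degree the constant simplex bounds; in even degree it is not a cycle.
  by_cases hn : Even n
  · refine ⟨aug c • Finsupp.single (ContinuousMap.const (Simplex (n + 2)) p) 1 -
      prismOp h (n + 1) c, ?_⟩
    rw [map_sub, key, map_zsmul, d_const, if_neg (by simpa [Nat.even_add_one] using hn), one_smul]
    abel
  · rw [if_neg hn, one_smul] at h2
    have h3 : aug c = 0 := by
      have := congrArg aug h2
      rw [map_zsmul, map_zero, aug_single] at this
      simpa using this
    refine ⟨-prismOp h (n + 1) c, ?_⟩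
    rw [map_neg, key, h3]
    simp

/-- The inclusion of a subspace. -/
def incl (A : Set X) : C(A, X) := ⟨Subtype.val, continuous_subtype_val⟩

theorem mapsTo_incl (A : Set X) : MapsTo (incl A) univ A := fun x _ ↦ x.2

theorem mapsTo_incl_preimage (A B : Set X) : MapsTo (incl A) (Subtype.val ⁻¹' B) B := fun _ h ↦ h

/-- Chains in a subspace are chains of the subspace. -/
theorem exists_cpush_val_eq {A : Set X} {n : ℕ} {c : Ch X n} (hc : c ∈ chIn A n) :
    ∃ e : Ch A n, cpush (incl A) n e = c := by
  have h1 : c ∈ supp ((fun σ : C(Simplex n, A) ↦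
      (incl A).comp σ) '' univ) := by
    refine supp_mono (fun σ hσ ↦ ?_) hc
    exact ⟨⟨fun t ↦ ⟨σ t, hσ ⟨t, rfl⟩⟩, by fun_prop⟩, mem_univ _, rfl⟩
  obtain ⟨e, -, he⟩ := exists_map_eq_of_mem_supp_image h1
  exact ⟨e, he⟩

theorem cpush_injective {Y : Type*} [TopologicalSpace Y] {f : C(X, Y)}
    (hf : Function.Injective f) (n : ℕ) : Function.Injective (cpush f n) :=
  Finsupp.mapDomain_injective fun _ _ h ↦ ContinuousMap.ext fun t ↦ hf (DFunLike.congr_fun h t)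

theorem cpush_val_mem_chIn {A : Set X} {n : ℕ} (e : Ch A n) :
    cpush (incl A) n e ∈ chIn A n :=
  cpush_mem_chIn (A := univ) _ (mapsTo_incl A) (chIn_univ _ _)

theorem exists_d_eq_of_contractible_subset_zero {A : Set X} [ContractibleSpace A] {c : Ch X 0}
    (hA : c ∈ chIn A 0) (hc : aug c = 0) : ∃ y ∈ chIn A 1, d 0 y = c := by
  obtain ⟨e, rfl⟩ := exists_cpush_val_eq hA
  rw [aug_cpush] at hc
  obtain ⟨y, rfl⟩ := exists_d_eq_of_contractible_zero hc
  exact ⟨_, cpush_val_mem_chIn y, d_cpush _ _ _⟩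

theorem exists_d_eq_of_contractible_subset {A : Set X} [ContractibleSpace A] {n : ℕ}
    {c : Ch X (n + 1)} (hA : c ∈ chIn A (n + 1)) (hc : d n c = 0) :
    ∃ y ∈ chIn A (n + 2), d (n + 1) y = c := by
  obtain ⟨e, rfl⟩ := exists_cpush_val_eq hA
  rw [d_cpush] at hc
  have := cpush_injective Subtype.val_injective n (hc.trans (map_zero _).symm)
  obtain ⟨y, rfl⟩ := exists_d_eq_of_contractible this
  exact ⟨_, cpush_val_mem_chIn y, d_cpush _ _ _⟩

end Contractible

/-! ### Relative boundaries -/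

section RelB

variable {X : Type u} [TopologicalSpace X]

/-- Boundaries modulo chains in `S`. -/
noncomputable def relB (S : Set X) (n : ℕ) : AddSubgroup (Ch X n) := (d n).range ⊔ chIn S n

theorem d_mem_relB {S : Set X} {n : ℕ} (y : Ch X (n + 1)) : d n y ∈ relB S n :=
  AddSubgroup.mem_sup_left ⟨y, rfl⟩

theorem mem_relB_of_chIn {S : Set X} {n : ℕ} {c : Ch X n} (h : c ∈ chIn S n) : c ∈ relB S n :=
  AddSubgroup.mem_sup_right h

theorem mem_relB {S : Set X} {n : ℕ} {c : Ch X n} :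
    c ∈ relB S n ↔ ∃ y, c - d n y ∈ chIn S n := by
  constructor
  · intro h
    obtain ⟨_, ⟨y, rfl⟩, b, hb, rfl⟩ := AddSubgroup.mem_sup.1 h
    exact ⟨y, by rwa [add_sub_cancel_left]⟩
  · rintro ⟨y, hy⟩
    have := add_mem (d_mem_relB y) (mem_relB_of_chIn hy)
    rwa [add_sub_cancel] at this

/-- A deformation that preserves `S` changes a cycle relative to `S` only by a relative boundary. -/
theorem cpush_slice_sub_mem_relB {S : Set X} {h : C(X × unitInterval, X)}
    (h0 : ∀ x, h (x, 0) = x) (hS : ∀ x ∈ S, ∀ t, h (x, t) ∈ S) {n : ℕ} {c : Ch X n}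
    (hc : BdryIn S n c) : cpush (slice h 1) n c - c ∈ relB S n := by
  have h0' : slice h 0 = ContinuousMap.id X := ContinuousMap.ext h0
  cases n with
  | zero =>
    have := d_prismOp_zero h c
    rw [h0', cpush_id] at this
    rw [← this]
    exact d_mem_relB _
  | succ n =>
    have := d_prismOp h n c
    rw [h0', cpush_id, eq_sub_iff_add_eq] at this
    rw [← this]
    exact add_mem (d_mem_relB _) (mem_relB_of_chIn (prismOp_mem_chIn h hS hc))

theorem BdryIn.sdOp_iterate {S : Set X} {n : ℕ} {c : Ch X n} (hc : BdryIn S n c) (k : ℕ) :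
    BdryIn S n ((sdOp n)^[k] c) := by
  induction k with
  | zero => exact hc
  | succ k ih =>
    rw [Function.iterate_succ_apply']
    cases n with
    | zero => trivial
    | succ n =>
      change SingularChains.d n _ ∈ _
      rw [d_sdOp]
      exact sdOp_mem_supp (P := fun s ↦ s ⊆ S) (fun s t h1 h2 ↦ h1.trans h2) ih

theorem d_sdOp_iterate {n : ℕ} (k : ℕ) (c : Ch X (n + 1)) :
    d n ((sdOp (n + 1))^[k] c) = (sdOp n)^[k] (d n c) := by
  induction k with
  | zero => rfl
  | succ k ih => rw [Function.iterate_succ_apply', d_sdOp, ih, Function.iterate_succ_apply']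

theorem sdOp_iterate_mem_chIn {S : Set X} {n : ℕ} {c : Ch X n} (hc : c ∈ chIn S n) (k : ℕ) :
    (sdOp n)^[k] c ∈ chIn S n := by
  induction k with
  | zero => exact hc
  | succ k ih =>
    rw [Function.iterate_succ_apply']
    exact sdOp_mem_supp (P := fun s ↦ s ⊆ S) (fun s t h1 h2 ↦ h1.trans h2) ih

/-- Barycentric subdivision changes a cycle relative to `S` only by a relative boundary. -/
theorem sub_sdOp_iterate_mem_relB {S : Set X} {n : ℕ} {c : Ch X n} (hc : BdryIn S n c) (k : ℕ) :
    c - (sdOp n)^[k] c ∈ relB S n := by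
  have step : ∀ c : Ch X n, BdryIn S n c → c - sdOp n c ∈ relB S n := by
    intro c hc
    cases n with
    | zero =>
      rw [← d_sdHtpyOp_zero]
      exact d_mem_relB _
    | succ n =>
      have := d_sdHtpyOp n c
      rw [eq_sub_iff_add_eq] at this
      rw [← this]
      exact add_mem (d_mem_relB _) (mem_relB_of_chIn (sdHtpyOp_mem_chIn hc))
  induction k with
  | zero => simp [zero_mem]
  | succ k ih =>
    have := add_mem ih (step _ (hc.sdOp_iterate k))
    rwa [sub_add_sub_cancel, ← Function.iterate_succ_apply' (sdOp n)] at this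

end RelB

/-! ### Relative homeomorphisms of collared pairs -/

/-- A collar of `S` in `Z`: a neighbourhood `U` of `S` that is pushed into `S` by a deformation of
`Z` relative to `S`. -/
structure Collar {Z : Type u} [TopologicalSpace Z] (S : Set Z) where
  h : C(Z × unitInterval, Z)
  h_zero : ∀ z, h (z, 0) = z
  h_fix : ∀ z ∈ S, ∀ t, h (z, t) = z
  U : Set Z
  isOpen : IsOpen U
  subset : S ⊆ U
  h_one : ∀ z ∈ U, h (z, 1) ∈ S

section RelHomeo

variable {Z Y : Type u} [TopologicalSpace Z] [TopologicalSpace Y]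

/-- After enough subdivisions a chain splits into a part in the collar and a part off `S`. -/
theorem Collar.exists_iterate_split {S : Set Z} (C : Collar S) (hS : IsClosed S) {n : ℕ}
    (c : Ch Z n) : ∃ k, ∀ j ≥ k, ∃ a ∈ chIn C.U n, ∃ b ∈ chIn Sᶜ n, (sdOp n)^[j] c = a + b := by
  obtain ⟨k, hk⟩ := exists_sdOp_iterate_mem_small (W := fun b : Bool ↦ if b then C.U else Sᶜ)
    (fun b ↦ by cases b; exacts [hS.isOpen_compl, C.isOpen])
    (by
      rw [eq_univ_iff_forall]
      intro z
      by_cases hz : z ∈ S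
      · exact mem_iUnion.2 ⟨true, C.subset hz⟩
      · exact mem_iUnion.2 ⟨false, hz⟩) c
  refine ⟨k, fun j hj ↦ exists_add_of_mem_supp_union (supp_mono ?_ (hk j hj))⟩
  rintro σ ⟨b, hb⟩
  cases b
  exacts [Or.inr hb, Or.inl hb]

theorem Collar.cpush_mem {S : Set Z} (C : Collar S) {n : ℕ} {c : Ch Z n} (hc : c ∈ chIn C.U n) :
    cpush (slice C.h 1) n c ∈ chIn S n :=
  cpush_mem_chIn (A := C.U) (slice C.h 1) (fun z hz ↦ C.h_one z hz) hc

theorem Collar.sub_mem {S : Set Z} (C : Collar S) {n : ℕ} {c : Ch Z n} (hc : BdryIn S n c) :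
    cpush (slice C.h 1) n c - c ∈ relB S n :=
  cpush_slice_sub_mem_relB C.h_zero (fun z hz t ↦ (C.h_fix z hz t).symm ▸ hz) hc

/-- A map between collared pairs that restricts to a bijection between the complements of the
subspaces, lifts the simplices of the complement, and is compatible with the ends of the
deformations and with the neighbourhoods. -/
structure CollarMap {S : Set Z} {B : Set Y} (CZ : Collar S) (CY : Collar B) (f : C(Z, Y)) :
    Prop where
  isClosed : IsClosed S
  isClosed' : IsClosed B
  injOn : InjOn f Sᶜ
  mapsTo : MapsTo f S B
  lift : ∀ (n : ℕ) (σ : C(Simplex n, Y)), range σ ⊆ Bᶜ →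
    ∃ τ : C(Simplex n, Z), range τ ⊆ Sᶜ ∧ f.comp τ = σ
  comm : ∀ z, f (CZ.h (z, 1)) = CY.h (f z, 1)
  mapsTo_U : MapsTo f CZ.U CY.U
  mem_U : ∀ z ∉ S, f z ∈ CY.U → z ∈ CZ.U

variable {S : Set Z} {B : Set Y} {CZ : Collar S} {CY : Collar B} {f : C(Z, Y)}

theorem CollarMap.exists_lift (H : CollarMap CZ CY f) {n : ℕ} {c : Ch Y n} (hc : c ∈ chIn Bᶜ n) :
    ∃ w ∈ chIn Sᶜ n, cpush f n w = c := by
  refine exists_map_eq_of_mem_supp_image (supp_mono (fun σ hσ ↦ ?_) hc)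
  obtain ⟨τ, h1, h2⟩ := H.lift n σ hσ
  exact ⟨τ, h1, h2⟩

theorem CollarMap.mem_chIn_U (H : CollarMap CZ CY f) {n : ℕ} {w : Ch Z n} (hw : w ∈ chIn Sᶜ n)
    (h : cpush f n w ∈ chIn CY.U n) : w ∈ chIn CZ.U n := by
  refine supp_mono ?_ (mem_supp_preimage_of_injOn ?_ hw h)
  · rintro σ ⟨h1, h2⟩ _ ⟨t, rfl⟩
    exact H.mem_U _ (h1 ⟨t, rfl⟩) (h2 ⟨t, rfl⟩)
  · intro σ hσ τ hτ hst
    ext t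
    exact H.injOn (hσ ⟨t, rfl⟩) (hτ ⟨t, rfl⟩) (DFunLike.congr_fun hst t)

theorem CollarMap.cpush_comm (H : CollarMap CZ CY f) {n : ℕ} (w : Ch Z n) :
    cpush (slice CY.h 1) n (cpush f n w) = cpush f n (cpush (slice CZ.h 1) n w) := by
  rw [cpush_cpush, cpush_cpush]
  congr 2
  ext z
  exact (H.comm z).symm

/-- Surjectivity in relative homology: the part of a subdivided cycle that avoids `B` lifts to `Z`,
and pushing the lift along the collar makes it a cycle relative to `S`. -/
theorem CollarMap.surjective (H : CollarMap CZ CY f) {n : ℕ} {c : Ch Y n} (hc : BdryIn B n c) :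
    ∃ w, BdryIn S n w ∧ c - cpush f n w ∈ relB B n := by
  obtain ⟨k, hk⟩ := CY.exists_iterate_split H.isClosed' c
  obtain ⟨a, ha, b, hb, hab⟩ := hk k le_rfl
  obtain ⟨w, hw, rfl⟩ := H.exists_lift hb
  -- `a` lies in the collar of `B` and `w` lifts the rest; the boundary of `w` lies in the collar of
  -- `S`, because modulo `B` it is minus the boundary of `a`.
  refine ⟨cpush (slice CZ.h 1) n w, ?_, ?_⟩
  · cases n with
    | zero => trivial
    | succ n =>
      change d n _ ∈ _
      rw [d_cpush]
      refine CZ.cpush_mem (H.mem_chIn_U (d_mem_chIn hw) ?_)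
      have h1 : cpush f n (d n w) = d n ((sdOp (n + 1))^[k] c) - d n a := by
        rw [hab, map_add, add_sub_cancel_left, d_cpush]
      rw [h1]
      exact sub_mem (chIn_mono CY.subset _ (hc.sdOp_iterate k)) (d_mem_chIn ha)
  · have h1 := sub_sdOp_iterate_mem_relB hc k
    have h2 := CY.sub_mem (hc.sdOp_iterate k)
    rw [hab] at h1 h2
    rw [map_add, H.cpush_comm] at h2
    have h3 := sub_mem (add_mem (mem_relB_of_chIn (CY.cpush_mem ha)) h1) h2
    convert h3 using 1
    abel

/-- Injectivity in relative homology: the part that avoids `B` of a subdivided chain bounding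
`f_* w` lifts to `Z`; it bounds `w` up to chains in the collar, which are pushed into `S`. -/
theorem CollarMap.injective (H : CollarMap CZ CY f) {n : ℕ} {w : Ch Z n} (hw : BdryIn S n w)
    (h : cpush f n w ∈ relB B n) : w ∈ relB S n := by
  obtain ⟨y, hy⟩ := mem_relB.1 h
  obtain ⟨k₁, hk₁⟩ := CY.exists_iterate_split H.isClosed' y
  obtain ⟨k₂, hk₂⟩ := CZ.exists_iterate_split H.isClosed w
  set k := max k₁ k₂
  obtain ⟨a, ha, b, hb, hab⟩ := hk₁ k (le_max_left _ _)
  obtain ⟨a', ha', b', hb', hab'⟩ := hk₂ k (le_max_right _ _)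
  obtain ⟨y', hy', rfl⟩ := H.exists_lift hb
  -- The chain `y'` bounds `b'` up to chains in the collar, as its image does in `Y`.
  have h1 : b' - d n y' ∈ chIn CZ.U n := by
    refine H.mem_chIn_U (sub_mem hb' (d_mem_chIn hy')) ?_
    have h2 := sdOp_iterate_mem_chIn hy k
    rw [iterate_map_sub, ← cpush_sdOp_iterate, ← d_sdOp_iterate, hab, hab', map_add, map_add,
      d_cpush] at h2
    rw [map_sub]
    have h3 := sub_mem (add_mem (chIn_mono CY.subset _ h2) (d_mem_chIn ha))
      (cpush_mem_chIn f H.mapsTo_U ha')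
    convert h3 using 1
    abel
  have h4 := CZ.sub_mem (hw.sdOp_iterate k)
  have h5 := CZ.cpush_mem (add_mem h1 ha')
  have h6 := sub_sdOp_iterate_mem_relB hw k
  have h7 := d_mem_relB (S := S) (cpush (slice CZ.h 1) _ y')
  rw [hab'] at h4 h6
  rw [map_add, map_sub, ← d_cpush] at h5
  have h8 := add_mem (sub_mem h6 h4) (add_mem (mem_relB_of_chIn h5) h7)
  convert h8 using 1
  rw [map_add]
  abel

theorem CollarMap.bijective (H : CollarMap CZ CY f) (n : ℕ) :
    Function.Bijective (relHomologyMap f (mapsTo_univ (s := univ) _) H.mapsTo n) := by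
  constructor
  · rw [injective_iff_map_eq_zero]
    intro x hx
    obtain ⟨c, h1, h2, rfl⟩ := exists_cls x
    rw [relHomologyMap_cls, cls_eq_zero] at hx
    obtain ⟨y, -, hy⟩ := hx
    obtain ⟨z, hz⟩ := mem_relB.1 (H.injective h2 (mem_relB.2 ⟨y, hy⟩))
    exact cls_eq_zero.2 ⟨z, chIn_univ _ _, hz⟩
  · intro x
    obtain ⟨c, h1, h2, rfl⟩ := exists_cls x
    obtain ⟨w, hw, hcw⟩ := H.surjective h2
    obtain ⟨y, hy⟩ := mem_relB.1 hcw
    refine ⟨cls univ S n w (chIn_univ _ _) hw, ?_⟩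
    rw [relHomologyMap_cls, eq_comm, cls_eq_cls]
    exact ⟨y, chIn_univ _ _, hy⟩

end RelHomeo

end SingularChains

namespace SingularChains

open FreeChains RelSing

/-! ### Relative homeomorphisms from quotient maps -/

section Quotient

variable {Z Y : Type u} [TopologicalSpace Z] [TopologicalSpace Y]

/-- `f : (Z, S) → (Y, B)` presents `Y` as `B` with `Z` glued to it along `S`. -/
structure IsGluing (S : Set Z) (B : Set Y) (f : C(Z, Y)) : Prop where
  isClosed : IsClosed S
  isClosed' : IsClosed B
  injOn : InjOn f Sᶜ
  mapsTo : MapsTo f S B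
  mapsTo_compl : MapsTo f Sᶜ Bᶜ
  quot : IsQuotientMap (Sum.elim (Subtype.val : B → Y) f)

variable {S : Set Z} {B : Set Y} {f : C(Z, Y)}

theorem IsGluing.mem_iff (H : IsGluing S B f) {z : Z} : f z ∈ B ↔ z ∈ S :=
  ⟨fun h ↦ by_contra fun hz ↦ H.mapsTo_compl hz h, fun h ↦ H.mapsTo h⟩

theorem IsGluing.isOpenEmbedding (H : IsGluing S B f) :
    IsOpenEmbedding fun z : (Sᶜ : Set Z) ↦ f z := by
  refine .of_continuous_injective_isOpenMap (by fun_prop)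
    (fun a b hab ↦ Subtype.ext (H.injOn a.2 b.2 hab)) fun O hO ↦ ?_
  obtain ⟨O', hO', rfl⟩ := isOpen_induced_iff.1 hO
  rw [← H.quot.isOpen_preimage, isOpen_sum_iff]
  constructor
  · convert isOpen_empty
    rw [eq_empty_iff_forall_notMem]
    rintro b ⟨z, -, hz⟩
    refine H.mapsTo_compl z.2 ?_
    change f z = b at hz
    rw [hz]
    exact b.2
  · convert hO'.inter H.isClosed.isOpen_compl
    ext z
    constructor
    · rintro ⟨w, hw, hwz⟩
      have hz : z ∈ Sᶜ := fun hz ↦ H.mapsTo_compl w.2 (by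
        change f w = f z at hwz
        rw [hwz]
        exact H.mapsTo hz)
      rw [← H.injOn w.2 hz hwz]
      exact ⟨hw, w.2⟩
    · rintro ⟨h1, h2⟩
      exact ⟨⟨z, h2⟩, h1, rfl⟩

/-- Simplices that avoid `B` lift to `Z`, because `f` is an open embedding off `S`. -/
theorem IsGluing.lift (H : IsGluing S B f) (n : ℕ) (σ : C(Simplex n, Y)) (hσ : range σ ⊆ Bᶜ) :
    ∃ τ : C(Simplex n, Z), range τ ⊆ Sᶜ ∧ f.comp τ = σ := by
  have h1 : ∀ t, ∃ z : (Sᶜ : Set Z), f z = σ t := by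
    intro t
    obtain ⟨x, hx⟩ := H.quot.surjective (σ t)
    rcases x with b | z
    · exact (hσ ⟨t, rfl⟩ (hx ▸ b.2)).elim
    · exact ⟨⟨z, fun hz ↦ hσ ⟨t, rfl⟩ (hx ▸ H.mapsTo hz)⟩, hx⟩
  choose τ hτ using h1
  have hc : Continuous τ := by
    rw [H.isOpenEmbedding.isInducing.continuous_iff]
    convert σ.continuous
    exact funext hτ
  refine ⟨⟨fun t ↦ τ t, by fun_prop⟩, ?_, ContinuousMap.ext hτ⟩
  rintro _ ⟨t, rfl⟩
  exact (τ t).2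

/-- The quotient map of a gluing. -/
def IsGluing.quotMap (f : C(Z, Y)) (B : Set Y) : C(B ⊕ Z, Y) :=
  ⟨Sum.elim (Subtype.val : B → Y) f, by fun_prop⟩

/-- The paths traced by the deformation of a collar, on the pieces of a gluing. Maps into the path
space `C([0, 1], Y)` descend along the quotient map itself, which need not remain a quotient map
after taking the product with the interval. -/
def IsGluing.paths (C : Collar S) (f : C(Z, Y)) (B : Set Y) : C(B ⊕ Z, C(unitInterval, Y)) :=
  ⟨Sum.elim (fun b ↦ ContinuousMap.const _ (b : Y)) (f.comp C.h).curry,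
    continuous_sumElim.2 ⟨ContinuousMap.continuous_const'.comp continuous_subtype_val,
      (f.comp C.h).curry.continuous⟩⟩

theorem IsGluing.paths_factors (H : IsGluing S B f) (C : Collar S) :
    Function.FactorsThrough (IsGluing.paths C f B) (IsGluing.quotMap f B) := by
  have key : ∀ (b : B) (z : Z), f z = b → ∀ t, f (C.h (z, t)) = b := by
    intro b z hz t
    rw [C.h_fix z (H.mem_iff.1 (hz ▸ b.2)), hz]
  rintro (b | z) (b' | z') h <;> refine ContinuousMap.ext fun t ↦ ?_
  · exact h
  · exact (key b z' h.symm t).symm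
  · exact key b' z h t
  · change f (C.h (z, t)) = f (C.h (z', t))
    change f z = f z' at h
    by_cases hz : z ∈ S
    · have hz' : z' ∈ S := H.mem_iff.1 (h ▸ H.mapsTo hz)
      rw [C.h_fix z hz, C.h_fix z' hz', h]
    · have hz' : z' ∉ S := fun h' ↦ hz (H.mem_iff.1 (h ▸ H.mapsTo h'))
      rw [H.injOn hz hz' h]

/-- A collar of `(Z, S)` extends to the space obtained by gluing `Z` to `B` along `S`. -/
noncomputable def IsGluing.collar (H : IsGluing S B f) (C : Collar S) : Collar B where
  h := ContinuousMap.uncurry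
    (IsQuotientMap.lift (f := IsGluing.quotMap f B) H.quot (IsGluing.paths C f B)
      (H.paths_factors C))
  h_zero y := by
    obtain ⟨x, rfl⟩ := H.quot.surjective y
    have := DFunLike.congr_fun (IsQuotientMap.lift_comp (f := IsGluing.quotMap f B) H.quot
      (IsGluing.paths C f B) (H.paths_factors C)) x
    refine (DFunLike.congr_fun this 0).trans ?_
    rcases x with b | z
    · rfl
    · exact congrArg f (C.h_zero z)
  h_fix y hy t := by
    have := DFunLike.congr_fun (IsQuotientMap.lift_comp (f := IsGluing.quotMap f B) H.quot
      (IsGluing.paths C f B) (H.paths_factors C)) (.inl ⟨y, hy⟩)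
    exact (DFunLike.congr_fun this t)
  U := B ∪ f '' C.U
  isOpen := by
    rw [← H.quot.isOpen_preimage, isOpen_sum_iff]
    constructor
    · convert isOpen_univ
      exact eq_univ_of_forall fun b ↦ Or.inl b.2
    · convert C.isOpen
      ext z
      constructor
      · rintro (h | ⟨w, hw, hwz⟩)
        · exact C.subset (H.mem_iff.1 h)
        · change f w = f z at hwz
          by_cases hz : z ∈ S
          · exact C.subset hz
          · have hw' : w ∉ S := fun h' ↦ hz (H.mem_iff.1 (hwz ▸ H.mapsTo h'))
            rwa [← H.injOn hw' hz hwz]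
      · exact fun h ↦ Or.inr ⟨z, h, rfl⟩
  subset := subset_union_left
  h_one y hy := by
    have key := fun x ↦ DFunLike.congr_fun (IsQuotientMap.lift_comp (f := IsGluing.quotMap f B)
      H.quot (IsGluing.paths C f B) (H.paths_factors C)) x
    rcases hy with hy | ⟨z, hz, rfl⟩
    · have := DFunLike.congr_fun (key (.inl ⟨y, hy⟩)) 1
      exact mem_of_eq_of_mem this hy
    · have := DFunLike.congr_fun (key (.inr z)) 1
      exact mem_of_eq_of_mem this (H.mapsTo (C.h_one z hz))

theorem IsGluing.collarMap (H : IsGluing S B f) (C : Collar S) :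
    CollarMap C (H.collar C) f where
  isClosed := H.isClosed
  isClosed' := H.isClosed'
  injOn := H.injOn
  mapsTo := H.mapsTo
  lift := H.lift
  comm z := by
    have := DFunLike.congr_fun (IsQuotientMap.lift_comp (f := IsGluing.quotMap f B) H.quot
      (IsGluing.paths C f B) (H.paths_factors C)) (.inr z)
    exact (DFunLike.congr_fun this 1).symm
  mapsTo_U z hz := Or.inr ⟨z, hz, rfl⟩
  mem_U z hz h := by
    rcases h with h | ⟨w, hw, hwz⟩
    · exact (H.mapsTo_compl hz h).elim
    · have hw' : w ∉ S := fun h' ↦ hz (H.mem_iff.1 (hwz ▸ H.mapsTo h'))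
      rwa [← H.injOn hw' hz hwz]

/-- Excision: gluing a collared pair induces an isomorphism in relative homology. -/
theorem IsGluing.bijective (H : IsGluing S B f) (C : Collar S) (n : ℕ) :
    Function.Bijective (relHomologyMap f (mapsTo_univ (s := univ) _) H.mapsTo n) :=
  (H.collarMap C).bijective n

end Quotient

/-! ### Relative homology of subspaces -/

section Subspace

variable {X : Type u} [TopologicalSpace X]

/-- The relative homology of subspaces may be computed in the larger subspace. -/
theorem bijective_relHomologyMap_val (A B : Set X) (n : ℕ) :
    Function.Bijective (relHomologyMap (A := (univ : Set A)) (B := Subtype.val ⁻¹' B) (A' := A)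
      (B' := B) (incl A) (mapsTo_incl A) (mapsTo_incl_preimage A B) n) := by
  set j : C(A, X) := incl A
  have hj : Function.Injective j := Subtype.val_injective
  have key : ∀ (m : ℕ) (e : Ch A m), cpush j m e ∈ chIn B m → e ∈ chIn (Subtype.val ⁻¹' B) m := by
    intro m e he
    refine supp_mono ?_ (mem_supp_preimage_of_injOn (s := univ) ?_ (fun _ _ ↦ mem_univ _) he)
    · rintro σ ⟨-, h⟩ _ ⟨t, rfl⟩
      exact h ⟨t, rfl⟩
    · intro σ _ τ _ h
      ext t
      exact congrArg Subtype.val (hj (DFunLike.congr_fun h t))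
  constructor
  · rw [injective_iff_map_eq_zero]
    intro x hx
    obtain ⟨c, h1, h2, rfl⟩ := exists_cls x
    rw [relHomologyMap_cls, cls_eq_zero] at hx
    obtain ⟨y, hy, h⟩ := hx
    obtain ⟨y, rfl⟩ := exists_cpush_val_eq hy
    rw [d_cpush, ← map_sub] at h
    exact cls_eq_zero.2 ⟨y, chIn_univ _ _, key _ _ h⟩
  · intro x
    obtain ⟨c, h1, h2, rfl⟩ := exists_cls x
    obtain ⟨e, rfl⟩ := exists_cpush_val_eq h1
    refine ⟨cls univ _ n e (chIn_univ _ _) ?_, relHomologyMap_cls _ _ _ _ _ _ _⟩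
    cases n with
    | zero => trivial
    | succ n =>
      refine key _ _ ?_
      rw [← d_cpush]
      exact h2

end Subspace

end SingularChains

namespace SingularChains

open FreeChains RelSing TupleChains Cellular

/-! ### The homology of discs relative to their boundary -/

theorem BdryIn.zsmul {X : Type u} [TopologicalSpace X] {B : Set X} {n : ℕ} {c : Ch X n}
    (hc : BdryIn B n c) (m : ℤ) : BdryIn B n (m • c) := by
  cases n with
  | zero => trivial
  | succ n =>
    change SingularChains.d n _ ∈ _
    rw [map_zsmul]
    exact zsmul_mem hc m

theorem zsmul_cls {X : Type u} [TopologicalSpace X] {A B : Set X} {n : ℕ} (m : ℤ) (c : Ch X n)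
    (h1 h2) : m • cls A B n c h1 h2 = cls A B n (m • c) (zsmul_mem h1 m) (h2.zsmul m) := by
  refine (map_zsmul (QuotientAddGroup.mk' ((relBoundaries A B n).addSubgroupOf _)) m _).symm.trans
    ?_
  refine congrArg QuotientAddGroup.mk (Subtype.ext ?_)
  exact (map_zsmul (chEquiv X n).symm m c).symm

section Disc

theorem Disc.norm_le {n : ℕ} (z : Disc.{u} n) : ‖z.down.1‖ ≤ 1 :=
  mem_closedBall_zero_iff.1 z.down.2

theorem mem_discBoundary {n : ℕ} {z : Disc.{u} n} : z ∈ discBoundary n ↔ ‖z.down.1‖ = 1 :=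
  mem_sphere_zero_iff_norm

theorem continuous_disc_val (n : ℕ) : Continuous fun z : Disc.{u} n ↦ z.down.1 :=
  continuous_subtype_val.comp continuous_uliftDown

theorem isClosed_discBoundary (n : ℕ) : IsClosed (discBoundary.{u} n) :=
  Metric.isClosed_sphere.preimage (continuous_disc_val n)

/-- A point of the disc, from a vector of norm at most one. -/
def Disc.mk {n : ℕ} (x : Fin n → ℝ) (hx : ‖x‖ ≤ 1) : Disc.{u} n :=
  ⟨⟨x, mem_closedBall_zero_iff.2 hx⟩⟩

theorem continuous_disc_mk {T : Type*} [TopologicalSpace T] {n : ℕ} {x : T → Fin n → ℝ}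
    (hx : ∀ t, ‖x t‖ ≤ 1) (hc : Continuous x) : Continuous fun t ↦ Disc.mk.{u} (x t) (hx t) :=
  continuous_uliftUp.comp (hc.subtype_mk _)

instance (n : ℕ) : CompactSpace (Disc.{u} n) := inferInstance

theorem norm_inv_max_smul_le {n : ℕ} (x : Fin n → ℝ) {s : ℝ} (hs : 0 < s) :
    ‖(max s ‖x‖)⁻¹ • x‖ ≤ 1 := by
  have h : 0 < max s ‖x‖ := lt_max_of_lt_left hs
  rw [norm_smul, norm_inv, Real.norm_of_nonneg h.le, inv_mul_le_iff₀ h, mul_one]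
  exact le_max_right _ _

theorem half_le_one_sub_half (t : unitInterval) : (1 / 2 : ℝ) ≤ 1 - t / 2 := by
  have := t.2.2
  linarith

/-- The collar of the boundary of the disc given by radial expansion: at time `t` the vector `x` is
divided by `max (1 - t / 2) ‖x‖`, so at time `1` everything of norm above `1 / 2` has reached the
boundary. -/
noncomputable def discCollar (n : ℕ) : Collar (discBoundary.{u} n) where
  h := ⟨fun p ↦ Disc.mk ((max (1 - (p.2 : ℝ) / 2) ‖p.1.down.1‖)⁻¹ • p.1.down.1)
      (norm_inv_max_smul_le _ (by linarith [half_le_one_sub_half p.2])),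
    continuous_disc_mk _ (by
      have h1 : Continuous fun p : Disc.{u} n × unitInterval ↦ p.1.down.1 :=
        (continuous_disc_val n).comp continuous_fst
      refine Continuous.smul (Continuous.inv₀ ((continuous_const.sub
        ((continuous_subtype_val.comp continuous_snd).div_const 2)).max h1.norm) fun p ↦ ?_) h1
      have : (0 : ℝ) < max (1 - (p.2 : ℝ) / 2) ‖p.1.down.1‖ :=
        lt_max_of_lt_left (by linarith [half_le_one_sub_half p.2])
      exact this.ne')⟩
  h_zero z := by
    refine ULift.ext _ _ (Subtype.ext ?_)
    change (max (1 - ((0 : unitInterval) : ℝ) / 2) ‖z.down.1‖)⁻¹ • z.down.1 = z.down.1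
    rw [Set.Icc.coe_zero, zero_div, sub_zero, max_eq_left (Disc.norm_le z), inv_one, one_smul]
  h_fix z hz t := by
    refine ULift.ext _ _ (Subtype.ext ?_)
    change (max (1 - (t : ℝ) / 2) ‖z.down.1‖)⁻¹ • z.down.1 = z.down.1
    rw [mem_discBoundary.1 hz, max_eq_right (by linarith [t.2.1]), inv_one, one_smul]
  U := {z | 1 / 2 < ‖z.down.1‖}
  isOpen := isOpen_lt continuous_const (continuous_disc_val n).norm
  subset z hz := by
    rw [mem_discBoundary] at hz
    change 1 / 2 < ‖z.down.1‖
    rw [hz]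
    norm_num
  h_one z hz := by
    rw [mem_discBoundary]
    change ‖(max (1 - ((1 : unitInterval) : ℝ) / 2) ‖z.down.1‖)⁻¹ • z.down.1‖ = 1
    have h1 : 1 / 2 < ‖z.down.1‖ := hz
    have h2 : 0 < ‖z.down.1‖ := by linarith
    rw [Set.Icc.coe_one, max_eq_right (by linarith), norm_smul, norm_inv, norm_norm,
      inv_mul_cancel₀ h2.ne']

/-! The boundary of the cube `[-1, 1]ⁿ⁺¹` is the union of the top face and of an open box. -/

theorem norm_le_one_iff {n : ℕ} {x : Fin (n + 1) → ℝ} :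
    ‖x‖ ≤ 1 ↔ |x 0| ≤ 1 ∧ ‖Fin.tail x‖ ≤ 1 := by
  rw [pi_norm_le_iff_of_nonneg zero_le_one, pi_norm_le_iff_of_nonneg zero_le_one,
    Fin.forall_fin_succ]
  rfl

theorem norm_eq_one_iff {n : ℕ} {x : Fin (n + 1) → ℝ} (hx : ‖x‖ ≤ 1) :
    ‖x‖ = 1 ↔ |x 0| = 1 ∨ ‖Fin.tail x‖ = 1 := by
  have h1 := norm_le_one_iff.1 hx
  rw [← not_iff_not, not_or]
  change ‖x‖ ≠ 1 ↔ |x 0| ≠ 1 ∧ ‖Fin.tail x‖ ≠ 1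
  rw [← lt_iff_le_and_ne.trans (and_iff_right hx),
    ← lt_iff_le_and_ne.trans (and_iff_right h1.1), ← lt_iff_le_and_ne.trans (and_iff_right h1.2),
    pi_norm_lt_iff zero_lt_one, pi_norm_lt_iff zero_lt_one, Fin.forall_fin_succ]
  rfl

/-- The boundary of the cube without the interior of its top face. -/
def box (n : ℕ) : Set (Disc.{u} (n + 1)) := {z | z.down.1 0 = -1 ∨ ‖Fin.tail z.down.1‖ = 1}

theorem box_subset (n : ℕ) : box.{u} n ⊆ discBoundary (n + 1) := by
  intro z hz
  rw [mem_discBoundary, norm_eq_one_iff (Disc.norm_le z)]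
  refine hz.imp_left fun h ↦ ?_
  rw [h, abs_neg, abs_one]

theorem continuous_tail (n : ℕ) : Continuous fun x : Fin (n + 1) → ℝ ↦ Fin.tail x :=
  continuous_pi fun i ↦ continuous_apply i.succ

theorem isClosed_box (n : ℕ) : IsClosed (box.{u} n) :=
  (isClosed_eq ((continuous_apply 0).comp (continuous_disc_val _)) continuous_const).union
    (isClosed_eq ((continuous_tail n).norm.comp (continuous_disc_val _)) continuous_const)

/-- The gauge whose inverse is the factor of the radial projection from `(2, 0)` onto the box. The
projection stops at the sides, where the tail has norm `1`, or at the bottom face, where the first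
coordinate has distance `3` from `2`. -/
noncomputable def boxScale {n : ℕ} (x : Fin (n + 1) → ℝ) : ℝ := max ‖Fin.tail x‖ ((2 - x 0) / 3)

/-- The radial projection of the cube from the point `(2, 0)` above it onto the box. -/
noncomputable def boxProj {n : ℕ} (x : Fin (n + 1) → ℝ) : Fin (n + 1) → ℝ :=
  Pi.single 0 2 + (boxScale x)⁻¹ • (x - Pi.single 0 2)

theorem boxProj_zero {n : ℕ} (x : Fin (n + 1) → ℝ) :
    boxProj x 0 = 2 - (boxScale x)⁻¹ * (2 - x 0) := by
  simp [boxProj]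
  ring

theorem tail_boxProj {n : ℕ} (x : Fin (n + 1) → ℝ) :
    Fin.tail (boxProj x) = (boxScale x)⁻¹ • Fin.tail x := by
  ext i
  simp [boxProj, Fin.tail]

theorem boxScale_pos {n : ℕ} {x : Fin (n + 1) → ℝ} (hx : ‖x‖ ≤ 1) : 0 < boxScale x := by
  have := (abs_le.1 (norm_le_one_iff.1 hx).1).2
  exact lt_max_of_lt_right (by linarith)

theorem boxScale_le {n : ℕ} {x : Fin (n + 1) → ℝ} (hx : ‖x‖ ≤ 1) : boxScale x ≤ 1 := by
  have h := norm_le_one_iff.1 hx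
  have := (abs_le.1 h.1).1
  exact max_le h.2 (by linarith)

theorem norm_boxProj_le {n : ℕ} {x : Fin (n + 1) → ℝ} (hx : ‖x‖ ≤ 1) : ‖boxProj x‖ ≤ 1 := by
  have hpos := boxScale_pos hx
  have hle := boxScale_le hx
  have h0 := abs_le.1 (norm_le_one_iff.1 hx).1
  rw [norm_le_one_iff, boxProj_zero, tail_boxProj, norm_smul, norm_inv,
    Real.norm_of_nonneg hpos.le, inv_mul_le_iff₀ hpos, mul_one]
  refine ⟨abs_le.2 ⟨?_, ?_⟩, le_max_left _ _⟩
  · have h1 : (2 - x 0) / 3 ≤ boxScale x := le_max_right _ _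
    have : (boxScale x)⁻¹ * (2 - x 0) ≤ 3 := by
      rw [inv_mul_le_iff₀ hpos]
      linarith
    linarith
  · have : 1 ≤ (boxScale x)⁻¹ * (2 - x 0) := by
      rw [le_inv_mul_iff₀ hpos]
      linarith
    linarith

theorem boxProj_mem {n : ℕ} {x : Fin (n + 1) → ℝ} (hx : ‖x‖ ≤ 1) :
    boxProj x 0 = -1 ∨ ‖Fin.tail (boxProj x)‖ = 1 := by
  have hpos := boxScale_pos hx
  rcases max_choice ‖Fin.tail x‖ ((2 - x 0) / 3) with h | h
  · right
    have h' : boxScale x = ‖Fin.tail x‖ := h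
    rw [tail_boxProj, norm_smul, norm_inv, Real.norm_of_nonneg hpos.le, ← h',
      inv_mul_cancel₀ hpos.ne']
  · left
    have h' : 2 - x 0 = 3 * boxScale x := by
      have : boxScale x = (2 - x 0) / 3 := h
      linarith
    rw [boxProj_zero, h', mul_comm, mul_assoc, mul_inv_cancel₀ hpos.ne']
    norm_num

theorem boxProj_eq_self {n : ℕ} {x : Fin (n + 1) → ℝ} (hx : ‖x‖ ≤ 1)
    (h : x 0 = -1 ∨ ‖Fin.tail x‖ = 1) : boxProj x = x := by
  have h1 : boxScale x = 1 := by
    refine le_antisymm (boxScale_le hx) ?_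
    rcases h with h | h
    · refine le_trans ?_ (le_max_right _ _)
      rw [h]
      norm_num
    · exact h.symm.le.trans (le_max_left _ _)
  rw [boxProj, h1, inv_one, one_smul, add_sub_cancel]

theorem continuous_boxScale (n : ℕ) : Continuous fun x : Fin (n + 1) → ℝ ↦ boxScale x :=
  (continuous_tail n).norm.max ((continuous_const.sub (continuous_apply 0)).div_const _)

/-- The straight-line deformation of the cube into the box. -/
noncomputable def boxHomotopy (n : ℕ) : C(Disc.{u} (n + 1) × unitInterval, Disc.{u} (n + 1)) :=
  ⟨fun p ↦ Disc.mk ((1 - (p.2 : ℝ)) • p.1.down.1 + (p.2 : ℝ) • boxProj p.1.down.1) (by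
      have h1 := Disc.norm_le p.1
      have h2 := norm_boxProj_le h1
      have h3 := (convex_closedBall (0 : Fin (n + 1) → ℝ) 1)
        (mem_closedBall_zero_iff.2 h1) (mem_closedBall_zero_iff.2 h2)
        (sub_nonneg.2 p.2.2.2) p.2.2.1 (by ring)
      exact mem_closedBall_zero_iff.1 h3),
    continuous_disc_mk _ (by
      have h1 : Continuous fun p : Disc.{u} (n + 1) × unitInterval ↦ p.1.down.1 :=
        (continuous_disc_val _).comp continuous_fst
      have h2 : Continuous fun p : Disc.{u} (n + 1) × unitInterval ↦ (p.2 : ℝ) := by fun_prop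
      refine ((continuous_const.sub h2).smul h1).add (h2.smul ?_)
      refine continuous_const.add (Continuous.smul (Continuous.inv₀
        ((continuous_boxScale n).comp h1) fun p ↦ ?_) (h1.sub continuous_const))
      exact (boxScale_pos (Disc.norm_le p.1)).ne')⟩

/-- The cube deforms into the box, so its homology relative to the box vanishes. -/
theorem mem_relB_box {n m : ℕ} {c : Ch (Disc.{u} (n + 1)) m} (hc : BdryIn (box n) m c) :
    c ∈ relB (box n) m := by
  have hfix : ∀ z ∈ box.{u} n, ∀ t, boxHomotopy n (z, t) ∈ box n := by
    intro z hz t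
    have : boxHomotopy n (z, t) = z := by
      refine ULift.ext _ _ (Subtype.ext ?_)
      change (1 - (t : ℝ)) • z.down.1 + (t : ℝ) • boxProj z.down.1 = z.down.1
      rw [boxProj_eq_self (Disc.norm_le z) hz, ← add_smul, sub_add_cancel, one_smul]
    rwa [this]
  have h0 : ∀ z, boxHomotopy.{u} n (z, 0) = z := by
    intro z
    refine ULift.ext _ _ (Subtype.ext ?_)
    change (1 - ((0 : unitInterval) : ℝ)) • z.down.1 + ((0 : unitInterval) : ℝ) •
      boxProj z.down.1 = z.down.1
    rw [Set.Icc.coe_zero, sub_zero, one_smul, zero_smul, add_zero]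
  have h1 : MapsTo (slice (boxHomotopy.{u} n) 1) univ (box n) := by
    intro z _
    have : (slice (boxHomotopy n) 1 z).down.1 = boxProj z.down.1 := by
      change (1 - ((1 : unitInterval) : ℝ)) • z.down.1 + ((1 : unitInterval) : ℝ) •
        boxProj z.down.1 = _
      rw [Set.Icc.coe_one, sub_self, one_smul, zero_smul, zero_add]
    change (slice (boxHomotopy n) 1 z).down.1 0 = -1 ∨
      ‖Fin.tail (slice (boxHomotopy n) 1 z).down.1‖ = 1
    rw [this]
    exact boxProj_mem (Disc.norm_le z)
  have h2 := cpush_slice_sub_mem_relB h0 hfix hc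
  have h3 := mem_relB_of_chIn (cpush_mem_chIn _ h1 (chIn_univ _ c))
  simpa using sub_mem h3 h2

/-- The boundary map of the triple (cube, boundary, box), an isomorphism because the homology of the
cube relative to the box vanishes. -/
theorem bijective_connecting_box (n k : ℕ) :
    Function.Bijective (connecting (univ : Set (Disc.{u} (n + 1))) (discBoundary (n + 1))
      (box n) k) := by
  constructor
  · rw [injective_iff_map_eq_zero]
    intro x hx
    obtain ⟨c, h1, h2, rfl⟩ := exists_cls x
    obtain ⟨y, hy, h⟩ := cls_eq_zero.1 ((connecting_cls _ _ _ _ c h1 h2).symm.trans hx)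
    rw [← map_sub] at h
    obtain ⟨z, hz⟩ := mem_relB.1 (mem_relB_box (m := k + 1) h)
    refine cls_eq_zero.2 ⟨z, chIn_univ _ _, ?_⟩
    have := add_mem (chIn_mono (box_subset n) _ hz) hy
    convert this using 1
    abel
  · intro x
    obtain ⟨c, h1, h2, rfl⟩ := exists_cls x
    obtain ⟨y, hy⟩ := mem_relB.1 (mem_relB_box h2)
    have h3 : BdryIn (discBoundary (n + 1)) (k + 1) y := by
      have := sub_mem h1 (chIn_mono (box_subset n) _ hy)
      rwa [sub_sub_cancel] at this
    refine ⟨cls univ _ _ y (chIn_univ _ _) h3, ?_⟩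
    refine (connecting_cls _ _ _ _ y _ h3).trans (cls_eq_cls.2 ⟨0, zero_mem _, ?_⟩)
    rw [map_zero, sub_zero, ← neg_sub]
    exact neg_mem hy

theorem norm_cons_one_le {n : ℕ} {y : Fin n → ℝ} (hy : ‖y‖ ≤ 1) :
    ‖(Fin.cons 1 y : Fin (n + 1) → ℝ)‖ ≤ 1 := by
  rw [norm_le_one_iff]
  simpa using hy

/-- The inclusion of the top face of the cube, as a map from the disc of one dimension less. -/
noncomputable def topFace (n : ℕ) : C(Disc.{u} n, discBoundary.{u} (n + 1)) :=
  ⟨fun y ↦ ⟨Disc.mk (Fin.cons 1 y.down.1) (norm_cons_one_le (Disc.norm_le y)), by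
      rw [mem_discBoundary]
      refine (norm_eq_one_iff (norm_cons_one_le (Disc.norm_le y))).2 (Or.inl ?_)
      simp⟩,
    Continuous.subtype_mk (continuous_disc_mk _ (continuous_pi fun i ↦ by
      refine Fin.cases ?_ (fun i ↦ ?_) i
      · exact continuous_const
      · exact (continuous_apply i).comp (continuous_disc_val n))) _⟩

theorem topFace_mem_box {n : ℕ} (y : Disc.{u} n) :
    (topFace n y).1 ∈ box n ↔ y ∈ discBoundary n := by
  rw [mem_discBoundary]
  change (1 : ℝ) = -1 ∨ ‖Fin.tail (Fin.cons 1 y.down.1 : Fin (n + 1) → ℝ)‖ = 1 ↔ _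
  rw [Fin.tail_cons]
  norm_num

/-- The boundary of the cube is the box with the top face glued on along its boundary. -/
theorem isGluing_topFace (n : ℕ) :
    IsGluing (discBoundary.{u} n) (Subtype.val ⁻¹' box.{u} n) (topFace.{u} n) where
  isClosed := isClosed_discBoundary n
  isClosed' := (isClosed_box n).preimage continuous_subtype_val
  injOn y _ y' _ h := by
    have h1 : (Fin.cons 1 y.down.1 : Fin (n + 1) → ℝ) = Fin.cons 1 y'.down.1 :=
      congrArg (fun z : discBoundary.{u} (n + 1) ↦ z.1.down.1) h
    exact ULift.ext _ _ (Subtype.ext (Fin.cons_right_injective _ h1))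
  mapsTo y hy := (topFace_mem_box y).2 hy
  mapsTo_compl y hy h := hy ((topFace_mem_box y).1 h)
  quot := by
    have hcl : CompactSpace (Subtype.val ⁻¹' box.{u} n : Set (discBoundary.{u} (n + 1))) := by
      have := isCompact_iff_compactSpace.1 (isClosed_discBoundary.{u} (n + 1)).isCompact
      exact isCompact_iff_compactSpace.1
        ((isClosed_box n).preimage continuous_subtype_val).isCompact
    have hcont : Continuous (Sum.elim (Subtype.val : (Subtype.val ⁻¹' box.{u} n :
        Set (discBoundary.{u} (n + 1))) → discBoundary.{u} (n + 1)) (topFace.{u} n)) := by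
      fun_prop
    refine hcont.isClosedMap.isQuotientMap hcont ?_
    intro x
    by_cases hx : x.1 ∈ box n
    · exact ⟨.inl ⟨x, hx⟩, rfl⟩
    · have h1 := (norm_eq_one_iff (Disc.norm_le x.1)).1 (mem_discBoundary.1 x.2)
      simp only [box, mem_ofPred_eq, not_or] at hx
      have h2 : x.1.down.1 0 = 1 := by
        rcases (abs_eq zero_le_one).1 (h1.resolve_right hx.2) with h | h
        · exact h
        · exact (hx.1 h).elim
      refine ⟨.inr (Disc.mk (Fin.tail x.1.down.1) (norm_le_one_iff.1 (Disc.norm_le x.1)).2),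
        Subtype.ext (ULift.ext _ _ (Subtype.ext ?_))⟩
      change Fin.cons 1 (Fin.tail x.1.down.1) = x.1.down.1
      exact (congrArg (fun a : ℝ ↦ (Fin.cons a (Fin.tail x.1.down.1) : Fin (n + 1) → ℝ))
        h2.symm).trans (Fin.cons_self_tail _)

/-- `H_{k+1}(Dⁿ⁺¹, Sⁿ) ≅ H_k(Dⁿ, Sⁿ⁻¹)`. -/
noncomputable def discSucc (n k : ℕ) :
    relHomology (univ : Set (Disc.{u} (n + 1))) (discBoundary (n + 1)) (k + 1) ≃+
      relHomology (univ : Set (Disc.{u} n)) (discBoundary n) k :=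
  (AddEquiv.ofBijective _ (bijective_connecting_box n k)).trans
    ((AddEquiv.ofBijective _ (bijective_relHomologyMap_val (discBoundary.{u} (n + 1))
      (box n) k)).symm.trans
      (AddEquiv.ofBijective _ ((isGluing_topFace n).bijective (discCollar n) k)).symm)

theorem subsingleton_disc_succ_zero (n : ℕ) :
    Subsingleton (relHomology (univ : Set (Disc.{u} (n + 1))) (discBoundary (n + 1)) 0) := by
  refine subsingleton_of_forall_eq 0 fun x ↦ ?_
  obtain ⟨c, h1, h2, rfl⟩ := exists_cls x
  obtain ⟨y, hy⟩ := mem_relB.1 (mem_relB_box (n := n) (m := 0) (c := c) trivial)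
  exact cls_eq_zero.2 ⟨y, chIn_univ _ _, chIn_mono (box_subset n) _ hy⟩

instance : Unique (Disc.{u} 0) where
  default := Disc.mk 0 (norm_zero.trans_le zero_le_one)
  uniq _ := ULift.ext _ _ (Subtype.ext (Subsingleton.elim _ _))

theorem discBoundary_zero : discBoundary.{u} 0 = ∅ := by
  rw [eq_empty_iff_forall_notMem]
  intro z hz
  rw [mem_discBoundary, Subsingleton.elim z.down.1 0, norm_zero] at hz
  exact zero_ne_one hz

theorem mem_chIn_empty {X : Type*} [TopologicalSpace X] {n : ℕ} {c : Ch X n} :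
    c ∈ chIn ∅ n ↔ c = 0 := by
  refine ⟨fun h ↦ ?_, fun h ↦ h ▸ zero_mem _⟩
  ext σ
  by_contra hσ
  exact h (Finsupp.mem_support_iff.2 hσ) ⟨stdSimplex.barycenter, rfl⟩

instance : ContractibleSpace (Disc.{u} 0) :=
  (Homeomorph.homeomorphOfUnique (Disc.{u} 0) Unit).contractibleSpace

theorem subsingleton_disc_zero_succ (k : ℕ) :
    Subsingleton (relHomology (univ : Set (Disc.{u} 0)) (discBoundary 0) (k + 1)) := by
  refine subsingleton_of_forall_eq 0 fun x ↦ ?_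
  obtain ⟨c, h1, h2, rfl⟩ := exists_cls x
  have h3 : d k c ∈ chIn (discBoundary 0) k := h2
  rw [discBoundary_zero, mem_chIn_empty] at h3
  obtain ⟨y, hy⟩ := exists_d_eq_of_contractible h3
  refine cls_eq_zero.2 ⟨y, chIn_univ _ _, ?_⟩
  rw [hy, sub_self]
  exact zero_mem _

/-- `H_k(Dⁿ, Sⁿ⁻¹) = 0` for `k ≠ n`. -/
theorem subsingleton_disc {n k : ℕ} (h : k ≠ n) :
    Subsingleton (relHomology (univ : Set (Disc.{u} n)) (discBoundary n) k) := by
  induction n generalizing k with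
  | zero =>
    obtain ⟨k, rfl⟩ := Nat.exists_eq_succ_of_ne_zero h
    exact subsingleton_disc_zero_succ k
  | succ n ih =>
    cases k with
    | zero => exact subsingleton_disc_succ_zero n
    | succ k =>
      have := ih (k := k) (by omega)
      exact (discSucc n k).toEquiv.subsingleton

/-- `H_0` of a point. -/
noncomputable def discZero :
    relHomology (univ : Set (Disc.{u} 0)) (discBoundary 0) 0 ≃+ ℤ := by
  let p : C(Simplex 0, Disc.{u} 0) := ContinuousMap.const _ default
  let φ : ℤ →+ relHomology (univ : Set (Disc.{u} 0)) (discBoundary 0) 0 :=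
    zmultiplesHom _ (cls univ _ 0 (Finsupp.single p 1) (chIn_univ _ _) trivial)
  have hφ : ∀ m : ℤ, φ m = cls univ _ 0 (m • Finsupp.single p 1) (chIn_univ _ _) trivial :=
    fun m ↦ zsmul_cls m _ _ _
  refine (AddEquiv.ofBijective φ ⟨?_, ?_⟩).symm
  · rw [injective_iff_map_eq_zero]
    intro m hm
    rw [hφ] at hm
    obtain ⟨y, -, hy⟩ := cls_eq_zero.1 hm
    rw [discBoundary_zero, mem_chIn_empty, sub_eq_zero] at hy
    have := congrArg aug hy
    rw [aug_d, map_zsmul, aug_single] at this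
    simpa using this
  · intro x
    obtain ⟨c, h1, h2, rfl⟩ := exists_cls x
    refine ⟨aug c, ?_⟩
    rw [hφ]
    obtain ⟨y, hy⟩ := exists_d_eq_of_contractible_zero
      (c := aug c • Finsupp.single p 1 - c) (by rw [map_sub, map_zsmul, aug_single]; simp)
    refine cls_eq_cls.2 ⟨y, chIn_univ _ _, ?_⟩
    rw [hy, sub_self]
    exact zero_mem _

/-- `H_n(Dⁿ, Sⁿ⁻¹)` is infinite cyclic. -/
noncomputable def discEquiv : (n : ℕ) →
    relHomology (univ : Set (Disc.{u} n)) (discBoundary n) n ≃+ ℤ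
  | 0 => discZero
  | n + 1 => (discSucc n n).trans (discEquiv n)

end Disc

end SingularChains

namespace SingularChains

open FreeChains RelSing

/-! ### The relative homology of a disjoint union of copies of a pair -/

section Operators

variable {X Y : Type u} [TopologicalSpace X] [TopologicalSpace Y] {A B : Set X} {A' B' : Set Y}

theorem cls_add {n : ℕ} {c c' : Ch X n} (h1 : c ∈ chIn A n) (h2 : BdryIn B n c)
    (h1' : c' ∈ chIn A n) (h2' : BdryIn B n c') (h2'' : BdryIn B n (c + c')) :
    cls A B n (c + c') (add_mem h1 h1') h2'' = cls A B n c h1 h2 + cls A B n c' h1' h2' := by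
  refine congrArg QuotientAddGroup.mk (Subtype.ext ?_)
  exact map_add (chEquiv X n).symm c c'

/-- The relative cycles of `(A, B)` among the combinations of continuous maps. -/
def relCyc (A B : Set X) (n : ℕ) : AddSubgroup (Ch X n) where
  carrier := {c | c ∈ chIn A n ∧ BdryIn B n c}
  zero_mem' := by
    refine ⟨zero_mem _, ?_⟩
    cases n with
    | zero => trivial
    | succ n =>
      change SingularChains.d n 0 ∈ _
      rw [map_zero]
      exact zero_mem _
  add_mem' := by
    rintro a b ⟨ha, ha'⟩ ⟨hb, hb'⟩
    refine ⟨add_mem ha hb, ?_⟩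
    cases n with
    | zero => trivial
    | succ n =>
      change SingularChains.d n _ ∈ _
      rw [map_add]
      exact add_mem ha' hb'
  neg_mem' := by
    rintro a ⟨ha, ha'⟩
    refine ⟨neg_mem ha, ?_⟩
    simpa using ha'.zsmul (-1)

/-- The homomorphism sending a relative cycle to its class. -/
noncomputable def clsHom (A B : Set X) (n : ℕ) : relCyc A B n →+ relHomology A B n :=
  AddMonoidHom.mk' (fun c ↦ cls A B n c.1 c.2.1 c.2.2) fun a b ↦
    cls_add a.2.1 a.2.2 b.2.1 b.2.2 _

theorem clsHom_apply {n : ℕ} (c : relCyc A B n) :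
    clsHom A B n c = cls A B n c.1 c.2.1 c.2.2 := rfl

theorem clsHom_eq_zero {n : ℕ} {c : relCyc A B n} :
    clsHom A B n c = 0 ↔ ∃ y ∈ chIn A (n + 1), c.1 - d n y ∈ chIn B n :=
  cls_eq_zero (h1 := c.2.1) (h2 := c.2.2)

theorem clsHom_surjective (n : ℕ) : Function.Surjective (clsHom A B n) := by
  intro x
  obtain ⟨c, h1, h2, rfl⟩ := exists_cls x
  exact ⟨⟨c, h1, h2⟩, rfl⟩

/-- A homomorphism out of relative homology, from a homomorphism on relative cycles that kills
the boundaries and the cycles in `B`. -/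
noncomputable def clsLift {M : Type*} [AddCommGroup M] {n : ℕ} (φ : relCyc A B n →+ M)
    (hφ : ∀ c : relCyc A B n, (∃ y ∈ chIn A (n + 1), c.1 - d n y ∈ chIn B n) → φ c = 0) :
    relHomology A B n →+ M :=
  (QuotientAddGroup.lift (clsHom A B n).ker φ fun c hc ↦ hφ c (clsHom_eq_zero.1 hc)).comp
    (QuotientAddGroup.quotientKerEquivOfSurjective _ (clsHom_surjective n)).symm.toAddMonoidHom

theorem clsLift_cls {M : Type*} [AddCommGroup M] {n : ℕ} (φ : relCyc A B n →+ M) (hφ)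
    (c : Ch X n) (h1 : c ∈ chIn A n) (h2 : BdryIn B n c) :
    clsLift φ hφ (cls A B n c h1 h2) = φ ⟨c, h1, h2⟩ := by
  have h : QuotientAddGroup.quotientKerEquivOfSurjective _ (clsHom_surjective n)
      (QuotientAddGroup.mk ⟨c, h1, h2⟩) = cls A B n c h1 h2 := rfl
  rw [← h, clsLift, AddMonoidHom.comp_apply]
  refine (congrArg _ (AddEquiv.symm_apply_apply _ _)).trans ?_
  rfl

end Operators

section Copies

variable {ι T : Type u} [TopologicalSpace ι] [TopologicalSpace T]

instance (n : ℕ) : PreconnectedSpace (Simplex n) :=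
  isPreconnected_iff_preconnectedSpace.1 (convex_stdSimplex ℝ (Fin (n + 1))).isPreconnected

/-- The inclusion of the copy of `T` with index `i`. -/
def copyIncl (i : ι) : C(T, ι × T) := ⟨fun z ↦ (i, z), by fun_prop⟩

/-- The index of the copy of `T` in which a simplex lies. -/
noncomputable def copyIndex {n : ℕ} (σ : C(Simplex n, ι × T)) : ι := (σ (verts n 0)).1

open Classical in
/-- The restriction of chains to the copy of `T` with index `i`. -/
noncomputable def copyRestrict (i : ι) (n : ℕ) : Ch (ι × T) n →+ Ch T n :=
  liftFree fun σ ↦ if copyIndex σ = i then Finsupp.single (ContinuousMap.snd.comp σ) 1 else 0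

open Classical in
theorem copyRestrict_single (i : ι) (n : ℕ) (σ : C(Simplex n, ι × T)) :
    copyRestrict i n (Finsupp.single σ 1) =
      if copyIndex σ = i then Finsupp.single (ContinuousMap.snd.comp σ) 1 else 0 :=
  liftFree_single _ _

theorem copyIndex_eq [DiscreteTopology ι] {n : ℕ} (σ : C(Simplex n, ι × T)) (t : Simplex n) :
    (σ t).1 = copyIndex σ :=
  PreconnectedSpace.constant inferInstance (f := fun t ↦ (σ t).1) (by fun_prop)

theorem copyIndex_face [DiscreteTopology ι] {n : ℕ} (σ : C(Simplex (n + 1), ι × T))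
    (i : Fin (n + 2)) :
    copyIndex (σ.comp (face i)) = copyIndex σ :=
  copyIndex_eq σ _

theorem copyIncl_comp_snd [DiscreteTopology ι] {n : ℕ} (σ : C(Simplex n, ι × T)) :
    (copyIncl (copyIndex σ)).comp (ContinuousMap.snd.comp σ) = σ :=
  ContinuousMap.ext fun t ↦ Prod.ext (copyIndex_eq σ t).symm rfl

theorem copyRestrict_mem {S : Set T} (i : ι) {n : ℕ} {c : Ch (ι × T) n}
    (hc : c ∈ chIn (Prod.snd ⁻¹' S) n) : copyRestrict i n c ∈ chIn S n := by
  refine apply_mem_of_mem_supp _ (fun σ hσ ↦ ?_) hc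
  rw [copyRestrict_single]
  split_ifs
  · refine single_mem_supp ?_ 1
    rintro _ ⟨t, rfl⟩
    exact hσ ⟨t, rfl⟩
  · exact zero_mem _

theorem copyRestrict_cpush_self (i : ι) (n : ℕ) (c : Ch T n) :
    copyRestrict i n (cpush (copyIncl i) n c) = c := by
  refine hom_congr (f := (copyRestrict i n).comp (cpush (copyIncl i) n)) (g := .id _)
    (fun σ ↦ ?_) c
  change copyRestrict i n (cpush _ n _) = _
  rw [cpush_single, copyRestrict_single, if_pos (by rfl)]
  rfl

theorem copyRestrict_cpush_of_ne {i j : ι} (h : j ≠ i) (n : ℕ) (c : Ch T n) :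
    copyRestrict i n (cpush (copyIncl j) n c) = 0 := by
  refine hom_congr (f := (copyRestrict i n).comp (cpush (copyIncl j) n)) (g := 0)
    (fun σ ↦ ?_) c
  change copyRestrict i n (cpush _ n _) = _
  rw [cpush_single, copyRestrict_single, if_neg (by exact h)]
  rfl

theorem mapsTo_copyIncl (S : Set T) (i : ι) :
    MapsTo (copyIncl i) S (Prod.snd ⁻¹' S : Set (ι × T)) :=
  fun _ h ↦ h

/-- The map `H_n(T, S) → H_n(ι × T, ι × S)` induced by the inclusion of one copy. -/
noncomputable def copyMap (S : Set T) (i : ι) (n : ℕ) :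
    relHomology (univ : Set T) S n →+ relHomology (univ : Set (ι × T)) (Prod.snd ⁻¹' S) n :=
  relHomologyMap (copyIncl i) (mapsTo_univ _ _) (mapsTo_copyIncl S i) n

/-- A collar of `S` gives a collar of `ι × S`. -/
noncomputable def Collar.copies {S : Set T} (C : Collar S) :
    Collar (Prod.snd ⁻¹' S : Set (ι × T)) where
  h := ⟨fun p ↦ (p.1.1, C.h (p.1.2, p.2)), by fun_prop⟩
  h_zero z := Prod.ext rfl (C.h_zero _)
  h_fix z hz t := Prod.ext rfl (C.h_fix _ hz t)
  U := Prod.snd ⁻¹' C.U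
  isOpen := C.isOpen.preimage continuous_snd
  subset _ hz := C.subset hz
  h_one z hz := C.h_one _ hz

variable [DiscreteTopology ι]

open Classical in
theorem d_copyRestrict (i : ι) (n : ℕ) (c : Ch (ι × T) (n + 1)) :
    copyRestrict i n (d n c) = d n (copyRestrict i (n + 1) c) := by
  refine hom_congr (f := (copyRestrict i n).comp (d n))
    (g := (d n).comp (copyRestrict i (n + 1))) (fun σ ↦ ?_) c
  change copyRestrict i n (d n _) = d n (copyRestrict i (n + 1) _)
  have h : ∀ x, copyRestrict i n (Finsupp.single (σ.comp (face x)) 1) =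
      if copyIndex σ = i then Finsupp.single (ContinuousMap.snd.comp (σ.comp (face x))) 1
      else 0 := by
    intro x
    rw [copyRestrict_single, copyIndex_face]
  simp only [d_single, map_sum, map_zsmul, copyRestrict_single, h]
  split_ifs
  · rw [d_single]
    rfl
  · simp

open Classical in
theorem sum_cpush_copyRestrict {n : ℕ} (c : Ch (ι × T) n) {J : Finset ι}
    (hJ : ∀ σ ∈ c.support, copyIndex σ ∈ J) :
    ∑ i ∈ J, cpush (copyIncl i) n (copyRestrict i n c) = c := by
  have : ∀ σ : C(Simplex n, ι × T), copyIndex σ ∈ J →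
      ∑ i ∈ J, cpush (copyIncl i) n (copyRestrict i n (Finsupp.single σ 1)) =
        Finsupp.single σ 1 := by
    intro σ hσ
    rw [Finset.sum_eq_single (copyIndex σ)]
    · rw [copyRestrict_single, if_pos rfl, cpush_single, copyIncl_comp_snd]
    · intro i _ hi
      rw [copyRestrict_single, if_neg hi.symm, map_zero]
    · exact fun h ↦ (h hσ).elim
  let φ : Ch (ι × T) n →+ Ch (ι × T) n :=
    ∑ i ∈ J, (cpush (copyIncl i) n).comp (copyRestrict i n) - .id _
  have hφ : φ c ∈ (⊥ : AddSubgroup (Ch (ι × T) n)) := by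
    refine apply_mem_of_mem_supp (s := {σ | copyIndex σ ∈ J}) φ (fun σ hσ ↦ ?_) hJ
    rw [AddSubgroup.mem_bot]
    simp only [φ, AddMonoidHom.sub_apply, AddMonoidHom.finsetSum_apply, AddMonoidHom.comp_apply,
      AddMonoidHom.id_apply, this σ hσ, sub_self]
  simpa only [φ, AddSubgroup.mem_bot, AddMonoidHom.sub_apply, AddMonoidHom.finsetSum_apply,
    AddMonoidHom.comp_apply, AddMonoidHom.id_apply, sub_eq_zero] using hφ

variable {S : Set T}

theorem BdryIn.copyRestrict (i : ι) {n : ℕ} {c : Ch (ι × T) n}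
    (hc : BdryIn (Prod.snd ⁻¹' S) n c) : BdryIn S n (copyRestrict i n c) := by
  cases n with
  | zero => trivial
  | succ n =>
    change SingularChains.d n (SingularChains.copyRestrict i (n + 1) c) ∈ _
    rw [← d_copyRestrict]
    exact copyRestrict_mem i hc

/-- The map `H_n(ι × T, ι × S) → H_n(T, S)` that restricts chains to one copy. -/
noncomputable def copyProj (S : Set T) (i : ι) (n : ℕ) :
    relHomology (univ : Set (ι × T)) (Prod.snd ⁻¹' S) n →+ relHomology (univ : Set T) S n :=
  clsLift ((clsHom univ S n).comp (((copyRestrict i n).comp (relCyc _ _ n).subtype).codRestrict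
    (relCyc univ S n) fun c ↦ ⟨chIn_univ _ _, c.2.2.copyRestrict i⟩)) (by
    rintro c ⟨y, -, hy⟩
    refine clsHom_eq_zero.2 ⟨copyRestrict i (n + 1) y, chIn_univ _ _, ?_⟩
    rw [← d_copyRestrict]
    have := copyRestrict_mem i hy
    rwa [map_sub] at this)

theorem copyProj_cls (i : ι) (n : ℕ) (c : Ch (ι × T) n) (h1 h2) :
    copyProj S i n (cls univ _ n c h1 h2) =
      cls univ S n (copyRestrict i n c) (chIn_univ _ _) (h2.copyRestrict i) := by
  rw [copyProj, clsLift_cls]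
  rfl

theorem copyProj_copyMap_self (i : ι) (n : ℕ) (x : relHomology (univ : Set T) S n) :
    copyProj S i n (copyMap S i n x) = x := by
  obtain ⟨c, h1, h2, rfl⟩ := exists_cls x
  rw [copyMap, relHomologyMap_cls, copyProj_cls]
  simp only [copyRestrict_cpush_self]

theorem copyProj_copyMap_of_ne {i j : ι} (h : j ≠ i) (n : ℕ)
    (x : relHomology (univ : Set T) S n) : copyProj S i n (copyMap S j n x) = 0 := by
  obtain ⟨c, h1, h2, rfl⟩ := exists_cls x
  rw [copyMap, relHomologyMap_cls, copyProj_cls]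
  refine cls_eq_zero.2 ⟨0, zero_mem _, ?_⟩
  rw [copyRestrict_cpush_of_ne h, map_zero, sub_zero]
  exact zero_mem _

open Classical in
theorem exists_sum_copyMap (n : ℕ)
    (x : relHomology (univ : Set (ι × T)) (Prod.snd ⁻¹' S) n) :
    ∃ J : Finset ι, ∑ i ∈ J, copyMap S i n (copyProj S i n x) = x := by
  obtain ⟨⟨c, h1, h2⟩, rfl⟩ := clsHom_surjective n x
  refine ⟨c.support.image copyIndex, ?_⟩
  let e : ι → relCyc (univ : Set (ι × T)) (Prod.snd ⁻¹' S) n := fun i ↦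
    ⟨cpush (copyIncl i) n (copyRestrict i n c), chIn_univ _ _, by
      cases n with
      | zero => trivial
      | succ n =>
        change d n _ ∈ _
        rw [d_cpush, ← d_copyRestrict]
        exact cpush_mem_chIn _ (fun _ h ↦ h) (copyRestrict_mem i h2)⟩
  have h : ∀ i, copyMap S i n (copyProj S i n (clsHom _ _ n ⟨c, h1, h2⟩)) =
      clsHom _ _ n (e i) := by
    intro i
    rw [clsHom_apply, copyProj_cls]
    exact relHomologyMap_cls _ _ _ _ _ _ _
  simp only [h]
  rw [← map_sum]
  refine congrArg _ (Subtype.ext ?_)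
  rw [AddSubgroup.val_finsetSum]
  exact sum_cpush_copyRestrict c fun σ hσ ↦ Finset.mem_image_of_mem _ hσ

/-- `H_n(ι × T, ι × S)` is the direct sum of copies of `H_n(T, S)`. -/
theorem bijective_copyMap (S : Set T) (n : ℕ) : Function.Bijective
    (Finsupp.liftAddHom fun i : ι ↦ copyMap S i n) := by
  classical
  constructor
  · rw [injective_iff_map_eq_zero]
    intro a ha
    ext j
    have key : (copyProj S j n).comp (Finsupp.liftAddHom fun i : ι ↦ copyMap S i n) =
        Finsupp.applyAddHom j := by
      refine Finsupp.addHom_ext fun i x ↦ ?_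
      rw [AddMonoidHom.comp_apply, Finsupp.liftAddHom_apply_single, Finsupp.applyAddHom_apply]
      by_cases h : i = j
      · rw [h, copyProj_copyMap_self, Finsupp.single_eq_same]
      · rw [copyProj_copyMap_of_ne h, Finsupp.single_eq_of_ne' h]
    have := DFunLike.congr_fun key a
    rw [AddMonoidHom.comp_apply, ha, map_zero] at this
    exact this.symm
  · intro x
    obtain ⟨J, hJ⟩ := exists_sum_copyMap n x
    refine ⟨∑ i ∈ J, Finsupp.single i (copyProj S i n x), ?_⟩
    rw [map_sum]
    simp only [Finsupp.liftAddHom_apply_single]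
    exact hJ

end Copies

end SingularChains

namespace Cellular

open RelSing SingularChains FreeChains Topology.CWComplex

/-! ### Skeleta of subcomplexes and characteristic maps -/

section Skeleta

variable {X : Type u} [TopologicalSpace X] [T2Space X] [CWComplex (univ : Set X)]
  (E : Subcomplex (univ : Set X))

omit [T2Space X] in
theorem cell_eq_of_mem {n m : ℕ} {e : cell (univ : Set X) n} {e' : cell (univ : Set X) m} {x : X}
    (h : x ∈ openCell n e) (h' : x ∈ openCell m e') :
    (⟨n, e⟩ : Σ n, cell (univ : Set X) n) = ⟨m, e'⟩ :=
  CWComplex.eq_of_not_disjoint_openCell (Set.not_disjoint_iff.2 ⟨x, h, h'⟩)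

omit [T2Space X] in
theorem cell_eq_of_mem' {n : ℕ} {e e' : cell (univ : Set X) n} {x : X}
    (h : x ∈ openCell n e) (h' : x ∈ openCell n e') : e = e' := by
  simpa using cell_eq_of_mem h h'

omit [T2Space X] in
theorem exists_mem_openCell (x : X) : ∃ n, ∃ e : cell (univ : Set X) n, x ∈ openCell n e := by
  have hx : x ∈ ⋃ (n : ℕ) (j : cell (univ : Set X) n), openCell n j := by
    rw [CWComplex.iUnion_openCell_eq_complex]
    exact mem_univ x
  simpa using hx

variable {E}

omit [T2Space X] in
theorem mem_I_of_mem {n : ℕ} {e : cell (univ : Set X) n} {x : X} (h : x ∈ openCell n e)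
    (hx : x ∈ (E : Set X)) : e ∈ E.I n :=
  by_contra fun he ↦
    (CWComplex.Subcomplex.disjoint_openCell_subcomplex_of_not_mem E he).notMem_of_mem_left h hx

theorem mem_skel_iff {k : ℕ} {x : X} :
    x ∈ skel E k ↔ ∃ m < k, ∃ e ∈ E.I m, x ∈ openCell m e := by
  have h : x ∈ skel E k ↔ x ∈ (E : Set X) ∧ x ∈ skeletonLT (univ : Set X) (k : ℕ∞) := Iff.rfl
  rw [h, CWComplex.mem_skeletonLT_iff]
  constructor
  · rintro ⟨hx, m, hm, e, he⟩
    exact ⟨m, by exact_mod_cast hm, e, mem_I_of_mem he hx, he⟩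
  · rintro ⟨m, hm, e, he, hx⟩
    exact ⟨CWComplex.Subcomplex.openCell_subset_of_mem E he hx, m, by exact_mod_cast hm, e, hx⟩

variable (E) in
theorem isClosed_skel (k : ℕ) : IsClosed (skel E k) :=
  (RelCWComplex.Subcomplex.closed E).inter (RelCWComplex.Subcomplex.closed _)

variable (E) in
theorem skel_zero : skel E 0 = ∅ := by
  rw [eq_empty_iff_forall_notMem]
  intro x hx
  obtain ⟨m, hm, -⟩ := mem_skel_iff.1 hx
  omega

variable (E) in
theorem skel_mono {k l : ℕ} (h : k ≤ l) : skel E k ⊆ skel E l := by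
  intro x hx
  obtain ⟨m, hm, e⟩ := mem_skel_iff.1 hx
  exact mem_skel_iff.2 ⟨m, by omega, e⟩

theorem cellFrontier_subset_skel {n : ℕ} {e : cell (univ : Set X) n} (he : e ∈ E.I n) :
    cellFrontier n e ⊆ skel E n := fun _ hx ↦
  ⟨CWComplex.Subcomplex.cellFrontier_subset_of_mem E he hx,
    CWComplex.cellFrontier_subset_skeletonLT n e hx⟩

theorem closedCell_subset_skel {n : ℕ} {e : cell (univ : Set X) n} (he : e ∈ E.I n) :
    closedCell n e ⊆ skel E (n + 1) := fun x hx ↦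
  ⟨CWComplex.Subcomplex.closedCell_subset_of_mem E he hx, by
    simpa using CWComplex.closedCell_subset_skeletonLT n e hx⟩

theorem skel_succ (n : ℕ) : skel E (n + 1) = skel E n ∪ ⋃ e : E.I n, closedCell n e.1 := by
  apply subset_antisymm
  · intro x hx
    obtain ⟨m, hm, e, he, hxe⟩ := mem_skel_iff.1 hx
    rcases (Nat.lt_succ_iff_lt_or_eq.1 hm) with h | rfl
    · exact .inl (mem_skel_iff.2 ⟨m, h, e, he, hxe⟩)
    · exact .inr (mem_iUnion.2 ⟨⟨e, he⟩, openCell_subset_closedCell _ _ hxe⟩)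
  · exact union_subset (skel_mono E (Nat.le_succ n))
      (iUnion_subset fun e ↦ closedCell_subset_skel e.2)

theorem notMem_skel {n : ℕ} {e : cell (univ : Set X) n} {x : X} (hx : x ∈ openCell n e) :
    x ∉ skel E n := by
  intro h
  obtain ⟨m, hm, e', -, he'⟩ := mem_skel_iff.1 h
  have := congrArg Sigma.fst (cell_eq_of_mem hx he')
  change n = m at this
  omega

/-- A map from the closed disc that presents the closure of an open cell as the image of the disc,
injective on the interior; it need not be the chosen characteristic map. -/
structure IsCharMap {n : ℕ} (e : cell (univ : Set X) n) (ψ : C(Disc.{u} n, X)) : Prop where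
  injOn : InjOn ψ (discBoundary n)ᶜ
  image_compl : ψ '' (discBoundary n)ᶜ = openCell n e
  mapsTo : MapsTo ψ (discBoundary n) (cellFrontier n e)

theorem compl_discBoundary (n : ℕ) :
    (discBoundary.{u} n)ᶜ = {z | z.down.1 ∈ Metric.ball (0 : Fin n → ℝ) 1} := by
  ext z
  rw [mem_compl_iff, mem_discBoundary, mem_ofPred_eq, mem_ball_zero_iff]
  exact ⟨fun h ↦ lt_of_le_of_ne (Disc.norm_le z) h, fun h ↦ h.ne⟩

omit [T2Space X] in
theorem isCharMap_charMap {n : ℕ} (e : cell (univ : Set X) n) : IsCharMap e (charMap e) where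
  injOn := by
    rw [compl_discBoundary]
    intro z hz w hw h
    refine ULift.ext _ _ (Subtype.ext ((map n e).injOn ?_ ?_ h))
    · rw [RelCWComplex.source_eq]
      exact hz
    · rw [RelCWComplex.source_eq]
      exact hw
  image_compl := by
    rw [compl_discBoundary]
    apply subset_antisymm
    · rintro _ ⟨z, hz, rfl⟩
      exact ⟨_, hz, rfl⟩
    · rintro _ ⟨x, hx, rfl⟩
      exact ⟨Disc.mk x (mem_ball_zero_iff.1 hx).le, hx, rfl⟩
  mapsTo z hz := ⟨_, hz, rfl⟩

theorem IsCharMap.range_eq {n : ℕ} {e : cell (univ : Set X) n} {ψ : C(Disc.{u} n, X)}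
    (h : IsCharMap e ψ) : range ψ = closedCell n e := by
  apply subset_antisymm
  · rintro _ ⟨z, rfl⟩
    by_cases hz : z ∈ discBoundary n
    · exact cellFrontier_subset_closedCell _ _ (h.mapsTo hz)
    · refine openCell_subset_closedCell _ _ ?_
      rw [← h.image_compl]
      exact ⟨z, hz, rfl⟩
  · rw [← CWComplex.closure_openCell_eq_closedCell, ← h.image_compl]
    exact (isCompact_range ψ.continuous).isClosed.closure_subset_iff.2 (image_subset_range _ _)

end Skeleta

/-! ### The homology of a complex relative to its skeleta -/

section CellHomology

variable {X : Type u} [TopologicalSpace X] [T2Space X] [CWComplex (univ : Set X)]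
  (E : Subcomplex (univ : Set X)) {n : ℕ} {ι : Type u} (c : ι → cell (univ : Set X) n)

/-- The union of the skeleton below dimension `n` with some closed `n`-cells. -/
def skelWith : Set X := skel E n ∪ ⋃ i, closedCell n (c i)

variable {E c} {ψ : ι → C(Disc.{u} n, X)}

theorem charMap_mem_skelWith (hψ : ∀ i, IsCharMap (c i) (ψ i)) (i : ι) (z : Disc.{u} n) :
    ψ i z ∈ skelWith E c := by
  refine .inr (mem_iUnion.2 ⟨i, ?_⟩)
  rw [← (hψ i).range_eq]
  exact ⟨z, rfl⟩

variable [TopologicalSpace ι] [DiscreteTopology ι]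

/-- The characteristic maps of a family of `n`-cells as one map from a disjoint union of discs. -/
def attach (hψ : ∀ i, IsCharMap (c i) (ψ i)) : C(ι × Disc.{u} n, skelWith E c) :=
  ⟨fun p ↦ ⟨ψ p.1 p.2, charMap_mem_skelWith hψ p.1 p.2⟩, by
    rw [continuous_prod_of_discrete_left]
    intro i
    exact (ψ i).continuous.subtype_mk _⟩

/-- Attaching `n`-cells to the skeleton of lower dimension is a gluing of discs along their
boundaries. -/
theorem isGluing_attach (hc : Function.Injective c) (hE : ∀ i, c i ∈ E.I n)
    (hψ : ∀ i, IsCharMap (c i) (ψ i)) :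
    IsGluing (Prod.snd ⁻¹' discBoundary n : Set (ι × Disc.{u} n)) (Subtype.val ⁻¹' skel E n)
      (attach (E := E) hψ) where
  isClosed := (isClosed_discBoundary n).preimage continuous_snd
  isClosed' := (isClosed_skel E n).preimage continuous_subtype_val
  injOn := by
    rintro ⟨i, z⟩ hz ⟨j, w⟩ hw h
    have h1 : ψ i z = ψ j w := congrArg Subtype.val h
    have h2 : ψ i z ∈ openCell n (c i) := by
      rw [← (hψ i).image_compl]
      exact ⟨z, hz, rfl⟩
    have h3 : ψ j w ∈ openCell n (c j) := by
      rw [← (hψ j).image_compl]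
      exact ⟨w, hw, rfl⟩
    rw [← h1] at h3
    obtain rfl := hc (cell_eq_of_mem' h2 h3)
    exact Prod.ext rfl ((hψ i).injOn hz hw h1)
  mapsTo p hp := cellFrontier_subset_skel (hE p.1) ((hψ p.1).mapsTo hp)
  mapsTo_compl p hp := by
    refine notMem_skel (e := c p.1) ?_
    rw [← (hψ p.1).image_compl]
    exact ⟨p.2, hp, rfl⟩
  quot := by
    rw [isQuotientMap_iff_isClosed]
    refine ⟨?_, fun V ↦ ⟨fun hV ↦ hV.preimage (by fun_prop), fun hV ↦ ?_⟩⟩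
    · rintro ⟨x, hx⟩
      rcases hx with hx | hx
      · exact ⟨.inl ⟨⟨x, _⟩, hx⟩, rfl⟩
      · obtain ⟨i, hi⟩ := mem_iUnion.1 hx
        rw [← (hψ i).range_eq] at hi
        obtain ⟨z, rfl⟩ := hi
        exact ⟨.inr (i, z), rfl⟩
    · obtain ⟨h1, h2⟩ := isClosed_sum_iff.1 hV
      have h3 : IsClosed (Subtype.val '' V ∩ skel E n) := by
        have h4 : IsClosed ((fun x : skel E n ↦ (⟨x.1, .inl x.2⟩ : skelWith E c)) ⁻¹' V) := by
          have h5 : Continuous fun x : skel E n ↦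
            (⟨⟨x.1, .inl x.2⟩, x.2⟩ : (Subtype.val ⁻¹' skel E n : Set (skelWith E c))) := by
            fun_prop
          exact h1.preimage h5
        convert (isClosed_skel E n).isClosedMap_subtype_val _ h4 using 1
        ext x
        constructor
        · rintro ⟨⟨y, hy, rfl⟩, hx⟩
          exact ⟨⟨y.1, hx⟩, hy, rfl⟩
        · rintro ⟨y, hy, rfl⟩
          exact ⟨⟨_, hy, rfl⟩, y.2⟩
      have h4 : IsClosed (Subtype.val '' V) := by
        -- It is enough to look at the cells whose open cell meets `V`: they lie in the skeleton,
        -- or they are among the attached cells.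
        refine CWComplex.isClosed_of_disjoint_openCell_or_isClosed_inter_closedCell
          (C := (univ : Set X)) (subset_univ _) fun m _ e ↦ ?_
        by_cases hd : Disjoint (Subtype.val '' V) (openCell m e)
        · exact .inl hd
        right
        obtain ⟨_, ⟨⟨x, hxA⟩, hxV, rfl⟩, hxe⟩ := Set.not_disjoint_iff.1 hd
        by_cases hx : x ∈ skel E n
        · obtain ⟨m', hm', e', he', hxe'⟩ := mem_skel_iff.1 hx
          obtain ⟨rfl, h⟩ := Sigma.mk.inj_iff.1 (cell_eq_of_mem hxe hxe')
          obtain rfl := eq_of_heq h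
          have h5 : closedCell m e ⊆ skel E n :=
            (closedCell_subset_skel he').trans (skel_mono E hm')
          rw [← inter_eq_self_of_subset_right h5, ← inter_assoc]
          exact h3.inter RelCWComplex.isClosed_closedCell
        · obtain ⟨i, hi⟩ := mem_iUnion.1 (hxA.resolve_left hx)
          have h6 : x ∈ openCell n (c i) := by
            rw [← cellFrontier_union_openCell_eq_closedCell] at hi
            exact hi.resolve_left fun h ↦ hx (cellFrontier_subset_skel (hE i) h)
          obtain ⟨rfl, h⟩ := Sigma.mk.inj_iff.1 (cell_eq_of_mem hxe h6)
          obtain rfl := eq_of_heq h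
          have h7 : IsClosed (ψ i '' ((fun z ↦ (i, z)) ⁻¹' (attach (E := E) hψ ⁻¹' V))) := by
            have h8 : IsClosed ((fun z : Disc.{u} m ↦ (i, z)) ⁻¹' (attach (E := E) hψ ⁻¹' V)) :=
              h2.preimage (by fun_prop)
            exact (h8.isCompact.image (ψ i).continuous).isClosed
          convert h7 using 1
          ext y
          constructor
          · rintro ⟨⟨y, hy, rfl⟩, hye⟩
            rw [← (hψ i).range_eq] at hye
            obtain ⟨z, hz⟩ := hye
            refine ⟨z, ?_, hz⟩
            have : attach hψ (i, z) = y := Subtype.ext hz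
            change attach hψ (i, z) ∈ V
            rwa [this]
          · rintro ⟨z, hz, rfl⟩
            refine ⟨⟨_, hz, rfl⟩, ?_⟩
            rw [← (hψ i).range_eq]
            exact ⟨z, rfl⟩
      convert h4.preimage continuous_subtype_val (X := skelWith E c) using 1
      exact (preimage_image_eq V Subtype.val_injective).symm

omit [TopologicalSpace ι] [DiscreteTopology ι] in
theorem mapsTo_charMap_skelWith (hψ : ∀ i, IsCharMap (c i) (ψ i)) (i : ι) :
    MapsTo (ψ i) univ (skelWith E c) :=
  fun z _ ↦ charMap_mem_skelWith hψ i z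

omit [TopologicalSpace ι] [DiscreteTopology ι] in
theorem mapsTo_charMap_skel (hE : ∀ i, c i ∈ E.I n) (hψ : ∀ i, IsCharMap (c i) (ψ i)) (i : ι) :
    MapsTo (ψ i) (discBoundary n) (skel E n) :=
  (hψ i).mapsTo.mono_right (cellFrontier_subset_skel (hE i))

/-- The relative homology of a complex obtained by attaching `n`-cells is the direct sum of copies
of `H_k(Dⁿ, Sⁿ⁻¹)`. -/
theorem bijective_skelWith (hc : Function.Injective c) (hE : ∀ i, c i ∈ E.I n)
    (hψ : ∀ i, IsCharMap (c i) (ψ i)) (k : ℕ) :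
    Function.Bijective (Finsupp.liftAddHom fun i ↦ relHomologyMap (ψ i)
      (mapsTo_charMap_skelWith (E := E) hψ i) (mapsTo_charMap_skel hE hψ i) k) := by
  have h1 := bijective_copyMap (ι := ι) (discBoundary.{u} n) k
  have h2 := (isGluing_attach (E := E) hc hE hψ).bijective (discCollar n).copies k
  have h3 := bijective_relHomologyMap_val (skelWith E c) (skel E n) k
  convert (h3.comp h2).comp h1 using 1
  have : (Finsupp.liftAddHom fun i ↦ relHomologyMap (ψ i)
      (mapsTo_charMap_skelWith (E := E) hψ i) (mapsTo_charMap_skel hE hψ i) k) =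
    ((relHomologyMap (incl (skelWith E c)) (mapsTo_incl _)
      (mapsTo_incl_preimage _ (skel E n)) k).comp
      (relHomologyMap (attach (E := E) hψ) (mapsTo_univ (s := univ) _)
        (isGluing_attach hc hE hψ).mapsTo k)).comp
      (Finsupp.liftAddHom fun i : ι ↦ copyMap (discBoundary.{u} n) i k) := by
    refine Finsupp.addHom_ext fun i x ↦ ?_
    rw [AddMonoidHom.comp_apply, Finsupp.liftAddHom_apply_single,
      Finsupp.liftAddHom_apply_single, AddMonoidHom.comp_apply, copyMap, relHomologyMap_comp,
      relHomologyMap_comp]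
    rfl
  rw [this]
  rfl

end CellHomology

end Cellular

namespace Cellular

open RelSing SingularChains FreeChains TupleChains Topology.CWComplex

/-! ### Cellular chain groups -/

section CellularChains

variable {X : Type u} [TopologicalSpace X] [T2Space X] [CWComplex (univ : Set X)]
  {E : Subcomplex (univ : Set X)}

theorem mapsTo_univ_skel {n : ℕ} {e : cell (univ : Set X) n} {ψ : C(Disc.{u} n, X)}
    (hE : e ∈ E.I n) (hψ : IsCharMap e ψ) : MapsTo ψ univ (skel E (n + 1)) := fun z _ ↦
  closedCell_subset_skel hE (hψ.range_eq ▸ ⟨z, rfl⟩)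

theorem mapsTo_discBoundary_skel {n : ℕ} {e : cell (univ : Set X) n} {ψ : C(Disc.{u} n, X)}
    (hE : e ∈ E.I n) (hψ : IsCharMap e ψ) : MapsTo ψ (discBoundary n) (skel E n) :=
  hψ.mapsTo.mono_right (cellFrontier_subset_skel hE)

/-- `H_k(E_n, E_{n-1})` is the direct sum of copies of `H_k(Dⁿ, Sⁿ⁻¹)`, one for each `n`-cell; each
cell may be parametrised by any map from the disc. -/
theorem bijective_skel {n : ℕ} {ι : Type u} {c : ι → cell (univ : Set X) n}
    {ψ : ι → C(Disc.{u} n, X)} (hc : Function.Injective c) (hE : ∀ i, c i ∈ E.I n)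
    (hsurj : ∀ e ∈ E.I n, ∃ i, c i = e) (hψ : ∀ i, IsCharMap (c i) (ψ i)) (k : ℕ) :
    Function.Bijective (Finsupp.liftAddHom fun i ↦ relHomologyMap (ψ i)
      (mapsTo_univ_skel (hE i) (hψ i)) (mapsTo_discBoundary_skel (hE i) (hψ i)) k) := by
  let _ : TopologicalSpace ι := ⊥
  have _ : DiscreteTopology ι := ⟨rfl⟩
  have h := bijective_skelWith (E := E) hc hE hψ k
  have hA : skelWith E c = skel E (n + 1) := by
    rw [skel_succ]
    refine congrArg _ (subset_antisymm (iUnion_subset fun i ↦ ?_) (iUnion_subset fun e ↦ ?_))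
    · exact subset_iUnion (fun e : E.I n ↦ closedCell n e.1) ⟨c i, hE i⟩
    · obtain ⟨i, hi⟩ := hsurj e.1 e.2
      rw [← hi]
      exact subset_iUnion (fun i ↦ closedCell n (c i)) i
  have key : ∀ (A : Set X) (_ : skelWith E c = A) (hm : ∀ i, MapsTo (ψ i) univ A),
      Function.Bijective (Finsupp.liftAddHom fun i ↦ relHomologyMap (ψ i) (hm i)
        (mapsTo_discBoundary_skel (hE i) (hψ i)) k) := by
    rintro A rfl hm
    exact h
  exact key _ hA _

theorem subsingleton_relHomology_skel {n k : ℕ} (h : k ≠ n) :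
    Subsingleton (relHomology (skel E (n + 1)) (skel E n) k) := by
  have h1 := bijective_skel (E := E) (c := fun e : E.I n ↦ e.1) Subtype.val_injective
    (fun e ↦ e.2) (fun e he ↦ ⟨⟨e, he⟩, rfl⟩) (fun e ↦ isCharMap_charMap e.1) k
  have := subsingleton_disc.{u} h
  exact h1.2.subsingleton

/-- A generator of the infinite cyclic group `H_n(Dⁿ, Sⁿ⁻¹)`. -/
noncomputable def discGen (n : ℕ) : relHomology (univ : Set (Disc.{u} n)) (discBoundary n) n :=
  (discEquiv n).symm 1

theorem eq_zsmul_discGen {n : ℕ} (x : relHomology (univ : Set (Disc.{u} n)) (discBoundary n) n) :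
    x = discEquiv n x • discGen n := by
  rw [discGen, ← map_zsmul, AddEquiv.eq_symm_apply]
  simp

/-- The class of a cell in the cellular chain group, for a given parametrisation of the cell. -/
noncomputable def cellGen {n : ℕ} {e : cell (univ : Set X) n} {ψ : C(Disc.{u} n, X)}
    (hE : e ∈ E.I n) (hψ : IsCharMap e ψ) : cellularChains E n :=
  relHomologyMap ψ (mapsTo_univ_skel hE hψ) (mapsTo_discBoundary_skel hE hψ) n (discGen n)

/-- The cellular chain group is free on the cells. -/
theorem bijective_cellGen {n : ℕ} {ι : Type u} {c : ι → cell (univ : Set X) n}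
    {ψ : ι → C(Disc.{u} n, X)} (hc : Function.Injective c) (hE : ∀ i, c i ∈ E.I n)
    (hsurj : ∀ e ∈ E.I n, ∃ i, c i = e) (hψ : ∀ i, IsCharMap (c i) (ψ i)) :
    Function.Bijective (liftFree fun i ↦ cellGen (hE i) (hψ i)) := by
  have h := bijective_skel hc hE hsurj hψ n
  have h2 := (Finsupp.mapRange.addEquiv (ι := ι) (discEquiv.{u} n).symm).bijective
  convert h.comp h2 using 1
  have : liftFree (fun i ↦ cellGen (hE i) (hψ i)) =
      (Finsupp.liftAddHom fun i ↦ relHomologyMap (ψ i)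
        (mapsTo_univ_skel (hE i) (hψ i)) (mapsTo_discBoundary_skel (hE i) (hψ i)) n).comp
      (Finsupp.mapRange.addEquiv (ι := ι) (discEquiv.{u} n).symm).toAddMonoidHom := by
    refine hom_ext fun i ↦ ?_
    rw [liftFree_single, AddMonoidHom.comp_apply]
    refine Eq.trans ?_ (congrArg _ (Finsupp.mapRange_single (f := (discEquiv.{u} n).symm)
      (hf := map_zero _)).symm)
    rw [Finsupp.liftAddHom_apply_single]
    rfl
  rw [this]
  rfl

/-- The class of a cell for one parametrisation is a multiple of its class for any other, so that
the class depends on the parametrisation only up to sign. -/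
theorem exists_cellGen_eq_zsmul {n : ℕ} {e : cell (univ : Set X) n} {ψ ψ' : C(Disc.{u} n, X)}
    (hE : e ∈ E.I n) (hψ : IsCharMap e ψ) (hψ' : IsCharMap e ψ') :
    ∃ m : ℤ, cellGen hE hψ' = m • cellGen hE hψ := by
  let _ : TopologicalSpace PUnit.{u + 1} := ⊥
  have _ : DiscreteTopology PUnit.{u + 1} := ⟨rfl⟩
  let c : PUnit.{u + 1} → cell (univ : Set X) n := fun _ ↦ e
  have h := (bijective_skelWith (E := E) (c := c) (ψ := fun _ ↦ ψ)
    (fun _ _ _ ↦ rfl) (fun _ ↦ hE) (fun _ ↦ hψ) n).2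
  have hm := mapsTo_charMap_skelWith (E := E) (c := c) (ψ := fun _ ↦ ψ') (fun _ ↦ hψ') ⟨⟩
  have hm' := mapsTo_charMap_skelWith (E := E) (c := c) (ψ := fun _ ↦ ψ) (fun _ ↦ hψ) ⟨⟩
  obtain ⟨a, ha⟩ := h (relHomologyMap ψ' hm (mapsTo_discBoundary_skel hE hψ') n (discGen n))
  have h2 : skelWith E c ⊆ skel E (n + 1) :=
    union_subset (skel_mono E (Nat.le_succ n)) (iUnion_subset fun _ ↦ closedCell_subset_skel hE)
  have h3 : a = Finsupp.single ⟨⟩ (a ⟨⟩) := by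
    ext
    simp
  rw [h3, Finsupp.liftAddHom_apply_single, eq_zsmul_discGen (a ⟨⟩), map_zsmul] at ha
  refine ⟨discEquiv n (a ⟨⟩), ?_⟩
  have hi : MapsTo (ContinuousMap.id X) (skelWith E c) (skel E (n + 1)) := h2
  have hi' : MapsTo (ContinuousMap.id X) (skel E n) (skel E n) := mapsTo_id _
  have h4 := congrArg (relHomologyMap (.id X) hi hi' n) ha
  rw [map_zsmul, relHomologyMap_comp, relHomologyMap_comp] at h4
  exact h4.symm

end CellularChains

end Cellular

/-! ### Relative cycles in vanishing relative homology groups -/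

namespace SingularChains

open RelSing

theorem BdryIn.mono {X : Type u} [TopologicalSpace X] {B B' : Set X} (h : B ⊆ B') {n : ℕ}
    {c : Ch X n} (hc : BdryIn B n c) : BdryIn B' n c := by
  cases n with
  | zero => trivial
  | succ n => exact chIn_mono h n hc

theorem BdryIn.sub_d {X : Type u} [TopologicalSpace X] {B : Set X} {n : ℕ}
    {c : Ch X n} (hc : BdryIn B n c) (y : Ch X (n + 1)) :
    BdryIn B n (c - SingularChains.d n y) := by
  cases n with
  | zero => trivial
  | succ n =>
    change SingularChains.d n _ ∈ _
    rw [map_sub, d_d, sub_zero]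
    exact hc

theorem exists_of_subsingleton {X : Type u} [TopologicalSpace X] {A B : Set X} {n : ℕ}
    (h : Subsingleton (relHomology A B n)) {c : Ch X n} (h1 : c ∈ chIn A n) (h2 : BdryIn B n c) :
    ∃ y ∈ chIn A (n + 1), c - d n y ∈ chIn B n :=
  cls_eq_zero.1 (Subsingleton.elim (cls A B n c h1 h2) 0)

end SingularChains

namespace Cellular

open RelSing SingularChains FreeChains TupleChains Topology.CWComplex

/-! ### The cellular chain complex of a contractible complex -/

section Exactness

variable {X : Type u} [TopologicalSpace X] [T2Space X] [CWComplex (univ : Set X)]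
  {E : Subcomplex (univ : Set X)}

/-- `H_k(E_{m-1}, E_{j-1}) = 0` for `k < j ≤ m`, on the level of chains. -/
theorem exists_sub_mem_chIn_skel {j m k : ℕ} (hk : k < j) (hj : j ≤ m) {c : Ch X k}
    (hc : c ∈ chIn (skel E m) k) (hb : BdryIn (skel E j) k c) :
    ∃ y ∈ chIn (skel E m) (k + 1), c - d k y ∈ chIn (skel E j) k := by
  induction m, hj using Nat.le_induction generalizing c with
  | base => exact ⟨0, zero_mem _, by rwa [map_zero, sub_zero]⟩
  | succ m hjm ih =>
    obtain ⟨y, hy, h⟩ := exists_of_subsingleton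
      (subsingleton_relHomology_skel (by omega : k ≠ m)) hc (hb.mono (skel_mono E hjm))
    obtain ⟨y', hy', h'⟩ := ih h (hb.sub_d y)
    refine ⟨y + y', add_mem hy (chIn_mono (skel_mono E (Nat.le_succ m)) _ hy'), ?_⟩
    rwa [map_add, ← sub_sub]

/-- `H_k(E_{j-1}) = 0` for `k ≥ j`, on the level of chains. -/
theorem exists_eq_d_of_mem_chIn_skel {j k : ℕ} (hj : j ≤ k) {c : Ch X k}
    (hc : c ∈ chIn (skel E j) k) (hb : BdryIn ∅ k c) :
    ∃ y ∈ chIn (skel E j) (k + 1), d k y = c := by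
  induction j generalizing c with
  | zero =>
    rw [skel_zero, mem_chIn_empty] at hc
    exact ⟨0, zero_mem _, by rw [hc, map_zero]⟩
  | succ j ih =>
    obtain ⟨y, hy, h⟩ := exists_of_subsingleton
      (subsingleton_relHomology_skel (by omega : k ≠ j)) hc (hb.mono (empty_subset _))
    obtain ⟨y', hy', h'⟩ := ih (by omega) h (hb.sub_d y)
    refine ⟨y + y', add_mem hy (chIn_mono (skel_mono E (Nat.le_succ j)) _ hy'), ?_⟩
    rw [map_add, h', add_sub_cancel]

/-- A complex without cells of dimension at least `N` is equal to its skeleta from `N` on. -/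
theorem coe_eq_skel {N : ℕ} (hN : ∀ m, N ≤ m → IsEmpty (cell (univ : Set X) m)) {m : ℕ}
    (hm : N ≤ m) : (E : Set X) = skel E m := by
  refine subset_antisymm (fun x hx ↦ ?_) inter_subset_left
  obtain ⟨k, e, he⟩ := exists_mem_openCell x
  refine mem_skel_iff.2 ⟨k, ?_, e, mem_I_of_mem he hx, he⟩
  by_contra h
  exact (hN k (by omega)).false e

variable (E) in
/-- The augmentation of the cellular chain complex, the sum of the coefficients of a `0`-chain. -/
noncomputable def cellularAug : cellularChains E 0 →+ ℤ :=
  clsLift (aug.comp (relCyc _ _ 0).subtype) (by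
    rintro ⟨c, h1, h2⟩ ⟨y, -, hy⟩
    rw [skel_zero, mem_chIn_empty, sub_eq_zero] at hy
    change aug c = 0
    rw [show c = _ from hy, aug_d])

theorem cellularAug_cls (c : Ch X 0) (h1 h2) : cellularAug E (cls _ _ 0 c h1 h2) = aug c :=
  clsLift_cls _ _ _ _ _

theorem cellularAug_cellularBoundary (x : cellularChains E 1) :
    cellularAug E (cellularBoundary E 0 x) = 0 := by
  obtain ⟨c, h1, h2, rfl⟩ := exists_cls x
  refine (congrArg _ (connecting_cls _ _ _ _ c h1 h2)).trans ((cellularAug_cls _ _ _).trans ?_)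
  exact aug_d c

variable [ContractibleSpace (E : Set X)]

/-- Exactness in positive degrees. A cellular cycle is represented by a singular cycle `z` of the
`(n + 1)`-skeleton; it bounds in the contractible complex, and a bounding chain can be moved into
the `(n + 2)`-skeleton relative to `z`. -/
theorem exists_cellularBoundary_eq {N : ℕ}
    (hN : ∀ m, N ≤ m → IsEmpty (cell (univ : Set X) m)) {n : ℕ}
    {x : cellularChains E (n + 1)} (hx : cellularBoundary E n x = 0) :
    ∃ y, cellularBoundary E (n + 1) y = x := by
  obtain ⟨c, h1, h2, rfl⟩ := exists_cls x
  obtain ⟨y, hy, h⟩ := cls_eq_zero.1 ((connecting_cls _ _ _ _ c h1 h2).symm.trans hx)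
  have hb : BdryIn ∅ n (d n c - d n y) := by
    rw [← map_sub]
    exact .d _
  obtain ⟨y', hy', h'⟩ := exists_eq_d_of_mem_chIn_skel le_rfl h hb
  -- Correcting `c` by chains of the skeleton below gives an absolute cycle with the same class.
  have hz : d n (c - y - y') = 0 := by
    rw [map_sub, map_sub, h', sub_self]
  have hyA : y + y' ∈ chIn (skel E (n + 1)) (n + 1) :=
    add_mem hy (chIn_mono (skel_mono E (Nat.le_succ n)) _ hy')
  have hzA : c - y - y' ∈ chIn (skel E (n + 2)) (n + 1) := by
    rw [sub_sub]
    exact sub_mem h1 (chIn_mono (skel_mono E (Nat.le_succ _)) _ hyA)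
  obtain ⟨w, hw, hwz⟩ := exists_d_eq_of_contractible_subset
    (chIn_mono (inter_subset_left : skel E (n + 2) ⊆ (E : Set X)) _ hzA) hz
  -- The complex is finite-dimensional, so the bounding chain lies in some skeleton.
  have hm := coe_eq_skel (E := E) hN (le_max_left N (n + 3))
  rw [hm] at hw
  have hwb : BdryIn (skel E (n + 2)) (n + 2) w := by
    change d (n + 1) w ∈ _
    rwa [hwz]
  obtain ⟨v, -, hv⟩ := exists_sub_mem_chIn_skel (by omega : n + 2 < n + 3) (le_max_right N (n + 3))
    hw (hwb.mono (skel_mono E (Nat.le_succ _)))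
  refine ⟨cls _ _ _ _ hv (hwb.sub_d v), (connecting_cls _ _ _ _ _ hv (hwb.sub_d v)).trans
    (cls_eq_cls.2 ⟨0, zero_mem _, ?_⟩)⟩
  rw [map_sub, d_d, hwz, map_zero, sub_zero, sub_zero]
  convert neg_mem hyA using 1
  abel

theorem exists_cellularBoundary_eq_of_aug {N : ℕ}
    (hN : ∀ m, N ≤ m → IsEmpty (cell (univ : Set X) m)) {x : cellularChains E 0}
    (hx : cellularAug E x = 0) : ∃ y, cellularBoundary E 0 y = x := by
  obtain ⟨c, h1, h2, rfl⟩ := exists_cls x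
  rw [cellularAug_cls] at hx
  obtain ⟨w, hw, hwz⟩ := exists_d_eq_of_contractible_subset_zero
    (chIn_mono (inter_subset_left : skel E 1 ⊆ (E : Set X)) _ h1) hx
  have hm := coe_eq_skel (E := E) hN (le_max_left N 2)
  rw [hm] at hw
  have hwb : BdryIn (skel E 1) 1 w := by
    change d 0 w ∈ _
    rwa [hwz]
  obtain ⟨v, -, hv⟩ := exists_sub_mem_chIn_skel (by omega : 1 < 2) (le_max_right N 2)
    hw (hwb.mono (skel_mono E (Nat.le_succ _)))
  refine ⟨cls _ _ _ _ hv (hwb.sub_d v), (connecting_cls _ _ _ _ _ hv (hwb.sub_d v)).trans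
    (cls_eq_cls.2 ⟨0, zero_mem _, ?_⟩)⟩
  rw [map_sub, d_d, hwz, map_zero, sub_zero, sub_zero, sub_self]
  exact zero_mem _

theorem cellularAug_surjective {N : ℕ} (hN : ∀ m, N ≤ m → IsEmpty (cell (univ : Set X) m)) :
    Function.Surjective (cellularAug E) := by
  obtain ⟨p⟩ := (inferInstance : Nonempty (E : Set X))
  have hm := coe_eq_skel (E := E) hN (le_max_left N 1)
  obtain ⟨v, hv, hc⟩ := exists_sub_mem_chIn_skel (E := E) (j := 1) (k := 0) zero_lt_one
    (le_max_right N 1) (c := Finsupp.single (ContinuousMap.const _ p.1) 1) (by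
      refine single_mem_supp ?_ 1
      rintro _ ⟨t, rfl⟩
      exact hm ▸ p.2) trivial
  intro m
  have hb : BdryIn (skel E 0) 0 (Finsupp.single (ContinuousMap.const _ p.1) 1 - d 0 v) := trivial
  refine ⟨m • cls _ _ 0 _ hc hb, ?_⟩
  rw [map_zsmul, cellularAug_cls, map_sub, aug_single, aug_d]
  simp

end Exactness

end Cellular

namespace GCW

open RelSing SingularChains Cellular Topology.CWComplex
open scoped Pointwise

/-! ### The action on the cells of a `G`-CW-complex -/

section Cells

variable {G : Type u} [Group G] {X : Type u} [TopologicalSpace X] [MulAction G X]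
  [T2Space X] [CWComplex (univ : Set X)]

/-- The type of `n`-cells of a `G`-CW-complex, with its action of `G`. It is a synonym that carries
the proof of `IsGCWComplex`, because the action depends on it. -/
def Cells (_ : IsGCWComplex G X) (n : ℕ) : Type u := cell (univ : Set X) n

variable (hX : IsGCWComplex G X)

noncomputable instance (n : ℕ) : SMul G (Cells hX n) where
  smul g e := (hX.permutes g n e).choose

variable {hX} {n : ℕ}

omit [T2Space X] in
theorem smul_openCell (g : G) (e : Cells hX n) :
    g • openCell (C := (univ : Set X)) n e =
      openCell (C := (univ : Set X)) n (g • e : Cells hX n) :=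
  (hX.permutes g n e).choose_spec

omit [T2Space X] in
theorem smul_mem_openCell {e : Cells hX n} {x : X} (hx : x ∈ openCell (C := (univ : Set X)) n e)
    (g : G) : g • x ∈ openCell (C := (univ : Set X)) n (g • e : Cells hX n) := by
  rw [← smul_openCell]
  exact Set.smul_mem_smul_set hx

omit [T2Space X] in
theorem smul_eq_of_mem {e e' : Cells hX n} {g : G} {x : X}
    (hx : x ∈ openCell (C := (univ : Set X)) n e)
    (h : g • x ∈ openCell (C := (univ : Set X)) n e') : g • e = e' :=
  cell_eq_of_mem' (smul_mem_openCell hx g) h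

/-- The center of a cell, a chosen point of the open cell. -/
noncomputable def center (e : Cells hX n) : X := map (C := (univ : Set X)) n e 0

omit [T2Space X] in
theorem center_mem (e : Cells hX n) : center e ∈ openCell (C := (univ : Set X)) n e :=
  RelCWComplex.map_zero_mem_openCell _ _

noncomputable instance : MulAction G (Cells hX n) where
  one_smul e := smul_eq_of_mem (center_mem e) (by
    rw [one_smul]
    exact center_mem e)
  mul_smul g h e := smul_eq_of_mem (center_mem e) (by
    rw [mul_smul]
    exact smul_mem_openCell (smul_mem_openCell (center_mem e) h) g)

omit [T2Space X] in
theorem mem_stabilizer_iff {e : Cells hX n} {g : G} {x : X}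
    (hx : x ∈ openCell (C := (univ : Set X)) n e) :
    g ∈ MulAction.stabilizer G e ↔ g • x = x := by
  rw [MulAction.mem_stabilizer_iff]
  constructor
  · intro h
    refine hX.fixes g n e ?_ x hx
    exact (smul_openCell g e).trans (congrArg _ h)
  · intro h
    refine smul_eq_of_mem hx ?_
    rw [h]
    exact hx

omit [T2Space X] in
theorem stabilizer_eq {e : Cells hX n} {x : X}
    (hx : x ∈ openCell (C := (univ : Set X)) n e) :
    MulAction.stabilizer G e = MulAction.stabilizer G x := by
  ext g
  rw [mem_stabilizer_iff hx, MulAction.mem_stabilizer_iff]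

omit [T2Space X] in
theorem le_stabilizer_iff {L : Subgroup G} {e : Cells hX n} :
    L ≤ MulAction.stabilizer G e ↔
      openCell (C := (univ : Set X)) n e ⊆ MulAction.fixedPoints L X := by
  constructor
  · intro h x hx l
    exact (mem_stabilizer_iff hx).1 (h l.2)
  · intro h g hg
    exact (mem_stabilizer_iff (center_mem e)).2 (h (center_mem e) ⟨g, hg⟩)

theorem mem_fixed_I {L : Subgroup G} {e : Cells hX n} :
    e ∈ (fixed hX L).I n ↔ L ≤ MulAction.stabilizer G e := by
  rw [le_stabilizer_iff]
  change (∃ L' ∈ ({L} : Set (Subgroup G)), _) ↔ _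
  simp

theorem mem_sing_I (hfin : ∀ x : X, Finite (MulAction.stabilizer G x)) {K : Subgroup G}
    {e : Cells hX n} : e ∈ (sing hX K).I n ↔ K < MulAction.stabilizer G e := by
  change (∃ L ∈ {L : Subgroup G | Finite L ∧ K < L}, _) ↔ _
  constructor
  · rintro ⟨L, ⟨-, hL⟩, h⟩
    exact hL.trans_le (le_stabilizer_iff.2 h)
  · intro h
    refine ⟨_, ⟨?_, h⟩, le_stabilizer_iff.1 le_rfl⟩
    rw [stabilizer_eq (center_mem e)]
    exact hfin _

theorem mem_fixed_iff {L : Subgroup G} {x : X} :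
    x ∈ (fixed hX L : Set X) ↔ ∀ l ∈ L, l • x = x := by
  rw [coe_fixed]
  exact ⟨fun h l hl ↦ h ⟨l, hl⟩, fun h l ↦ h l.1 l.2⟩

/-! A cocompact `G`-CW-complex has finitely many orbits of cells: the orbits of the centers form a
closed discrete subset of the orbit space. -/

/-- A set that meets each open cell in at most one point is closed, since a closed cell meets only
finitely many open cells. -/
theorem isClosed_of_subsingleton_inter {P : Set X}
    (hP : ∀ (n : ℕ) (e : cell (univ : Set X) n), (P ∩ openCell n e).Subsingleton) :
    IsClosed P := by
  refine (CWComplex.closed (univ : Set X) P (subset_univ _)).2 fun n e ↦ Set.Finite.isClosed ?_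
  obtain ⟨I, hI⟩ := CWComplex.cellFrontier_subset_finite_openCell n e
  rw [← cellFrontier_union_openCell_eq_closedCell, inter_union_distrib_left]
  refine Set.Finite.union ?_ (hP n e).finite
  refine Set.Finite.subset ?_ (inter_subset_inter_right _ hI)
  simp only [inter_iUnion]
  refine Set.Finite.biUnion (Set.finite_lt_nat n) fun m _ ↦ ?_
  exact Set.Finite.biUnion (I m).finite_toSet fun j _ ↦ (hP m j).finite

variable (hX) in
/-- The orbits of cells, of all dimensions. -/
abbrev CellOrbit : Type u := Σ n, MulAction.orbitRel.Quotient G (Cells hX n)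

/-- The orbit of the center of a cell representing an orbit of cells. -/
noncomputable def centerOrbit (i : CellOrbit hX) : MulAction.orbitRel.Quotient G X :=
  Quotient.mk _ (center i.2.out)

omit [T2Space X] in
theorem centerOrbit_injective : Function.Injective (centerOrbit (hX := hX)) := by
  rintro ⟨n, i⟩ ⟨m, j⟩ h
  obtain ⟨g, hg⟩ := Quotient.exact h
  change g • center j.out = center i.out at hg
  have h1 := smul_mem_openCell (center_mem j.out) g
  rw [hg] at h1
  obtain ⟨rfl, h2⟩ := Sigma.mk.inj_iff.1 (cell_eq_of_mem (center_mem i.out) h1)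
  have h3 : i.out = g • j.out := eq_of_heq h2
  have h4 : i = j := by
    rw [← Quotient.out_eq i, ← Quotient.out_eq j]
    exact Quotient.sound ⟨g, h3.symm⟩
  rw [h4]

/-- A union of orbits of centers meets an open cell in at most one point, because group elements
that agree on a cell agree on its points. -/
theorem isClosed_image_centerOrbit (S : Set (CellOrbit hX)) : IsClosed (centerOrbit '' S) := by
  rw [← (isQuotientMap_quotient_mk' (s := MulAction.orbitRel G X)).isClosed_preimage]
  refine isClosed_of_subsingleton_inter fun n e ↦ ?_
  have key : ∀ x ∈ openCell (C := (univ : Set X)) n e,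
      x ∈ Quotient.mk (MulAction.orbitRel G X) ⁻¹' (centerOrbit '' S) →
      ∃ g : G, x = g • center (hX := hX) (n := n)
        (Quotient.out (Quotient.mk (MulAction.orbitRel G (Cells hX n)) e)) := by
    rintro x hx ⟨⟨m, i⟩, -, h⟩
    obtain ⟨g, hg⟩ := Quotient.exact h.symm
    change g • center i.out = x at hg
    have h1 := smul_mem_openCell (center_mem i.out) g
    rw [hg] at h1
    obtain ⟨rfl, h2⟩ := Sigma.mk.inj_iff.1 (cell_eq_of_mem hx h1)
    refine ⟨g, hg.symm.trans ?_⟩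
    have h3 : Quotient.mk (MulAction.orbitRel G (Cells hX n)) e = i := by
      rw [← Quotient.out_eq i]
      exact Quotient.sound ⟨g, (eq_of_heq h2).symm⟩
    rw [h3]
  rintro x ⟨hxP, hx⟩ y ⟨hyP, hy⟩
  obtain ⟨g, rfl⟩ := key x hx hxP
  obtain ⟨g', rfl⟩ := key y hy hyP
  set e' : Cells hX n := Quotient.out (Quotient.mk (MulAction.orbitRel G (Cells hX n)) e)
  have h1 : g • e' = g' • e' :=
    (smul_eq_of_mem (center_mem e') hx).trans (smul_eq_of_mem (center_mem e') hy).symm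
  rw [← inv_smul_eq_iff, smul_smul, ← MulAction.mem_stabilizer_iff,
    mem_stabilizer_iff (center_mem e'), mul_smul, inv_smul_eq_iff] at h1
  exact h1

theorem finite_cellOrbit (h : CompactSpace (MulAction.orbitRel.Quotient G X)) :
    Finite (CellOrbit hX) := by
  let _ : TopologicalSpace (CellOrbit hX) := ⊥
  have _ : DiscreteTopology (CellOrbit hX) := ⟨rfl⟩
  have hc : IsClosedEmbedding (centerOrbit (hX := hX)) :=
    .of_continuous_injective_isClosedMap continuous_of_discreteTopology centerOrbit_injective
      fun S _ ↦ isClosed_image_centerOrbit S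
  have := hc.compactSpace
  exact finite_of_compact_of_discrete

theorem exists_isEmpty_cell (hX : IsGCWComplex G X)
    (h : CompactSpace (MulAction.orbitRel.Quotient G X)) :
    ∃ N, ∀ m, N ≤ m → IsEmpty (cell (univ : Set X) m) := by
  have := finite_cellOrbit (hX := hX) h
  obtain ⟨N, hN⟩ := (Set.finite_range fun i : CellOrbit hX ↦ i.1).bddAbove
  refine ⟨N + 1, fun m hm ↦ ⟨fun e ↦ ?_⟩⟩
  have : m ≤ N := hN ⟨⟨m, Quotient.mk (MulAction.orbitRel G (Cells hX m)) e⟩, rfl⟩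
  omega

theorem finite_orbits (h : CompactSpace (MulAction.orbitRel.Quotient G X)) (n : ℕ) :
    Finite (MulAction.orbitRel.Quotient G (Cells hX n)) := by
  have := finite_cellOrbit (hX := hX) h
  exact Finite.of_injective (fun i ↦ (⟨n, i⟩ : CellOrbit hX)) fun i j h ↦ by
    simpa using h

end Cells

end GCW

/-! ### Morphisms of the orbit category and projective modules -/

namespace Bredon

open FreeChains

section OrbitCategory

variable {G : Type u} [Group G]

/-- The image of the base point under a morphism of the orbit category. -/
def homPt {H K : OrbitCat G} (f : H ⟶ K) : G ⧸ K.subgroup :=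
  (show (G ⧸ H.subgroup) →[G] (G ⧸ K.subgroup) from f) ((1 : G) : G ⧸ H.subgroup)

theorem hom_apply {H K : OrbitCat G} (f : H ⟶ K) (g : G) :
    (show (G ⧸ H.subgroup) →[G] (G ⧸ K.subgroup) from f) (g : G ⧸ H.subgroup) = g • homPt f := by
  rw [homPt, ← map_smul]
  congr 1
  change _ = ((g * 1 : G) : G ⧸ H.subgroup)
  rw [mul_one]

theorem homPt_injective {H K : OrbitCat G} : Function.Injective (homPt (H := H) (K := K)) := by
  intro f f' h
  refine MulActionHom.ext (X := G ⧸ H.subgroup) (Y := G ⧸ K.subgroup) (φ := id) fun x ↦ ?_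
  obtain ⟨g, rfl⟩ := QuotientGroup.mk_surjective x
  exact (hom_apply f g).trans ((congrArg (g • ·) h).trans (hom_apply f' g).symm)

/-- An element `g` such that the morphism `f : G ⧸ H → G ⧸ K` sends `xH` to `xgK`. -/
noncomputable def homRep {H K : OrbitCat G} (f : H ⟶ K) : G := (homPt f).out

theorem mk_homRep {H K : OrbitCat G} (f : H ⟶ K) : ((homRep f : G) : G ⧸ K.subgroup) = homPt f :=
  QuotientGroup.out_eq' _

/-- A morphism `xH ↦ xgK` is well defined only if `g⁻¹Hg ≤ K`. -/
theorem homRep_conj_mem {H K : OrbitCat G} (f : H ⟶ K) {l : G} (hl : l ∈ H.subgroup) :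
    (homRep f)⁻¹ * l * homRep f ∈ K.subgroup := by
  rw [mul_assoc, ← QuotientGroup.eq, mk_homRep]
  have h1 : ((l * homRep f : G) : G ⧸ K.subgroup) = l • homPt f := by
    rw [← mk_homRep]
    rfl
  rw [h1, ← hom_apply, homPt]
  congr 1
  rw [QuotientGroup.eq]
  simpa using hl

/-- The morphism `G ⧸ H → G ⧸ K` that sends `xH` to `xgK`. -/
def homOf {H K : OrbitCat G} (g : G) (hg : ∀ l ∈ H.subgroup, g⁻¹ * l * g ∈ K.subgroup) :
    H ⟶ K :=
  show (G ⧸ H.subgroup) →[G] (G ⧸ K.subgroup) from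
  { toFun := Quotient.lift (fun x ↦ ((x * g : G) : G ⧸ K.subgroup)) (by
      intro x y h
      refine QuotientGroup.eq.2 ?_
      have := hg _ (QuotientGroup.leftRel_apply.1 h)
      simpa [mul_assoc] using this)
    map_smul' := by
      intro x y
      obtain ⟨y, rfl⟩ := QuotientGroup.mk_surjective y
      exact congrArg QuotientGroup.mk (mul_assoc x y g) }

theorem homPt_homOf {H K : OrbitCat G} (g : G)
    (hg : ∀ l ∈ H.subgroup, g⁻¹ * l * g ∈ K.subgroup) : homPt (homOf g hg) = g :=
  congrArg QuotientGroup.mk (one_mul g)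

theorem homPt_id (H : OrbitCat G) : homPt (𝟙 H) = (1 : G) := rfl

theorem homPt_comp {H K L : OrbitCat G} (f : H ⟶ K) (f' : K ⟶ L) :
    homPt (f ≫ f') = ((homRep f * homRep f' : G) : G ⧸ L.subgroup) := by
  have h : homPt (f ≫ f') = homRep f • homPt f' := by
    rw [← hom_apply f', mk_homRep]
    rfl
  rw [h, ← mk_homRep f']
  rfl

/-- Elements `v i` of values of a module `M` form a basis if their images under the morphisms of the
orbit category form a basis of each value of `M`. -/
def IsBasis {M : OrbitMod G} {I : Type u} (K : I → OrbitCat G) (v : ∀ i, M.obj (op (K i))) : Prop :=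
  ∀ L : OrbitCat G, Function.Bijective
    (liftFree (A := M.obj (op L)) fun p : Σ i, L ⟶ K i ↦ (M.map p.2.op).hom (v p.1))

section Basis

variable {M N : OrbitMod G} {I : Type u} {K : I → OrbitCat G} {v : ∀ i, M.obj (op (K i))}

theorem IsBasis.ab_hom_ext (h : IsBasis K v) (L : OrbitCat G) {B : AddCommGrpCat.{u}}
    {a b : M.obj (op L) ⟶ B} (hab : ∀ p : Σ i, L ⟶ K i, a.hom ((M.map p.2.op).hom (v p.1)) =
      b.hom ((M.map p.2.op).hom (v p.1))) : a = b := by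
  refine AddCommGrpCat.hom_ext (AddMonoidHom.ext fun x ↦ ?_)
  obtain ⟨c, rfl⟩ := (h L).2 x
  refine hom_congr (f := a.hom.comp (liftFree _)) (g := b.hom.comp (liftFree _)) (fun p ↦ ?_) c
  rw [AddMonoidHom.comp_apply, AddMonoidHom.comp_apply, liftFree_single]
  exact hab p

theorem IsBasis.hom_ext (h : IsBasis K v) {a b : M ⟶ N}
    (hab : ∀ i, (a.app (op (K i))).hom (v i) = (b.app (op (K i))).hom (v i)) : a = b := by
  ext L : 2
  refine h.ab_hom_ext L.unop fun p ↦ ?_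
  have h1 := congrArg (fun φ ↦ φ.hom (v p.1)) (a.naturality p.2.op)
  have h2 := congrArg (fun φ ↦ φ.hom (v p.1)) (b.naturality p.2.op)
  exact h1.trans ((congrArg (N.map p.2.op).hom (hab p.1)).trans h2.symm)

theorem IsBasis.exists_hom (h : IsBasis K v) (m : ∀ i, N.obj (op (K i))) :
    ∃ f : M ⟶ N, ∀ i, (f.app (op (K i))).hom (v i) = m i := by
  let φ (L : OrbitCat G) : ((Σ i, L ⟶ K i) →₀ ℤ) ≃+ M.obj (op L) :=
    AddEquiv.ofBijective _ (h L)
  let θ (L : OrbitCat G) : ((Σ i, L ⟶ K i) →₀ ℤ) →+ N.obj (op L) :=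
    liftFree fun p ↦ (N.map p.2.op).hom (m p.1)
  let ψ (L : OrbitCat G) : M.obj (op L) ⟶ N.obj (op L) :=
    AddCommGrpCat.ofHom ((θ L).comp (φ L).symm.toAddMonoidHom)
  have hψ : ∀ L (p : Σ i, L ⟶ K i), (ψ L).hom ((M.map p.2.op).hom (v p.1)) =
      (N.map p.2.op).hom (m p.1) := by
    intro L p
    have hφ : φ L (Finsupp.single p 1) = (M.map p.2.op).hom (v p.1) := liftFree_single _ _
    rw [← hφ]
    change θ L ((φ L).symm (φ L _)) = _
    rw [AddEquiv.symm_apply_apply]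
    exact liftFree_single _ _
  refine ⟨{ app := fun L ↦ ψ L.unop, naturality := ?_ }, fun i ↦ ?_⟩
  · intro L L' g
    refine h.ab_hom_ext L.unop fun p ↦ ?_
    have h1 := congrArg (fun a ↦ a.hom (v p.1)) (M.map_comp p.2.op g)
    have h2 := congrArg (fun a ↦ a.hom (m p.1)) (N.map_comp p.2.op g)
    have h3 := hψ L'.unop ⟨p.1, g.unop ≫ p.2⟩
    have h4 := congrArg (N.map g).hom (hψ L.unop p)
    exact (congrArg (ψ L'.unop).hom h1.symm).trans (h3.trans (h2.trans h4.symm))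
  · have h1 := congrArg (fun a ↦ a.hom (v i)) (M.map_id (op (K i)))
    have h2 := congrArg (fun a ↦ a.hom (m i)) (N.map_id (op (K i)))
    exact (congrArg (ψ (K i)).hom h1.symm).trans ((hψ (K i) ⟨i, 𝟙 _⟩).trans h2)

/-- A module over the orbit category with a basis is projective. -/
theorem IsBasis.projective (h : IsBasis K v) : Projective M where
  factors {N E} f e _ := by
    have he : ∀ i, ∃ m, (e.app (op (K i))).hom m = (f.app (op (K i))).hom (v i) := fun i ↦
      (AddCommGrpCat.epi_iff_surjective (e.app (op (K i)))).1 inferInstance _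
    choose m hm using he
    obtain ⟨g, hg⟩ := h.exists_hom m
    refine ⟨g, h.hom_ext fun i ↦ ?_⟩
    exact (congrArg (e.app (op (K i))).hom (hg i)).trans (hm i)

end Basis

end OrbitCategory

end Bredon

/-! ### Naturality of induced maps in relative homology -/

namespace SingularChains

open FreeChains RelSing

variable {X Y : Type u} [TopologicalSpace X] [TopologicalSpace Y]

theorem cpush_congr {A : Set X} {f f' : C(X, Y)} (h : EqOn f f' A) {n : ℕ} {c : Ch X n}
    (hc : c ∈ chIn A n) : cpush f n c = cpush f' n c := by
  have : (cpush f n - cpush f' n) c ∈ (⊥ : AddSubgroup (Ch Y n)) := by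
    refine apply_mem_of_mem_supp _ (fun σ hσ ↦ ?_) hc
    rw [AddSubgroup.mem_bot, AddMonoidHom.sub_apply, cpush_single, cpush_single, sub_eq_zero]
    congr 1
    ext t
    exact h (hσ ⟨t, rfl⟩)
  rwa [AddSubgroup.mem_bot, AddMonoidHom.sub_apply, sub_eq_zero] at this

/-- The induced map depends only on the restriction to the larger subspace. -/
theorem relHomologyMap_congr {A B : Set X} {A' B' : Set Y} {f f' : C(X, Y)} (h : EqOn f f' A)
    (hA hA' hB hB') (n : ℕ) (x : relHomology A B n) :
    relHomologyMap (A' := A') (B' := B') f hA hB n x = relHomologyMap f' hA' hB' n x := by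
  obtain ⟨c, h1, h2, rfl⟩ := exists_cls x
  simp only [relHomologyMap_cls, cpush_congr h h1]

theorem connecting_relHomologyMap {A B C : Set X} {A' B' C' : Set Y} (f : C(X, Y))
    (hA : MapsTo f A A') (hB : MapsTo f B B') (hC : MapsTo f C C') (n : ℕ)
    (x : relHomology A B (n + 1)) :
    connecting A' B' C' n (relHomologyMap f hA hB (n + 1) x) =
      relHomologyMap f hB hC n (connecting A B C n x) := by
  obtain ⟨c, h1, h2, rfl⟩ := exists_cls x
  rw [relHomologyMap_cls, connecting_cls, connecting_cls]
  refine Eq.trans ?_ (relHomologyMap_cls f hB hC n (d n c) h2 (.d c)).symm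
  simp only [d_cpush]

end SingularChains

namespace GCW

open RelSing SingularChains FreeChains Cellular Bredon Topology.CWComplex
open scoped Pointwise

/-! ### The cellular chains of the fixed point sets as modules over the orbit category -/

section Translation

variable {G : Type u} [Group G] {X : Type u} [TopologicalSpace X] [MulAction G X]
  [T2Space X] [CWComplex (univ : Set X)] (hX : IsGCWComplex G X)

/-- The homeomorphism of a `G`-CW-complex given by a group element. -/
def smulMap (g : G) : C(X, X) := ⟨fun x ↦ g • x, hX.continuous_smul g⟩

variable {hX}

theorem smul_mem_fixed_I {L L' : Subgroup G} {g : G} (h : ∀ l ∈ L', g⁻¹ * l * g ∈ L) {n : ℕ}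
    {e : Cells hX n} (he : e ∈ (fixed hX L).I n) : (g • e : Cells hX n) ∈ (fixed hX L').I n := by
  rw [mem_fixed_I] at he
  refine mem_fixed_I.2 fun l hl ↦ ?_
  have := MulAction.mem_stabilizer_iff.1 (he (h l hl))
  rwa [mul_smul, mul_smul, inv_smul_eq_iff] at this

theorem mapsTo_smulMap {L L' : Subgroup G} {g : G} (h : ∀ l ∈ L', g⁻¹ * l * g ∈ L) (k : ℕ) :
    MapsTo (smulMap hX g) (skel (fixed hX L) k) (skel (fixed hX L') k) := by
  intro x hx
  obtain ⟨m, hm, e, he, hxe⟩ := mem_skel_iff.1 hx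
  exact mem_skel_iff.2 ⟨m, hm, g • (show Cells hX m from e), smul_mem_fixed_I h he,
    smul_mem_openCell (e := e) hxe g⟩

/-- The map `C_n(X^L) → C_n(X^{L'})` given by an element `g` with `g⁻¹ L' g ≤ L`. -/
noncomputable def transl {L L' : Subgroup G} {g : G} (h : ∀ l ∈ L', g⁻¹ * l * g ∈ L) (n : ℕ) :
    cellularChains (fixed hX L) n →+ cellularChains (fixed hX L') n :=
  relHomologyMap (smulMap hX g) (mapsTo_smulMap h (n + 1)) (mapsTo_smulMap h n) n

/-- Elements of the same coset of `L` act in the same way on `X^L`. -/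
theorem transl_congr {L L' : Subgroup G} {g g' : G} (h : ∀ l ∈ L', g⁻¹ * l * g ∈ L)
    (h' : ∀ l ∈ L', g'⁻¹ * l * g' ∈ L) (hg : (g : G ⧸ L) = (g' : G ⧸ L)) (n : ℕ)
    (x : cellularChains (fixed hX L) n) : transl h n x = transl h' n x := by
  refine relHomologyMap_congr (fun x hx ↦ ?_) _ _ _ _ n x
  have := mem_fixed_iff.1 hx.1 _ (QuotientGroup.eq.1 hg)
  change g • x = g' • x
  rwa [mul_smul, inv_smul_eq_iff, eq_comm] at this

theorem transl_one {L : Subgroup G} {g : G} (h : ∀ l ∈ L, g⁻¹ * l * g ∈ L)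
    (hg : (g : G ⧸ L) = ((1 : G) : G ⧸ L)) (n : ℕ) (x : cellularChains (fixed hX L) n) :
    transl h n x = x := by
  rw [transl_congr h (g' := 1) (by simp) hg]
  obtain ⟨c, h1, h2, rfl⟩ := exists_cls x
  have : smulMap hX (1 : G) = ContinuousMap.id X := ContinuousMap.ext fun x ↦ one_smul G x
  rw [transl, relHomologyMap_cls]
  simp only [this, cpush_id]

theorem transl_transl {L L' L'' : Subgroup G} {g g' g'' : G} (h : ∀ l ∈ L', g⁻¹ * l * g ∈ L)
    (h' : ∀ l ∈ L'', g'⁻¹ * l * g' ∈ L') (h'' : ∀ l ∈ L'', g''⁻¹ * l * g'' ∈ L)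
    (hg : (g'' : G ⧸ L) = ((g' * g : G) : G ⧸ L)) (n : ℕ) (x : cellularChains (fixed hX L) n) :
    transl h' n (transl h n x) = transl h'' n x := by
  rw [transl_congr h'' (g' := g' * g) (fun l hl ↦ by
    simpa [mul_assoc] using h _ (h' l hl)) hg, transl, transl, relHomologyMap_comp]
  refine relHomologyMap_congr (fun x _ ↦ ?_) _ _ _ _ n x
  exact (mul_smul g' g x).symm

theorem cellularBoundary_transl {L L' : Subgroup G} {g : G} (h : ∀ l ∈ L', g⁻¹ * l * g ∈ L)
    (n : ℕ) (x : cellularChains (fixed hX L) (n + 1)) :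
    cellularBoundary _ n (transl h (n + 1) x) = transl h n (cellularBoundary _ n x) :=
  connecting_relHomologyMap _ _ _ _ n x

theorem cellularAug_transl {L L' : Subgroup G} {g : G} (h : ∀ l ∈ L', g⁻¹ * l * g ∈ L)
    (x : cellularChains (fixed hX L) 0) :
    cellularAug _ (transl h 0 x) = cellularAug _ x := by
  obtain ⟨c, h1, h2, rfl⟩ := exists_cls x
  rw [transl, relHomologyMap_cls, cellularAug_cls, cellularAug_cls, aug_cpush]

/-- The translate of a parametrisation of `e` parametrises `g • e`. -/
theorem isCharMap_smul {n : ℕ} {e : Cells hX n} {ψ : C(Disc.{u} n, X)} (hψ : IsCharMap e ψ)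
    (g : G) : IsCharMap (g • e : Cells hX n) ((smulMap hX g).comp ψ) where
  injOn z hz w hw h := hψ.injOn hz hw (MulAction.injective g h)
  image_compl := by
    rw [← smul_openCell, ← hψ.image_compl]
    exact image_comp (fun x : X ↦ g • x) ψ _
  mapsTo z hz := by
    have h1 := hψ.mapsTo hz
    have h2 : g • ψ z ∈ closedCell (C := (univ : Set X)) n (g • e : Cells hX n) := by
      rw [← CWComplex.closure_openCell_eq_closedCell, ← smul_openCell]
      refine image_closure_subset_closure_image (hX.continuous_smul g) ⟨ψ z, ?_, rfl⟩
      have h3 : closure (openCell (C := (univ : Set X)) n e) = closedCell n e :=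
        CWComplex.closure_openCell_eq_closedCell
      exact h3 ▸ cellFrontier_subset_closedCell _ _ h1
    have h4 := cellFrontier_union_openCell_eq_closedCell (C := (univ : Set X)) n
      (g • e : Cells hX n)
    rw [← h4] at h2
    -- A boundary point cannot move into the open cell `g • e`, since `g⁻¹` would move it into `e`.
    refine Or.resolve_right h2 fun h ↦ ?_
    have h3 : ψ z ∈ openCell (C := (univ : Set X)) n e := by
      have := smul_mem_openCell (e := (g • e : Cells hX n)) h g⁻¹
      have h5 : g⁻¹ • smulMap hX g (ψ z) = ψ z := inv_smul_smul g (ψ z)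
      rw [inv_smul_smul] at this
      exact h5 ▸ this
    exact (CWComplex.disjoint_skeletonLT_openCell le_rfl).notMem_of_mem_left
      (CWComplex.cellFrontier_subset_skeletonLT n e h1) h3

theorem transl_cellGen {L L' : Subgroup G} {g : G} (h : ∀ l ∈ L', g⁻¹ * l * g ∈ L) {n : ℕ}
    {e : Cells hX n} {ψ : C(Disc.{u} n, X)} (he : e ∈ (fixed hX L).I n) (hψ : IsCharMap e ψ) :
    transl h n (cellGen he hψ) = cellGen (smul_mem_fixed_I h he) (isCharMap_smul hψ g) :=
  relHomologyMap_comp _ _ _ _ _ _ _ _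

end Translation

section Modules

variable {G : Type u} [Group G] {X : Type u} [TopologicalSpace X] [MulAction G X]
  [T2Space X] [CWComplex (univ : Set X)] (hX : IsGCWComplex G X)

/-- The module over the orbit category with value `C_n(X^H)` at `G ⧸ H`. A morphism
`xH ↦ xgK` acts by translation with `g`; the choice of `g` in its coset does not matter, by
`transl_congr`. -/
noncomputable def cellMod (n : ℕ) : OrbitMod G where
  obj L := AddCommGrpCat.of (cellularChains (fixed hX L.unop.subgroup) n)
  map f := AddCommGrpCat.ofHom (transl (fun _ hl ↦ homRep_conj_mem f.unop hl) n)
  map_id L := by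
    refine AddCommGrpCat.hom_ext (AddMonoidHom.ext fun x ↦ ?_)
    exact transl_one (fun _ hl ↦ homRep_conj_mem (𝟙 L.unop) hl)
      ((mk_homRep _).trans (homPt_id _)) n x
  map_comp f g := by
    refine AddCommGrpCat.hom_ext (AddMonoidHom.ext fun x ↦ ?_)
    exact (transl_transl (fun _ hl ↦ homRep_conj_mem f.unop hl)
      (fun _ hl ↦ homRep_conj_mem g.unop hl) (fun _ hl ↦ homRep_conj_mem (g.unop ≫ f.unop) hl)
      ((mk_homRep _).trans (homPt_comp g.unop f.unop)) n x).symm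

/-- The cellular boundary as a morphism of modules over the orbit category. -/
noncomputable def cellModBoundary (n : ℕ) : cellMod hX (n + 1) ⟶ cellMod hX n where
  app L := AddCommGrpCat.ofHom (cellularBoundary (fixed hX L.unop.subgroup) n)
  naturality L L' f := by
    refine AddCommGrpCat.hom_ext (AddMonoidHom.ext fun x ↦ ?_)
    exact cellularBoundary_transl (fun _ hl ↦ homRep_conj_mem f.unop hl) n x

/-- The augmentation as a morphism of modules over the orbit category. -/
noncomputable def cellModAug : cellMod hX 0 ⟶ trivMod G where
  app L := AddCommGrpCat.ofHom
    (AddEquiv.ulift.{0, u}.symm.toAddMonoidHom.comp (cellularAug (fixed hX L.unop.subgroup)))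
  naturality L L' f := by
    refine AddCommGrpCat.hom_ext (AddMonoidHom.ext fun x ↦ ?_)
    exact congrArg ULift.up (cellularAug_transl
      (fun _ hl ↦ homRep_conj_mem f.unop hl) x)

variable {hX}

/-- The isotropy group of a cell as an object of the orbit category. -/
noncomputable def isotropy (hfin : ∀ x : X, Finite (MulAction.stabilizer G x)) {n : ℕ}
    (e : Cells hX n) : OrbitCat G where
  subgroup := MulAction.stabilizer G e
  finite := by
    rw [stabilizer_eq (center_mem e)]
    exact hfin _

omit [T2Space X] in
theorem mem_isotropy {n : ℕ} {hfin : ∀ x : X, Finite (MulAction.stabilizer G x)} {e : Cells hX n}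
    {g : G} : g ∈ (isotropy hfin e).subgroup ↔ g • e = e :=
  MulAction.mem_stabilizer_iff

theorem homRep_smul_mem {n : ℕ} (hfin : ∀ x : X, Finite (MulAction.stabilizer G x))
    {L : OrbitCat G} {e : Cells hX n} (f : L ⟶ isotropy hfin e) :
    (homRep f • e : Cells hX n) ∈ (fixed hX L.subgroup).I n :=
  smul_mem_fixed_I (fun _ hl ↦ homRep_conj_mem f hl) (mem_fixed_I.2 le_rfl)

/-- The cells of `X^L` in the orbit of `e` come from morphisms `G ⧸ L → G ⧸ G_e`. -/
theorem exists_homRep_smul_eq {n : ℕ} (hfin : ∀ x : X, Finite (MulAction.stabilizer G x))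
    {L : OrbitCat G} {e e' : Cells hX n} (he' : e' ∈ (fixed hX L.subgroup).I n) {g : G}
    (h : g • e = e') : ∃ f : L ⟶ isotropy hfin e, homRep f • e = e' := by
  have hg : ∀ l ∈ L.subgroup, g⁻¹ * l * g ∈ (isotropy hfin e).subgroup := by
    intro l hl
    have := MulAction.mem_stabilizer_iff.1 (mem_fixed_I.1 he' hl)
    rw [← h] at this
    rw [mem_isotropy, mul_smul, mul_smul, this, inv_smul_smul]
  refine ⟨homOf g hg, ?_⟩
  have h2 := QuotientGroup.eq.1 ((mk_homRep _).trans (homPt_homOf g hg))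
  rw [mem_isotropy, mul_smul, inv_smul_eq_iff] at h2
  rw [← h, h2]

omit [T2Space X] in
theorem homRep_smul_injective {n : ℕ} (hfin : ∀ x : X, Finite (MulAction.stabilizer G x))
    {L : OrbitCat G} {e : Cells hX n} {f f' : L ⟶ isotropy hfin e}
    (h : homRep f • e = homRep f' • e) : f = f' := by
  refine homPt_injective ?_
  rw [← mk_homRep, ← mk_homRep, QuotientGroup.eq, mem_isotropy, mul_smul, ← h, inv_smul_smul]

/-- `C_n(X^L)` is free on the pairs of an orbit of `n`-cells and a morphism from `G ⧸ L` to the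
orbit: these correspond to the `n`-cells of `X^L`. -/
theorem bijective_cellGen_hom (hfin : ∀ x : X, Finite (MulAction.stabilizer G x)) (n : ℕ)
    (L : OrbitCat G) : Function.Bijective (liftFree
      fun p : Σ i : MulAction.orbitRel.Quotient G (Cells hX n), L ⟶ isotropy hfin i.out ↦
        cellGen (E := fixed hX L.subgroup) (homRep_smul_mem hfin p.2)
          (isCharMap_smul (isCharMap_charMap p.1.out) (homRep p.2))) := by
  let c : (Σ i : MulAction.orbitRel.Quotient G (Cells hX n), L ⟶ isotropy hfin i.out) →
    Cells hX n := fun p ↦ homRep p.2 • p.1.out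
  have hc : Function.Injective c := by
    rintro ⟨i, f⟩ ⟨j, f'⟩ h
    change homRep f • i.out = homRep f' • j.out at h
    have hij : i = j := by
      rw [← Quotient.out_eq i, ← Quotient.out_eq j]
      refine Quotient.sound ⟨(homRep f)⁻¹ * homRep f', ?_⟩
      change ((homRep f)⁻¹ * homRep f') • j.out = i.out
      rw [mul_smul, ← h, inv_smul_smul]
    subst hij
    rw [homRep_smul_injective hfin h]
  have hE : ∀ p, c p ∈ (fixed hX L.subgroup).I n := fun p ↦ homRep_smul_mem hfin p.2
  have hsurj : ∀ e ∈ (fixed hX L.subgroup).I n, ∃ p, c p = e := by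
    intro e he
    let i : MulAction.orbitRel.Quotient G (Cells hX n) := Quotient.mk _ e
    obtain ⟨g, hg⟩ := Quotient.exact (Quotient.out_eq i).symm
    obtain ⟨f, hf⟩ := exists_homRep_smul_eq hfin he hg
    exact ⟨⟨i, f⟩, hf⟩
  exact bijective_cellGen (E := fixed hX L.subgroup) hc hE hsurj
    fun p ↦ isCharMap_smul (isCharMap_charMap p.1.out) (homRep p.2)

/-- The class of a cell in the value of the module of cellular chains at its isotropy group. -/
noncomputable def isotropyGen (hfin : ∀ x : X, Finite (MulAction.stabilizer G x)) {n : ℕ}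
    (e : Cells hX n) : (cellMod hX n).obj (op (isotropy hfin e)) :=
  cellGen (E := fixed hX (isotropy hfin e).subgroup) (mem_fixed_I.2 le_rfl) (isCharMap_charMap e)

theorem map_isotropyGen (hfin : ∀ x : X, Finite (MulAction.stabilizer G x)) {n : ℕ}
    (e : Cells hX n) {L : OrbitCat G} (f : L ⟶ isotropy hfin e) :
    ((cellMod hX n).map f.op).hom (isotropyGen hfin e) =
      cellGen (E := fixed hX L.subgroup) (homRep_smul_mem hfin f)
        (isCharMap_smul (isCharMap_charMap e) (homRep f)) :=
  transl_cellGen (L := (isotropy hfin e).subgroup) (fun _ hl ↦ homRep_conj_mem f hl) _ _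

/-- The classes of representatives of the orbits of `n`-cells form a basis of the module of cellular
`n`-chains. -/
theorem isBasis_isotropyGen (hfin : ∀ x : X, Finite (MulAction.stabilizer G x)) (n : ℕ) :
    IsBasis (M := cellMod hX n) (I := MulAction.orbitRel.Quotient G (Cells hX n))
      (fun i ↦ isotropy hfin i.out) (fun i ↦ isotropyGen hfin i.out) := by
  intro L
  simp only [map_isotropyGen]
  exact bijective_cellGen_hom hfin n L

end Modules

end GCW

namespace Bredon

/-! ### The cellular resolution of the constant module -/

variable {G : Type u} [Group G]

/-- Exactness of a sequence of modules over the orbit category is tested on values. -/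
theorem exact_of_forall_obj (S : ShortComplex (OrbitMod G))
    (h : ∀ (L : (OrbitCat G)ᵒᵖ) (x : S.X₂.obj L), (S.g.app L).hom x = 0 →
      ∃ y, (S.f.app L).hom y = x) : S.Exact := by
  rw [ShortComplex.exact_iff_isZero_homology, Functor.isZero_iff]
  intro L
  have h1 : (S.map ((evaluation _ _).obj L)).Exact := by
    rw [ShortComplex.ab_exact_iff]
    exact h L
  rw [ShortComplex.exact_iff_isZero_homology] at h1
  exact h1.of_iso (S.mapHomologyIso ((evaluation _ _).obj L)).symm

end Bredon

namespace GCW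

open RelSing Cellular Bredon Topology.CWComplex

section Resolution

variable {G : Type u} [Group G] {X : Type u} [TopologicalSpace X] [MulAction G X]
  [T2Space X] [CWComplex (univ : Set X)]

/-- The cellular chain complexes of the fixed point sets, as a complex of modules. -/
noncomputable def cellComplex (hX : IsGCWComplex G X) : ChainComplex (OrbitMod G) ℕ :=
  ChainComplex.of (cellMod hX) (cellModBoundary hX) fun n ↦ by
    ext L : 2
    refine AddCommGrpCat.hom_ext (AddMonoidHom.ext fun x ↦ ?_)
    exact cellularBoundary_cellularBoundary _ n x

theorem cellComplex_d (hX : IsGCWComplex G X) (n : ℕ) :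
    (cellComplex hX).d (n + 1) n = cellModBoundary hX n :=
  ChainComplex.of_d _ _ _

theorem cellModBoundary_cellModAug (hX : IsGCWComplex G X) :
    (cellComplex hX).d 1 0 ≫ cellModAug hX = 0 := by
  rw [cellComplex_d]
  ext L : 2
  refine AddCommGrpCat.hom_ext (AddMonoidHom.ext fun x ↦ ?_)
  exact congrArg ULift.up (cellularAug_cellularBoundary x)

theorem contractible_fixed (hX : IsCocompactModel G X) (L : OrbitCat G) :
    ContractibleSpace (fixed hX.toIsGCWComplex L.subgroup : Set X) := by
  rw [coe_fixed]
  exact hX.contractible _ L.finite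

/-- The cellular chains of a cocompact model form a projective resolution of the constant module. -/
noncomputable def cellResolution (hX : IsCocompactModel G X) :
    ProjectiveResolution (trivMod G) where
  complex := cellComplex hX.toIsGCWComplex
  projective n := (isBasis_isotropyGen hX.finite_stabilizer n).projective
  π := (ChainComplex.toSingle₀Equiv _ _).symm
    ⟨cellModAug hX.toIsGCWComplex, cellModBoundary_cellModAug _⟩
  quasiIso := by
    obtain ⟨N, hN⟩ := exists_isEmpty_cell hX.toIsGCWComplex hX.cocompact
    refine ⟨fun n ↦ ?_⟩
    cases n with
    | zero =>
      rw [ChainComplex.quasiIsoAt₀_iff, ShortComplex.quasiIso_iff_of_zeros' _ rfl rfl rfl]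
      constructor
      · refine exact_of_forall_obj _ fun L x hx ↦ ?_
        have := contractible_fixed hX L.unop
        obtain ⟨y, hy⟩ := exists_cellularBoundary_eq_of_aug hN
          (x := (x : cellularChains (fixed hX.toIsGCWComplex L.unop.subgroup) 0))
          (ULift.up_injective hx)
        exact ⟨y, hy⟩
      · rw [NatTrans.epi_iff_epi_app]
        intro L
        rw [AddCommGrpCat.epi_iff_surjective]
        have := contractible_fixed hX L.unop
        intro m
        obtain ⟨x, hx⟩ := cellularAug_surjective
          (E := fixed hX.toIsGCWComplex L.unop.subgroup) hN m.down
        exact ⟨x, congrArg ULift.up hx⟩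
    | succ n =>
      rw [quasiIsoAt_iff_exactAt' (hL := ChainComplex.exactAt_succ_single_obj ..),
        HomologicalComplex.exactAt_iff' _ (n + 2) (n + 1) n (by simp) (by simp)]
      refine exact_of_forall_obj _ fun L x hx ↦ ?_
      have := contractible_fixed hX L.unop
      have hd := cellComplex_d hX.toIsGCWComplex
      obtain ⟨y, hy⟩ := exists_cellularBoundary_eq hN
        (x := (x : cellularChains (fixed hX.toIsGCWComplex L.unop.subgroup) (n + 1)))
        (by
          have : (((cellComplex hX.toIsGCWComplex).d (n + 1) n).app L).hom x = 0 := hx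
          rw [hd] at this
          exact this)
      refine ⟨y, ?_⟩
      change (((cellComplex hX.toIsGCWComplex).d (n + 2) (n + 1)).app L).hom y = x
      rw [hd]
      exact hy

end Resolution

end GCW

namespace Bredon

/-! ### The values of the quotient modules `Q_K` -/

section QuotMod

variable {G : Type u} [Group G]

theorem hom_eq_id {K : OrbitCat G} {f : K ⟶ K} (h : homPt f = ((1 : G) : G ⧸ K.subgroup)) :
    f = 𝟙 K :=
  homPt_injective (h.trans (homPt_id K).symm)

/-- A morphism `G ⧸ L → G ⧸ K` without a section comes from an inclusion of a conjugate of `L` as a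
proper subgroup of `K`. -/
theorem exists_section_or {L K : OrbitCat G} (b : L ⟶ K) :
    (∃ a : K ⟶ L, a ≫ b = 𝟙 K) ∨ IsConjToProper L.subgroup K.subgroup := by
  by_cases h : ∀ k ∈ K.subgroup, (homRep b)⁻¹⁻¹ * k * (homRep b)⁻¹ ∈ L.subgroup
  · refine .inl ⟨homOf _ h, hom_eq_id ?_⟩
    rw [homPt_comp, QuotientGroup.eq]
    have h1 : (homRep (homOf _ h))⁻¹ * (homRep b)⁻¹ ∈ L.subgroup :=
      QuotientGroup.eq.1 ((mk_homRep _).trans (homPt_homOf _ h))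
    have h2 := homRep_conj_mem b h1
    simpa [mul_assoc] using h2
  · refine .inr ⟨(homRep b)⁻¹, lt_of_le_of_ne ?_ fun h' ↦ h fun k hk ↦ ?_⟩
    · rintro _ ⟨l, hl, rfl⟩
      simpa using homRep_conj_mem b hl
    · rw [← h'] at hk
      obtain ⟨l, hl, rfl⟩ := hk
      simpa [mul_assoc] using hl

/-- A morphism `G ⧸ K → G ⧸ H` embeds `K` into `H`, so the finite group `H` has too many elements to
be conjugate to a proper subgroup of `K`. -/
theorem not_isConjToProper {K H : OrbitCat G} (a : K ⟶ H) :
    ¬ IsConjToProper H.subgroup K.subgroup := by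
  rintro ⟨g, hg⟩
  have := K.finite
  have := H.finite
  have h1 : Nat.card K.subgroup ≤ Nat.card H.subgroup :=
    Nat.card_le_card_of_injective
      (fun k : K.subgroup ↦ (⟨_, homRep_conj_mem a k.2⟩ : H.subgroup)) fun k k' h ↦
        Subtype.ext (by simpa using congrArg Subtype.val h)
  refine hg.ne (Subgroup.eq_of_le_of_card_ge hg.le (h1.trans_eq ?_))
  exact (Nat.card_congr (H.subgroup.equivMapOfInjective _ (MulAut.conj g).injective).toEquiv)

/-- Every endomorphism of `G ⧸ K` is split, because `K` is finite. -/
theorem exists_section_endo {K : OrbitCat G} (e : K ⟶ K) : ∃ s : K ⟶ K, s ≫ e = 𝟙 K :=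
  (exists_section_or e).resolve_right (not_isConjToProper (𝟙 K))

/-- One-sided inverses in the orbit category of finite subgroups are two-sided. -/
theorem comp_eq_id_symm {K L : OrbitCat G} {a : K ⟶ L} {b : L ⟶ K} (h : a ≫ b = 𝟙 K) :
    b ≫ a = 𝟙 L := by
  obtain ⟨s, hs⟩ := exists_section_endo (b ≫ a)
  have h1 : (b ≫ a) ≫ (b ≫ a) = b ≫ a := by
    rw [Category.assoc, reassoc_of% h]
  calc b ≫ a = (s ≫ b ≫ a) ≫ b ≫ a := by rw [hs, Category.id_comp]
    _ = s ≫ (b ≫ a) ≫ b ≫ a := Category.assoc _ _ _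
    _ = 𝟙 L := by rw [h1, hs]

/-- If there are morphisms in both directions, then each of them is invertible. -/
theorem exists_retraction {K L : OrbitCat G} (a : K ⟶ L) (b : L ⟶ K) :
    ∃ b' : L ⟶ K, a ≫ b' = 𝟙 K := by
  obtain ⟨s, hs⟩ := exists_section_endo (a ≫ b)
  exact ⟨b ≫ s, (Category.assoc _ _ _).symm.trans (comp_eq_id_symm hs)⟩

/-- `N_K(G ⧸ L) = 0` if there is a morphism `G ⧸ K → G ⧸ L`. -/
theorem properSub_eq_bot {K L : OrbitCat G} (a : K ⟶ L) : properSub K (op L) = ⊥ := by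
  refine AddSubgroup.closure_eq_bot_iff.2 ?_
  rintro _ ⟨H, hH, f, -⟩
  exact (not_isConjToProper (a ≫ f) hH).elim

/-- `N_K(G ⧸ L) = P_K(G ⧸ L)` if `L` is conjugate to a proper subgroup of `K`. -/
theorem properSub_eq_top {K L : OrbitCat G} (h : IsConjToProper L.subgroup K.subgroup) :
    properSub K (op L) = ⊤ := by
  refine (AddSubgroup.eq_top_iff' _).2 fun x ↦ AddSubgroup.subset_closure ⟨L, h, 𝟙 L, x, ?_⟩
  exact (congrArg (fun φ ↦ φ.hom x) ((freeMod K).map_id (op L))).symm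

/-- The class in `Q_K(G ⧸ L)` of a combination of morphisms `G ⧸ L → G ⧸ K`. -/
noncomputable def quotMk (K L : OrbitCat G) : ((L ⟶ K) →₀ ℤ) →+ (quotMod K).obj (op L) :=
  show (freeMod K).obj (op L) →+ (freeMod K).obj (op L) ⧸ properSub K (op L) from
    QuotientAddGroup.mk' _

theorem quotMk_surjective (K L : OrbitCat G) : Function.Surjective (quotMk K L) :=
  QuotientAddGroup.mk_surjective (s := properSub K (op L))

theorem map_quotMk (K : OrbitCat G) {L L' : OrbitCat G} (f : L' ⟶ L) (x : (L ⟶ K) →₀ ℤ) :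
    ((quotMod K).map f.op).hom (quotMk K L x) = quotMk K L' (x.mapDomain fun b ↦ f ≫ b) := rfl

/-- The coefficient of the identity, as a function on `Q_K(G ⧸ K)`. -/
noncomputable def coeffId (K : OrbitCat G) : (quotMod K).obj (op K) →+ ℤ :=
  QuotientAddGroup.lift (properSub K (op K)) (Finsupp.applyAddHom (𝟙 K)) (by
    rw [properSub_eq_bot (𝟙 K)]
    exact bot_le)

theorem coeffId_quotMk (K : OrbitCat G) (x : (K ⟶ K) →₀ ℤ) :
    coeffId K (quotMk K K x) = x (𝟙 K) := rfl

/-- For mutually inverse `a` and `b`, the coefficient of the identity after restriction along `a` is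
the coefficient of `b`. -/
theorem coeffId_map_quotMk {K L : OrbitCat G} {a : K ⟶ L} {b : L ⟶ K} (h : a ≫ b = 𝟙 K)
    (x : (L ⟶ K) →₀ ℤ) : coeffId K (((quotMod K).map a.op).hom (quotMk K L x)) = x b := by
  rw [map_quotMk, coeffId_quotMk, ← h]
  refine Finsupp.mapDomain_apply (fun c c' hc ↦ ?_) x b
  have := congrArg (b ≫ ·) hc
  simpa only [← Category.assoc, comp_eq_id_symm h, Category.id_comp] using this

theorem quotMod_eq_zero_of_isEmpty {K L : OrbitCat G} (h : IsEmpty (L ⟶ K))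
    (x : (quotMod K).obj (op L)) : x = 0 := by
  obtain ⟨x, rfl⟩ := quotMk_surjective K L x
  rw [Subsingleton.elim x 0, map_zero]

/-- An element of `Q_K(G ⧸ L)` is determined by the coefficients of the identity in its images in
`Q_K(G ⧸ K)`. -/
theorem quotMod_eq_zero {K L : OrbitCat G} {x : (quotMod K).obj (op L)}
    (h : ∀ a : K ⟶ L, coeffId K (((quotMod K).map a.op).hom x) = 0) : x = 0 := by
  obtain ⟨x, rfl⟩ := quotMk_surjective K L x
  by_cases hL : IsConjToProper L.subgroup K.subgroup
  · refine (QuotientAddGroup.eq_zero_iff (N := properSub K (op L))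
      (x : (freeMod K).obj (op L))).2 ?_
    rw [properSub_eq_top hL]
    exact AddSubgroup.mem_top x
  · have : x = 0 := by
      ext b
      obtain ⟨a, ha⟩ := (exists_section_or b).resolve_right hL
      rw [← coeffId_map_quotMk ha, h a]
      rfl
    rw [this, map_zero]

/-- Only finitely many morphisms have a nonzero coefficient at a given element. -/
theorem finite_coeffId_ne_zero {K L : OrbitCat G} (x : (quotMod K).obj (op L)) :
    {a : K ⟶ L | coeffId K (((quotMod K).map a.op).hom x) ≠ 0}.Finite := by
  classical
  obtain ⟨x, rfl⟩ := quotMk_surjective K L x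
  refine (x.support.finite_toSet.biUnion (t := fun b ↦ {a : K ⟶ L | a ≫ b = 𝟙 K})
    fun b _ ↦ Set.Subsingleton.finite fun a ha a' ha' ↦ ?_).subset fun a ha ↦ ?_
  · have h1 : a ≫ b = 𝟙 K := ha
    have h2 : a' ≫ b = 𝟙 K := ha'
    calc a = a ≫ b ≫ a' := by rw [comp_eq_id_symm h2, Category.comp_id]
      _ = a' := by rw [reassoc_of% h1]
  · rw [mem_ofPred_eq, map_quotMk, coeffId_quotMk] at ha
    have h1 := Finsupp.mapDomain_support (Finsupp.mem_support_iff.2 ha)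
    obtain ⟨b, hb, hab⟩ := Finset.mem_image.1 h1
    exact mem_biUnion (Finset.mem_coe.2 hb) hab

end QuotMod

end Bredon

namespace Cellular

open RelSing SingularChains FreeChains Topology.CWComplex

/-! ### Compactly supported cochains in terms of generators -/

section Cochains

variable {X : Type u} [TopologicalSpace X] [T2Space X] [CWComplex (univ : Set X)]
  {A E : Subcomplex (univ : Set X)} {n : ℕ}

/-- Whether a cochain vanishes at a cell does not depend on the parametrisation of the cell. -/
theorem apply_cellGen_eq_zero_iff (φ : cellularChains E n →+ ℤ) {e : cell (univ : Set X) n}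
    {ψ ψ' : C(Disc.{u} n, X)} (hE : e ∈ E.I n) (hψ : IsCharMap e ψ) (hψ' : IsCharMap e ψ') :
    φ (cellGen hE hψ) = 0 ↔ φ (cellGen hE hψ') = 0 := by
  constructor <;> intro h
  · obtain ⟨m, hm⟩ := exists_cellGen_eq_zsmul hE hψ hψ'
    rw [hm, map_zsmul, h, smul_zero]
  · obtain ⟨m, hm⟩ := exists_cellGen_eq_zsmul hE hψ' hψ
    rw [hm, map_zsmul, h, smul_zero]

theorem comp_cellMap_eq_zero_iff (φ : cellularChains E n →+ ℤ) (e : E.I n) :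
    φ.comp (cellMap E e) = 0 ↔ φ (cellGen e.2 (isCharMap_charMap e.1)) = 0 := by
  constructor
  · intro h
    exact DFunLike.congr_fun h (discGen n)
  · intro h
    refine AddMonoidHom.ext fun x ↦ ?_
    rw [eq_zsmul_discGen x, map_zsmul, AddMonoidHom.comp_apply]
    refine (congrArg _ ?_).trans (smul_zero _)
    exact h

theorem I_subset (h : A ≤ E) : A.I n ⊆ E.I n := fun e he ↦
  mem_I_of_mem (RelCWComplex.map_zero_mem_openCell n e)
    (h (CWComplex.Subcomplex.openCell_subset_of_mem A he
      (RelCWComplex.map_zero_mem_openCell n e)))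

theorem cellularIncl_cellGen (h : A ≤ E) {e : cell (univ : Set X) n} (he : e ∈ A.I n)
    {ψ : C(Disc.{u} n, X)} (hψ : IsCharMap e ψ) :
    cellularIncl h n (cellGen he hψ) = cellGen (I_subset h he) hψ :=
  relHomologyMap_comp _ _ _ _ _ _ _ _

theorem comp_cellularIncl_eq_zero_iff (h : A ≤ E) (φ : cellularChains E n →+ ℤ) :
    φ.comp (cellularIncl h n) = 0 ↔
      ∀ e (he : e ∈ A.I n), φ (cellGen (I_subset h he) (isCharMap_charMap e)) = 0 := by
  constructor
  · intro h0 e he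
    rw [← cellularIncl_cellGen h he]
    exact DFunLike.congr_fun h0 _
  · intro h0
    refine AddMonoidHom.ext fun x ↦ ?_
    obtain ⟨c, rfl⟩ := (bijective_cellGen (E := A) (c := fun e : A.I n ↦ e.1)
      Subtype.val_injective (fun e ↦ e.2) (fun e he ↦ ⟨⟨e, he⟩, rfl⟩)
      (fun e ↦ isCharMap_charMap e.1)).2 x
    refine hom_congr (f := (φ.comp (cellularIncl h n)).comp (liftFree _)) (g := 0) (fun e ↦ ?_) c
    rw [AddMonoidHom.comp_apply, liftFree_single, AddMonoidHom.comp_apply, cellularIncl_cellGen]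
    exact h0 e.1 e.2

/-- Compactly supported cochains relative to `A` in terms of their values at cells. -/
theorem mem_compactCochains_iff (h : A ≤ E) {φ : cellularChains E n →+ ℤ} :
    φ ∈ compactCochains h n ↔
      {e : E.I n | φ (cellGen e.2 (isCharMap_charMap e.1)) ≠ 0}.Finite ∧
      ∀ e (he : e ∈ A.I n), φ (cellGen (I_subset h he) (isCharMap_charMap e)) = 0 := by
  change {e : E.I n | φ.comp (cellMap E e) ≠ 0}.Finite ∧ φ.comp (cellularIncl h n) = 0 ↔ _
  rw [comp_cellularIncl_eq_zero_iff]
  simp only [ne_eq, comp_cellMap_eq_zero_iff]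

end Cochains

end Cellular

namespace GCW

open RelSing SingularChains FreeChains Cellular Bredon Topology.CWComplex

/-! ### Homomorphisms into `Q_K` are compactly supported cochains -/

section Cochains

variable {G : Type u} [Group G] {X : Type u} [TopologicalSpace X] [MulAction G X]
  [T2Space X] [CWComplex (univ : Set X)] {hX : IsGCWComplex G X} {n : ℕ}

/-- The cochain on `X^K` attached to a morphism into `Q_K`: the coefficient of the identity in the
value at `G ⧸ K`. -/
noncomputable def toCochain (hX : IsGCWComplex G X) (n : ℕ) (K : OrbitCat G) :
    (cellMod hX n ⟶ quotMod K) →+ (cellularChains (fixed hX K.subgroup) n →+ ℤ) where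
  toFun f := (coeffId K).comp (f.app (op K)).hom
  map_zero' := by
    refine AddMonoidHom.ext fun x ↦ ?_
    exact map_zero (coeffId K)
  map_add' f g := by
    refine AddMonoidHom.ext fun x ↦ ?_
    exact map_add (coeffId K) _ _

variable (hfin : ∀ x : X, Finite (MulAction.stabilizer G x)) {K : OrbitCat G}

theorem toCochain_cellGen (f : cellMod hX n ⟶ quotMod K) (e : Cells hX n)
    (a : K ⟶ isotropy hfin e) :
    toCochain hX n K f (cellGen (homRep_smul_mem hfin a)
      (isCharMap_smul (isCharMap_charMap e) (homRep a))) =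
      coeffId K (((quotMod K).map a.op).hom ((f.app _).hom (isotropyGen hfin e))) := by
  rw [← map_isotropyGen]
  exact congrArg (coeffId K) (congrArg (fun φ ↦ φ.hom (isotropyGen hfin e)) (f.naturality a.op))

include hfin in
/-- A morphism into `Q_K` is determined by its values at the classes of the cells in their isotropy
groups, and these values by their coefficients at the morphisms from `G ⧸ K`. -/
theorem toCochain_injective : Function.Injective (toCochain hX n K) := by
  rw [injective_iff_map_eq_zero]
  intro f hf
  refine (isBasis_isotropyGen hfin n).hom_ext fun i ↦ quotMod_eq_zero fun a ↦ ?_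
  rw [← toCochain_cellGen, hf]
  rfl

theorem isEmpty_hom_of_lt {L : OrbitCat G} (h : K.subgroup < L.subgroup) : IsEmpty (L ⟶ K) := by
  have h1 : K.subgroup.map (MulAut.conj 1).toMonoidHom = K.subgroup := by
    ext x
    constructor
    · rintro ⟨l, hl, rfl⟩
      simpa using hl
    · exact fun hx ↦ ⟨x, hx, by simp⟩
  exact ⟨fun b ↦ not_isConjToProper b ⟨1, by rwa [h1]⟩⟩

include hfin in
/-- Each `n`-cell of `X^K` is the translate, along a morphism of the orbit category, of the
representative of its orbit. -/
theorem exists_homRep_eq {e : Cells hX n} (he : e ∈ (fixed hX K.subgroup).I n) :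
    ∃ (i : MulAction.orbitRel.Quotient G (Cells hX n)) (a : K ⟶ isotropy hfin i.out),
      homRep a • i.out = e := by
  obtain ⟨g, hg⟩ := Quotient.exact
    (Quotient.out_eq (Quotient.mk (MulAction.orbitRel G (Cells hX n)) e)).symm
  obtain ⟨a, ha⟩ := exists_homRep_smul_eq hfin he hg
  exact ⟨_, a, ha⟩

/-- Let `L` be the isotropy group of a cell `e`. The values of a cochain at the translates of `e` in
`X^K`, which correspond to the morphisms `a : G ⧸ K → G ⧸ L`, are the coefficients of a combination
of morphisms `G ⧸ L → G ⧸ K`, each at the inverse of `a` if there is one; compact support makes the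
combination finite. -/
theorem exists_coeff {e : Cells hX n} {φ : cellularChains (fixed hX K.subgroup) n →+ ℤ}
    (hφ : {e : (fixed hX K.subgroup).I n |
      φ (cellGen e.2 (isCharMap_charMap e.1)) ≠ 0}.Finite) :
    ∃ p : (isotropy hfin e ⟶ K) →₀ ℤ, ∀ a b, a ≫ b = 𝟙 K →
      p b = φ (cellGen (homRep_smul_mem hfin a)
        (isCharMap_smul (isCharMap_charMap e) (homRep a))) := by
  classical
  let ψ (a : K ⟶ isotropy hfin e) : ℤ := φ (cellGen (homRep_smul_mem hfin a)
    (isCharMap_smul (isCharMap_charMap e) (homRep a)))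
  have h1 : {a | ψ a ≠ 0}.Finite := by
    refine Set.Finite.of_finite_image (f := fun a ↦
      (⟨homRep a • e, homRep_smul_mem hfin a⟩ : (fixed hX K.subgroup).I n))
      (hφ.subset ?_) ?_
    · rintro _ ⟨a, ha, rfl⟩
      exact fun h ↦ ha ((apply_cellGen_eq_zero_iff φ _ _ _).1 h)
    · intro a _ a' _ h
      exact homRep_smul_injective hfin (congrArg Subtype.val h)
  -- A morphism has at most one inverse, so each coefficient comes from one translate.
  have huniq : ∀ {a : K ⟶ isotropy hfin e} {b b'}, a ≫ b = 𝟙 K → a ≫ b' = 𝟙 K → b = b' := by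
    intro a b b' h h'
    calc b = (b ≫ a) ≫ b' := by rw [Category.assoc, h', Category.comp_id]
      _ = b' := by rw [comp_eq_id_symm h, Category.id_comp]
  let q (b : isotropy hfin e ⟶ K) : ℤ := if h : ∃ a, a ≫ b = 𝟙 K then ψ h.choose else 0
  have h2 : (Function.support q).Finite := by
    refine (h1.biUnion (t := fun a ↦ {b | a ≫ b = 𝟙 K}) fun a _ ↦
      Set.Subsingleton.finite fun b hb b' hb' ↦ huniq hb hb').subset fun b hb ↦ ?_
    by_cases h : ∃ a, a ≫ b = 𝟙 K
    · rw [Function.mem_support, show q b = ψ h.choose from dif_pos h] at hb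
      exact mem_biUnion hb h.choose_spec
    · exact (hb (dif_neg h)).elim
  refine ⟨Finsupp.ofSupportFinite q h2, fun a b hab ↦ ?_⟩
  have h : ∃ a, a ≫ b = 𝟙 K := ⟨a, hab⟩
  have h3 : h.choose = a := by
    have := h.choose_spec
    calc h.choose = h.choose ≫ b ≫ a := by rw [comp_eq_id_symm hab, Category.comp_id]
      _ = a := by rw [reassoc_of% this]
  change q b = ψ a
  rw [show q b = ψ h.choose from dif_pos h, h3]

/-- If `G ⧸ L` does not map to `G ⧸ K`, where `L` is the isotropy group of `e`, then the translates
of `e` in `X^K` are singular. -/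
theorem lt_stabilizer {e : Cells hX n} {a : K ⟶ isotropy hfin e}
    (h : IsEmpty (isotropy hfin e ⟶ K)) :
    K.subgroup < MulAction.stabilizer G (homRep a • e : Cells hX n) := by
  refine lt_of_le_of_ne (mem_fixed_I.1 (homRep_smul_mem hfin a)) fun heq ↦ h.false ?_
  refine homOf (homRep a)⁻¹ fun l hl ↦ ?_
  rw [heq, MulAction.mem_stabilizer_iff, mul_smul, mul_smul, inv_smul_smul, inv_inv,
    mem_isotropy.1 hl]

include hfin in
/-- The cochain of a morphism into `Q_K` has compact support, since there are finitely many orbits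
of cells and an element of `Q_K(G ⧸ L)` has finitely many coefficients. It vanishes on the singular
cells, since `Q_K(G ⧸ L) = 0` unless `G ⧸ L` maps to `G ⧸ K`. -/
theorem toCochain_mem (hcpt : CompactSpace (MulAction.orbitRel.Quotient G X))
    (f : cellMod hX n ⟶ quotMod K) :
    toCochain hX n K f ∈ compactCochains (sing_le_fixed hX K.subgroup) n := by
  rw [mem_compactCochains_iff]
  constructor
  · have := finite_orbits (hX := hX) hcpt n
    have h1 : ∀ i : MulAction.orbitRel.Quotient G (Cells hX n), {a : K ⟶ isotropy hfin i.out |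
        coeffId K (((quotMod K).map a.op).hom
          ((f.app _).hom (isotropyGen hfin i.out))) ≠ 0}.Finite := fun i ↦ finite_coeffId_ne_zero _
    refine (Set.finite_iUnion fun i ↦ (h1 i).image fun a ↦
      (⟨homRep a • i.out, homRep_smul_mem hfin a⟩ : (fixed hX K.subgroup).I n)).subset ?_
    rintro ⟨e, he⟩ h
    obtain ⟨i, a, rfl⟩ := exists_homRep_eq hfin he
    refine mem_iUnion.2 ⟨i, a, fun h0 ↦ h ?_, rfl⟩
    rw [← toCochain_cellGen] at h0
    exact (apply_cellGen_eq_zero_iff _ _ _ _).1 h0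
  · intro e he
    have he' := I_subset (sing_le_fixed hX K.subgroup) he
    obtain ⟨i, a, rfl⟩ := exists_homRep_eq hfin he'
    have h0 : IsEmpty (isotropy hfin i.out ⟶ K) := by
      refine ⟨fun b ↦ ?_⟩
      refine (isEmpty_hom_of_lt (K := K) (L := isotropy hfin (homRep a • i.out : Cells hX n))
        ((mem_sing_I hfin).1 he)).false (homOf (homRep a) (fun l hl ↦ ?_) ≫ b)
      rw [mem_isotropy] at hl ⊢
      rw [mul_smul, mul_smul, hl, inv_smul_smul]
    refine (apply_cellGen_eq_zero_iff _ _ _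
      (isCharMap_smul (isCharMap_charMap i.out) (homRep a))).2 ?_
    rw [toCochain_cellGen, quotMod_eq_zero_of_isEmpty h0 ((f.app _).hom (isotropyGen hfin i.out)),
      map_zero, map_zero]

include hfin in
/-- Every compactly supported cochain of `X^K` that vanishes on the singular part comes from a
morphism into `Q_K`, prescribed on the basis given by representatives of the orbits of cells. -/
theorem exists_toCochain_eq {φ : cellularChains (fixed hX K.subgroup) n →+ ℤ}
    (hφ : φ ∈ compactCochains (sing_le_fixed hX K.subgroup) n) :
    ∃ f, toCochain hX n K f = φ := by
  rw [mem_compactCochains_iff] at hφ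
  choose p hp using fun e : Cells hX n ↦ exists_coeff hfin (e := e) hφ.1
  obtain ⟨f, hf⟩ := (isBasis_isotropyGen hfin n).exists_hom (N := quotMod K)
    fun i ↦ quotMk K _ (p i.out)
  refine ⟨f, ?_⟩
  refine AddMonoidHom.ext fun x ↦ ?_
  obtain ⟨c, rfl⟩ := (bijective_cellGen_hom hfin n K).2 x
  refine hom_congr (f := (toCochain hX n K f).comp (liftFree _)) (g := φ.comp (liftFree _))
    (fun ia ↦ ?_) c
  rw [AddMonoidHom.comp_apply, AddMonoidHom.comp_apply, liftFree_single, toCochain_cellGen, hf]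
  by_cases h : Nonempty (isotropy hfin ia.1.out ⟶ K)
  -- Either the isotropy group is conjugate to `K`, or the cell is singular and both sides vanish.
  · obtain ⟨b, hb⟩ := exists_retraction ia.2 h.some
    rw [coeffId_map_quotMk hb, hp _ _ _ hb]
  · rw [not_nonempty_iff] at h
    rw [quotMod_eq_zero_of_isEmpty h (quotMk K _ _), map_zero, map_zero]
    exact ((apply_cellGen_eq_zero_iff _ _ _ (isCharMap_charMap _)).2
      (hφ.2 _ ((mem_sing_I hfin).2 (lt_stabilizer hfin h)))).symm

/-- The identification of morphisms with cochains is compatible with the differentials. -/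
theorem toCochain_cellModBoundary (f : cellMod hX n ⟶ quotMod K) :
    toCochain hX (n + 1) K (cellModBoundary hX n ≫ f) =
      coboundary (fixed hX K.subgroup) n (toCochain hX n K f) := rfl

end Cochains

end GCW

/-! ### Comparison of the cohomology groups -/

theorem nonempty_quotient_addEquiv {R : Type} {M T : Type u} [Ring R] [AddCommGroup M] [Module R M]
    [AddCommGroup T] (e : M ≃+ T) {P : Submodule R M} {B : AddSubgroup T}
    (h : ∀ x, x ∈ P ↔ e x ∈ B) : Nonempty ((M ⧸ P) ≃+ T ⧸ B) :=
  ⟨QuotientAddGroup.congr P.toAddSubgroup B e (by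
    ext y
    constructor
    · rintro ⟨x, hx, rfl⟩
      exact (h x).1 hx
    · intro hy
      exact ⟨e.symm y, (h _).2 (by rwa [e.apply_symm_apply]), e.apply_symm_apply y⟩)⟩

/-- An injection of the middle term of a short complex of modules that matches its kernel
with `Z` and its image with `B` identifies its homology with `Z ⧸ B`. -/
theorem nonempty_homology_addEquiv {R : Type} [Ring R] (S : ShortComplex (ModuleCat.{u} R))
    {T : Type u}
    [AddCommGroup T] (Ψ : S.X₂ →+ T) {Z B : AddSubgroup T} (hΨ : Function.Injective Ψ)
    (hZ : ∀ x, S.g.hom x = 0 ↔ Ψ x ∈ Z) (hZ' : Z ≤ Ψ.range)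
    (hB : ∀ y, y ∈ B ↔ ∃ x, Ψ (S.f.hom x) = y) :
    Nonempty (S.homology ≃+ Z ⧸ B.addSubgroupOf Z) := by
  let e : LinearMap.ker S.g.hom ≃+ Z := AddEquiv.ofBijective
    ((Ψ.comp (LinearMap.ker S.g.hom).subtype.toAddMonoidHom).codRestrict Z fun x ↦ (hZ _).1 x.2)
    ⟨fun x y h ↦ Subtype.ext (hΨ (congrArg Subtype.val h)), fun ⟨y, hy⟩ ↦ by
      obtain ⟨x, rfl⟩ := hZ' hy
      exact ⟨⟨x, (hZ x).2 hy⟩, rfl⟩⟩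
  obtain ⟨e'⟩ := nonempty_quotient_addEquiv e (P := LinearMap.range S.moduleCatToCycles)
    (B := B.addSubgroupOf Z) fun y ↦ by
      rw [AddSubgroup.mem_addSubgroupOf, hB]
      constructor
      · rintro ⟨x, rfl⟩
        exact ⟨x, rfl⟩
      · rintro ⟨x, hx⟩
        exact ⟨x, Subtype.ext (hΨ hx)⟩
  exact ⟨S.moduleCatHomologyIso.toLinearEquiv.toAddEquiv.trans e'⟩

namespace GCW

open RelSing SingularChains FreeChains Cellular Bredon Topology.CWComplex

section Cohomology

variable {G : Type u} [Group G] {X : Type u} [TopologicalSpace X] [MulAction G X]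
  [T2Space X] [CWComplex (univ : Set X)]

/-- The cohomology of `Hom(C_*(X^?), Q_K)` is that of the compactly supported cochains of
`(X^K, X^K_sing)`. -/
theorem nonempty_homology_linearYonedaObj_addEquiv (hX : IsCocompactModel G X) (K : OrbitCat G)
    (n : ℕ) :
    Nonempty ((((cellComplex hX.toIsGCWComplex).linearYonedaObj ℤ (quotMod K)).homology n) ≃+
      compactCohomology (sing_le_fixed hX.toIsGCWComplex K.subgroup) n) := by
  set C := (cellComplex hX.toIsGCWComplex).linearYonedaObj ℤ (quotMod K) with hC
  have hfin := hX.finite_stabilizer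
  have hd : ∀ (m : ℕ) (f : cellMod hX.toIsGCWComplex m ⟶ quotMod K),
      toCochain hX.toIsGCWComplex (m + 1) K ((C.d m (m + 1)).hom f) =
        coboundary _ m (toCochain hX.toIsGCWComplex m K f) := by
    intro m f
    rw [← toCochain_cellModBoundary, ← cellComplex_d]
    rfl
  have hker : ∀ f : cellMod hX.toIsGCWComplex n ⟶ quotMod K, (C.d n (n + 1)).hom f = 0 ↔
      toCochain hX.toIsGCWComplex n K f ∈
        compactCocycles (sing_le_fixed hX.toIsGCWComplex K.subgroup) n := by
    intro f
    refine ⟨fun h ↦ ⟨toCochain_mem hfin hX.cocompact f, ?_⟩, fun h ↦ ?_⟩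
    · refine (hd n f).symm.trans ?_
      rw [h]
      exact map_zero _
    · refine toCochain_injective hfin ((hd n f).trans ?_)
      exact h.2.trans (map_zero _).symm
  have hrange : compactCocycles (sing_le_fixed hX.toIsGCWComplex K.subgroup) n ≤
      (toCochain hX.toIsGCWComplex n K).range := fun φ hφ ↦ exists_toCochain_eq hfin hφ.1
  cases n with
  | zero =>
    -- In degree `0` the incoming map is the zero map `d 0 0`.
    obtain ⟨e⟩ := nonempty_homology_addEquiv (C.sc' 0 0 1)
      (toCochain hX.toIsGCWComplex 0 K) (B := ⊥) (toCochain_injective hfin) hker hrange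
      (fun y ↦ by
        rw [AddSubgroup.mem_bot]
        have h0 : ∀ f, (C.d 0 0).hom f = 0 := fun f ↦ by
          rw [C.shape 0 0 (by simp)]
          rfl
        constructor
        · rintro rfl
          exact ⟨0, (congrArg (toCochain hX.toIsGCWComplex 0 K) (h0 0)).trans (map_zero _)⟩
        · rintro ⟨f, rfl⟩
          exact (congrArg (toCochain hX.toIsGCWComplex 0 K) (h0 f)).trans (map_zero _))
    exact ⟨(C.homologyIsoSc' 0 0 1 (by simp) (by simp)).toLinearEquiv.toAddEquiv.trans e⟩
  | succ n =>
    obtain ⟨e⟩ := nonempty_homology_addEquiv (C.sc' n (n + 1) (n + 2))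
      (toCochain hX.toIsGCWComplex (n + 1) K)
      (B := (compactCochains (sing_le_fixed hX.toIsGCWComplex K.subgroup) n).map
        (coboundary _ n)) (toCochain_injective hfin) hker hrange
      (fun y ↦ by
        constructor
        · rintro ⟨φ, hφ, rfl⟩
          obtain ⟨f, rfl⟩ := exists_toCochain_eq hfin hφ
          exact ⟨f, hd n f⟩
        · rintro ⟨f, rfl⟩
          exact ⟨_, toCochain_mem hfin hX.cocompact f, (hd n f).symm⟩)
    exact ⟨(C.homologyIsoSc' n (n + 1) (n + 2) (by simp) (by simp)).toLinearEquiv.toAddEquiv.trans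
      e⟩

end Cohomology

end GCW

theorem mainTheorem2 (G : Type u) [Group G] (X : Type u) [TopologicalSpace X] [T2Space X]
    [MulAction G X] [Topology.CWComplex (Set.univ : Set X)] (hX : GCW.IsCocompactModel G X)
    (K : Subgroup G) (hK : Finite K) (n : ℕ) :
    Nonempty (Bredon.cohomology n (Bredon.quotMod (⟨K, hK⟩ : Bredon.OrbitCat G)) ≃+
      Cellular.compactCohomology (GCW.sing_le_fixed hX.toIsGCWComplex K) n) := by
  obtain ⟨e⟩ := GCW.nonempty_homology_linearYonedaObj_addEquiv hX ⟨K, hK⟩ n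
  exact ⟨((GCW.cellResolution hX).isoExt n (Bredon.quotMod
    (⟨K, hK⟩ : Bredon.OrbitCat G))).toLinearEquiv.toAddEquiv.trans e⟩
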